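/- Let $\Sigma$ be a compact connected translation surface with set of conical singularities $\mathfrak B\neq\emptyset$: thus $\Sigma$ is a compact connected Hausdorff space, $\Sigma\smallsetminus\mathfrak B$ has an atlas of charts to open subsets of $\mathbb R^2=\mathbb C$ whose transition maps are locally translations, and each $\mathfrak b\in\mathfrak B$ has a cone angle $2\pi k$ with $k\ge 1$ an integer (marked points, $k=1$, are allowed), that is, there is a coordinate $w$ around $\mathfrak b$ with $w(\mathfrak b)=0$ such that $w^k$ is locally, up to translation, a chart near all other points. A vertical leaf is forward-critical (backward-critical) if the upward (downward) unit-speed vertical flow carries its points into a singularity in finite time. Let $\mathfrak W$ be the union of all critical leaves. A saddle connection is a leaf that is critical in both directions. For an open interval $I\subset\mathbb R$ and $W\subset I$, the divided interval $\hat I$ is obtained from $I$ by replacing each $w\in W$ by three points $w^-<\hat w<w^+$ (left lane, median, right lane), with the topology generated by the non-empty open intervals $(a,b)$, $a,b\in\hat I$, in which $a$ is not of the form $w^-$ and $b$ is not of the form $w^+$. The divided surface $\hat\Sigma$ is glued from (i) the divided flow boxes $\hat I\times L$, for all open rectangles $I\times L$ with vertical and horizontal sides in $\Sigma\smallsetminus\mathfrak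 B$, where $I$ is divided at the positions of the critical leaves, and (ii) divided charts at the singularities. The latter are, for each $\mathfrak b$ of cone angle $2\pi k$ and each of the $2k$ half-discs into which the critical leaves cut a neighbourhood of $\mathfrak b$, divided half-open boxes whose edge is the adjacent lane of the critical leaves that bound the half-disc. This edge runs from a lane of a forward-critical leaf, through a lane point over $\mathfrak b$, into the same-side lane of a backward-critical leaf. So there are $2k$ lane points and no median over $\mathfrak b$. The fractured surface is the subspace of $\hat\Sigma$ that remains when the medians of all critical leaves are removed. The vertical flow $\psi^t$ on $\hat\Sigma$ is the partially defined flow generated by the local flows $(s,\zeta)\mapsto(s,\zeta+t)$ in the charts (i) and (ii). Suppose that $\Sigma$ has no saddle connections. Then the fractured surface is a compact Hausdorff space, it is invariant under the vertical flow, which acts on it as a continuous flow by homeomorphisms defined for all times $t\in\mathbb R$, and the forward and backward vertical flows on it are both minimal: for every point $p$ of the fractured surface, including the points of the left and right lanes of critical leaves and the lane points over singularities, both the forward orbit $\{\psi^t p: t\ge 0\}$ and the backward orbit $\{\psi^{t}p:t\le 0\}$ are dense in the fractured surface. -/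

import Mathlib

open Set Filter Topology

noncomputable section

universe u

/-! ### Translation surfaces -/

/-- A translation structure with conical singularities on a space `X` (later: compact, connected
and Hausdorff). The model plane is `ℂ`, the vertical direction is that of the imaginary axis.
Off the set `sing` of singularities there is an atlas whose transition maps are locally
translations. Around a singularity `b` there is a coordinate `w = cone b` with `w(b) = 0` such that
`w ^ order b` is, up to translation, a chart of the atlas near every other point: this is
a conical singularity of cone angle `2 π * order b`. The value `order b = 1` is allowed
(a marked point). -/
structure TranslationSurface (X : Type u) [TopologicalSpace X] where
  sing : Set X
  atlas : Set (OpenPartialHomeomorph X ℂ)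
  atlas_source : ∀ c ∈ atlas, c.source ⊆ singᶜ
  atlas_cover : ∀ x ∉ sing, ∃ c ∈ atlas, x ∈ c.source
  atlas_compat : ∀ c ∈ atlas, ∀ c' ∈ atlas, ∀ x ∈ c.source ∩ c'.source,
    ∃ v : ℂ, ∀ᶠ y in 𝓝 x, c' y = c y + v
  order : sing → ℕ
  order_pos : ∀ b, 0 < order b
  cone : sing → OpenPartialHomeomorph X ℂ
  mem_cone_source : ∀ b, (b : X) ∈ (cone b).source
  cone_self : ∀ b, cone b b = 0
  cone_source_inter : ∀ b, (cone b).source ∩ sing = {(b : X)}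
  cone_compat : ∀ b, ∀ x ∈ (cone b).source, x ≠ b → ∀ c ∈ atlas, x ∈ c.source →
    ∃ v : ℂ, ∀ᶠ y in 𝓝 x, c y = cone b y ^ order b + v

namespace TranslationSurface

variable {X : Type u} [TopologicalSpace X] (S : TranslationSurface X)

/-- The vertical flow, run upward (`σ = 1`) or downward (`σ = -1`) at unit speed from the
nonsingular point `x`, drops `x` into a singularity after a finite positive time `T`. -/
def FallsIntoSing (σ : ℝ) (x : X) : Prop :=
  ∃ T > 0, ∃ γ : ℝ → X, γ 0 = x ∧ γ T ∈ S.sing ∧ ContinuousOn γ (Icc 0 T) ∧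
    ∀ t ∈ Ico 0 T, γ t ∉ S.sing ∧ ∀ c ∈ S.atlas, γ t ∈ c.source →
      ∀ᶠ r in 𝓝[Ico 0 T] t, c (γ r) = c (γ t) + (σ * (r - t) : ℝ) * Complex.I

/-- The union of the forward-critical leaves: those that dive into a singularity. -/
def forwardCritical : Set X := {x | S.FallsIntoSing 1 x}

/-- The union of the backward-critical leaves: those that shoot out of a singularity. -/
def backwardCritical : Set X := {x | S.FallsIntoSing (-1) x}

/-- The union of the critical leaves. -/
def critical : Set X := S.forwardCritical ∪ S.backwardCritical

/-- A saddle connection is a leaf that is critical in both directions. -/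
def NoSaddleConnections : Prop := Disjoint S.forwardCritical S.backwardCritical

end TranslationSurface

/-! ### Divided intervals -/

/-- The interval `(a, b)` divided at the points of `W` inside it. A point is a pair of a position
`s` in `(a, b)` and a lane `ℓ`, where `ℓ = -1, 0, 1` stand for left, median and right. Positions in
`W` have all three lanes; for every other position `s` the pair `(s, 0)` is the point `s` itself. -/
def DividedInterval (a b : ℝ) (W : Set ℝ) : Type :=
  {p : ℝ ×ₗ SignType // (ofLex p).1 ∈ Ioo a b ∧ ((ofLex p).2 = 0 ∨ (ofLex p).1 ∈ W)}

namespace DividedInterval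

variable {a b : ℝ} {W : Set ℝ}

def pos (p : DividedInterval a b W) : ℝ := (ofLex p.1).1

def lane (p : DividedInterval a b W) : SignType := (ofLex p.1).2

/-- Lexicographic order: by position, and left lane < median < right lane. -/
instance : LinearOrder (DividedInterval a b W) :=
  inferInstanceAs (LinearOrder {p : ℝ ×ₗ SignType //
    (ofLex p).1 ∈ Ioo a b ∧ ((ofLex p).2 = 0 ∨ (ofLex p).1 ∈ W)})

/-- The topology generated by the nonempty open intervals `(p, q)` such that `p` is not a left lane
point and `q` is not a right lane point. -/
instance : TopologicalSpace (DividedInterval a b W) :=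
  TopologicalSpace.generateFrom
    {U | ∃ p q : DividedInterval a b W, p.lane ≠ -1 ∧ q.lane ≠ 1 ∧ (Ioo p q).Nonempty ∧ U = Ioo p q}

end DividedInterval

namespace TranslationSurface

variable {X : Type u} [TopologicalSpace X] (S : TranslationSurface X)

/-! ### Points of the divided surface -/

/-- The points of the divided surface. `point x 0` is the image under `ι` of the nonsingular point
`x` (a median point if `x` lies on a critical leaf); `point x (-1)` and `point x 1` are the left and
right lane points over a point `x` of a critical leaf. Over a singularity `b` of cone angle
`2 π k` there are `2 k` lane points and no median: `singLane b m` belongs to the `m`-th of the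
`2 k` half-discs into which the critical leaves cut the region around `b`. For even `m` it continues
the right lane of the forward-critical leaf into the right lane of the backward-critical leaf
bounding this half-disc, for odd `m` it does so with the left lanes. -/
inductive Divided : Type u
  | point (x : X) (l : SignType) (hx : x ∉ S.sing) (hl : l = 0 ∨ x ∈ S.critical) : Divided
  | singLane (b : S.sing) (m : Fin (2 * S.order b)) : Divided

/-- The embedding of the nonsingular part of the surface in the divided surface. -/
def iota (x : {x : X // x ∉ S.sing}) : S.Divided := .point x.1 0 x.2 (.inl rfl)

/-! ### Divided flow boxes -/

/-- A flow box: an open rectangle `(a, b) × (c, d)` in the nonsingular part of the surface, with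
vertical and horizontal sides. -/
structure FlowBox where
  a : ℝ
  b : ℝ
  c : ℝ
  d : ℝ
  chart : OpenPartialHomeomorph X ℂ
  target_eq : chart.target = Ioo a b ×ℂ Ioo c d
  source_subset : chart.source ⊆ S.singᶜ
  compat : ∀ e ∈ S.atlas, ∀ x ∈ e.source ∩ chart.source,
    ∃ v : ℂ, ∀ᶠ y in 𝓝 x, chart y = e y + v

namespace FlowBox

variable {S} (B : S.FlowBox)

/-- The positions `s` at which a critical leaf crosses the flow box, as the vertical line
`{s} × (c, d)`. -/
def cuts : Set ℝ :=
  {s | s ∈ Ioo B.a B.b ∧ ∀ h ∈ Ioo B.c B.d, B.chart.symm ⟨s, h⟩ ∈ S.critical}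

/-- The divided flow box, as a map into the divided surface. -/
def lift (p : DividedInterval B.a B.b B.cuts × Ioo B.c B.d) : S.Divided :=
  .point (B.chart.symm ⟨p.1.pos, p.2⟩) p.1.lane
    (B.source_subset (B.chart.map_target (by
      rw [B.target_eq]; exact ⟨p.1.2.1, p.2.2⟩)))
    (p.1.2.2.imp id fun h => h.2 p.2 p.2.2)

end FlowBox

/-! ### Divided singularity charts -/

/-- The branch of the `k`-th root that sends the closed half-plane of those `z` with
`0 ≤ (-1) ^ m * re z` to the closed sector of opening angle `π / k` around direction `π m / k`. -/
def sectorRoot (k m : ℕ) (z : ℂ) : ℂ :=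
  ((-1) ^ m * z) ^ (k : ℂ)⁻¹ * Complex.exp (Real.pi * m / k * Complex.I)

theorem sectorRoot_pow {k : ℕ} (hk : 0 < k) (m : ℕ) (z : ℂ) : sectorRoot k m z ^ k = z := by
  have hk' : (k : ℂ) ≠ 0 := by exact_mod_cast hk.ne'
  rw [sectorRoot, mul_pow, Complex.cpow_nat_inv_pow _ hk.ne', ← Complex.exp_nat_mul]
  have h1 : (k : ℂ) * (Real.pi * m / k * Complex.I) = m * (Real.pi * Complex.I) := by
    field_simp
  rw [h1, Complex.exp_nat_mul, Complex.exp_pi_mul_I, mul_right_comm, ← mul_pow]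
  simp

theorem sectorRoot_zero {k : ℕ} (hk : 0 < k) (m : ℕ) : sectorRoot k m 0 = 0 := by
  have := sectorRoot_pow hk m 0
  exact pow_eq_zero_iff hk.ne' |>.1 this

/-- The half-open box `{0 ≤ ± re z < r, |im z| < r}` attached to the `m`-th half-disc at a
singularity `b`: on the right of the center leaf if `m` is even, on the left if `m` is odd. The
radius `r` is so small that the box fits into the cone coordinate at `b`. -/
structure HalfBox where
  b : S.sing
  m : Fin (2 * S.order b)
  r : ℝ
  fits : ∀ z : ℂ, z.re ∈ Ioo (-r) r → z.im ∈ Ioo (-r) r → 0 ≤ (-1) ^ (m : ℕ) * z.re →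
    sectorRoot (S.order b) m z ∈ (S.cone b).target

namespace HalfBox

variable {S} (B : S.HalfBox)

/-- The half-open box as a map into the surface; it sends `0` to the singularity. -/
def map (z : ℂ) : X := (S.cone B.b).symm (sectorRoot (S.order B.b) B.m z)

/-- The positions of the critical leaves in the half-open box, including the center leaf `0`. -/
def cuts : Set ℝ :=
  {s | s = 0 ∨ (0 ≤ (-1) ^ (B.m : ℕ) * s ∧ ∀ h ∈ Ioo (-B.r) B.r, B.map ⟨s, h⟩ ∈ S.critical)}

/-- The part of the divided interval which starts at the right lane of `0` and goes right (`m` even),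
or starts at the left lane of `0` and goes left (`m` odd). -/
def Half : Type :=
  {p : DividedInterval (-B.r) B.r B.cuts //
    if Even (B.m : ℕ) then toLex (0, 1) ≤ p.1 else p.1 ≤ toLex (0, -1)}

instance : TopologicalSpace B.Half :=
  inferInstanceAs (TopologicalSpace {p : DividedInterval (-B.r) B.r B.cuts //
    if Even (B.m : ℕ) then toLex (0, 1) ≤ p.1 else p.1 ≤ toLex (0, -1)})

theorem half_re (p : B.Half) : 0 ≤ (-1) ^ (B.m : ℕ) * p.1.pos := by
  have h := p.2
  split_ifs at h with hm
  · rw [hm.neg_one_pow, one_mul]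
    rcases (Prod.Lex.le_iff).1 h with h | h
    · exact le_of_lt h
    · exact le_of_eq h.1
  · rw [(Nat.not_even_iff_odd.1 hm).neg_one_pow]
    rcases (Prod.Lex.le_iff).1 h with h | h
    · have : p.1.pos < 0 := h
      linarith
    · have : p.1.pos = 0 := h.1
      linarith

theorem map_mem_source {z : ℂ} (h1 : z.re ∈ Ioo (-B.r) B.r) (h2 : z.im ∈ Ioo (-B.r) B.r)
    (h3 : 0 ≤ (-1) ^ (B.m : ℕ) * z.re) : B.map z ∈ (S.cone B.b).source :=
  (S.cone B.b).map_target (B.fits z h1 h2 h3)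

theorem cone_map_pow {z : ℂ} (h1 : z.re ∈ Ioo (-B.r) B.r) (h2 : z.im ∈ Ioo (-B.r) B.r)
    (h3 : 0 ≤ (-1) ^ (B.m : ℕ) * z.re) : S.cone B.b (B.map z) ^ S.order B.b = z := by
  rw [map, (S.cone B.b).right_inv (B.fits z h1 h2 h3), sectorRoot_pow (S.order_pos _)]

theorem map_ne {z : ℂ} (h1 : z.re ∈ Ioo (-B.r) B.r) (h2 : z.im ∈ Ioo (-B.r) B.r)
    (h3 : 0 ≤ (-1) ^ (B.m : ℕ) * z.re) (hz : z ≠ 0) : B.map z ≠ B.b := by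
  intro h
  have := B.cone_map_pow h1 h2 h3
  rw [h, S.cone_self, zero_pow (S.order_pos _).ne'] at this
  exact hz this.symm

theorem map_notMem_sing {z : ℂ} (h1 : z.re ∈ Ioo (-B.r) B.r) (h2 : z.im ∈ Ioo (-B.r) B.r)
    (h3 : 0 ≤ (-1) ^ (B.m : ℕ) * z.re) (hz : z ≠ 0) : B.map z ∉ S.sing := by
  intro h
  have h4 : B.map z ∈ (S.cone B.b).source ∩ S.sing := ⟨B.map_mem_source h1 h2 h3, h⟩
  rw [S.cone_source_inter] at h4
  exact B.map_ne h1 h2 h3 hz h4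

theorem map_zero : B.map 0 = B.b := by
  rw [map, sectorRoot_zero (S.order_pos _), ← S.cone_self B.b,
    (S.cone B.b).left_inv (S.mem_cone_source _)]

theorem continuousAt_sectorRoot {k : ℕ} (hk : 0 < k) {m : ℕ} {z : ℂ}
    (hz : 0 ≤ (-1) ^ m * z.re) : ContinuousAt (sectorRoot k m) z := by
  unfold sectorRoot
  refine ContinuousAt.mul ?_ continuousAt_const
  have h : ContinuousAt (fun x : ℂ => x ^ (k : ℂ)⁻¹) ((-1) ^ m * z) := by
    apply Complex.continuousAt_cpow_const_of_re_pos
    · left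
      rcases Nat.even_or_odd m with hm | hm <;> rw [hm.neg_one_pow] at hz ⊢ <;> simpa using hz
    · rw [← Complex.ofReal_natCast, ← Complex.ofReal_inv, Complex.ofReal_re]
      positivity
  exact ContinuousAt.comp (f := fun z : ℂ => (-1) ^ m * z) h (by fun_prop)

/-- The edge of a half-open box consists of points that fall into the singularity. -/
theorem edge_falls (σ : ℝ) (hσ : σ = 1 ∨ σ = -1) (T : ℝ) (hT : 0 < T) (hTr : T < B.r) :
    S.FallsIntoSing σ (B.map ⟨0, -σ * T⟩) := by
  have key : ∀ t ∈ Icc 0 T, (σ * (t - T)) ∈ Ioo (-B.r) B.r := by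
    rintro t ⟨h0, h1⟩
    rcases hσ with rfl | rfl <;> constructor <;> linarith
  have hre : (0 : ℝ) ∈ Ioo (-B.r) B.r := ⟨by linarith, by linarith⟩
  have hh : (0 : ℝ) ≤ (-1) ^ (B.m : ℕ) * (0 : ℝ) := by simp
  have hc : Continuous fun t : ℝ => (⟨0, σ * (t - T)⟩ : ℂ) := by
    have : (fun t : ℝ => (⟨0, σ * (t - T)⟩ : ℂ)) = fun t : ℝ => ((σ * (t - T) : ℝ) : ℂ) * Complex.I := by
      funext t
      apply Complex.ext <;> simp
    rw [this]
    fun_prop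
  have hcont : ContinuousOn (fun t : ℝ => B.map ⟨0, σ * (t - T)⟩) (Icc 0 T) := by
    intro t ht
    apply ContinuousAt.continuousWithinAt
    have h1 : ContinuousAt (sectorRoot (S.order B.b) B.m) ⟨0, σ * (t - T)⟩ :=
      continuousAt_sectorRoot (S.order_pos _) hh
    have h2 := (S.cone B.b).continuousAt_symm (B.fits ⟨0, σ * (t - T)⟩ hre (key t ht) hh)
    exact (ContinuousAt.comp (x := (⟨0, σ * (t - T)⟩ : ℂ)) h2 h1).comp
      (f := fun t : ℝ => (⟨0, σ * (t - T)⟩ : ℂ)) hc.continuousAt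
  refine ⟨T, hT, fun t => B.map ⟨0, σ * (t - T)⟩, ?_, ?_, hcont, ?_⟩
  · simp
  · have : (⟨0, σ * (T - T)⟩ : ℂ) = 0 := by apply Complex.ext <;> simp
    simp only [this, map_zero]
    exact B.b.2
  · intro t ht
    have htI : t ∈ Icc 0 T := ⟨ht.1, ht.2.le⟩
    have hne : (⟨0, σ * (t - T)⟩ : ℂ) ≠ 0 := by
      intro h
      have := congrArg Complex.im h
      simp only [Complex.zero_im] at this
      rcases hσ with rfl | rfl <;> linarith [ht.2]
    refine ⟨B.map_notMem_sing hre (key t htI) hh hne, fun c hc hcs => ?_⟩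
    obtain ⟨v, hv⟩ := S.cone_compat B.b _ (B.map_mem_source hre (key t htI) hh)
      (B.map_ne hre (key t htI) hh hne) c hc hcs
    have hcw := (hcont t htI).mono (Ico_subset_Icc_self)
    filter_upwards [hcw.eventually hv, self_mem_nhdsWithin] with r hr hrT
    have hrI : r ∈ Icc 0 T := ⟨hrT.1, hrT.2.le⟩
    have e1 := B.cone_map_pow (z := ⟨0, σ * (t - T)⟩) hre (key t htI) hh
    have e2 := B.cone_map_pow (z := ⟨0, σ * (r - T)⟩) hre (key r hrI) hh
    rw [hr, hv.self_of_nhds, e1, e2]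
    apply Complex.ext
    · simp
    · simp
      ring

theorem edge_critical {h : ℝ} (hh : h ∈ Ioo (-B.r) B.r) (h0 : h ≠ 0) :
    B.map ⟨0, h⟩ ∈ S.critical := by
  rcases lt_or_gt_of_ne h0 with hn | hp
  · left
    have := B.edge_falls 1 (.inl rfl) (-h) (by linarith) (by linarith [hh.1])
    simpa [forwardCritical] using this
  · right
    have := B.edge_falls (-1) (.inr rfl) h hp hh.2
    simpa [backwardCritical] using this

open Classical in
/-- The divided half-open box, as a map into the divided surface. The missing image of the corner
`0` is the corresponding lane point over the singularity. -/
def lift (p : B.Half × Ioo (-B.r) B.r) : S.Divided :=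
  if h : (⟨p.1.1.pos, p.2⟩ : ℂ) = 0 then .singLane B.b B.m
  else .point (B.map ⟨p.1.1.pos, p.2⟩) p.1.1.lane
    (B.map_notMem_sing p.1.1.2.1 p.2.2 (B.half_re p.1) h)
    (p.1.1.2.2.imp id (by
      rintro (h1 | h1)
      · have h1' : p.1.1.pos = 0 := h1
        rw [h1'] at h ⊢
        exact B.edge_critical p.2.2 (fun h2 => h (by rw [h2]; rfl))
      · exact h1.2 _ p.2.2))

end HalfBox

/-! ### The divided and the fractured surface -/

/-- The divided surface is glued from the divided flow boxes and the divided half-open boxes at the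
singularities: a set is open if and only if its preimage in each of these is open. -/
instance : TopologicalSpace S.Divided :=
  (⨆ B : S.FlowBox, TopologicalSpace.coinduced B.lift inferInstance) ⊔
    (⨆ B : S.HalfBox, TopologicalSpace.coinduced B.lift inferInstance)

/-- The fractured surface: the complement of the (images under `ι` of the) critical leaves in the
divided surface, with the subspace topology. -/
abbrev Fractured : Type u := {p : S.Divided // p ∉ S.iota '' {x | x.1 ∈ S.critical}}

/-! ### The vertical flow -/

/-- The relation `q = ψ^t p` within a single divided flow box or divided half-open box, where
`ψ^t (s, h) = (s, h + t)`. -/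
def LocalFlow (t : ℝ) (p q : S.Divided) : Prop :=
  (∃ (B : S.FlowBox) (s : DividedInterval B.a B.b B.cuts) (h h' : Ioo B.c B.d),
      (h' : ℝ) = h + t ∧ B.lift (s, h) = p ∧ B.lift (s, h') = q) ∨
    ∃ (B : S.HalfBox) (s : B.Half) (h h' : Ioo (-B.r) B.r),
      (h' : ℝ) = h + t ∧ B.lift (s, h) = p ∧ B.lift (s, h') = q

/-- The vertical flow on the divided surface, as a relation: `VerticalFlow t p q` means that
`q = ψ^t p`. The local flows are fitted together through `ψ^t ψ^s = ψ^(t + s)`. -/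
inductive VerticalFlow : ℝ → S.Divided → S.Divided → Prop
  | of_local {t : ℝ} {p q : S.Divided} : S.LocalFlow t p q → VerticalFlow t p q
  | comp {t s : ℝ} {p q r : S.Divided} :
      VerticalFlow s p q → VerticalFlow t q r → VerticalFlow (t + s) p r

end TranslationSurface

end

noncomputable section

universe u

/-! The topology of the divided surface can be made explicit (`Divided.nhds_eq`). Neighbourhoods of
a point over a nonsingular `x` come from neighbourhoods of `x`, cut down to one side of the vertical
line if the point is a lane point; neighbourhoods of a lane point over a singularity are pieces of
its half-disc. Once the medians are gone, the sides that belong to a fibre are finite in number,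
mutually disjoint, and cover everything near the fibre. So compactness and the Hausdorff property
descend from `X` (`compactSpace_fractured`, `t2Space_fractured`). By compactness every point has a
box in which its vertical line extends by a uniform `ε`, and the resulting local flow extends to all
times (`exists_flow_of_local`, `exists_verticalFlow`).

For minimality let `M` be closed, invariant and nonempty, with projection `N` in `X`. No orbit is
periodic: a periodic orbit avoids the singularities, its neighbours move parallel to it and close up
as well, so the projection of the points of period `T` is clopen in `X` and would contain a
singularity (`not_periodic`).

No nonsingular point of `N` has a gap, that is, a horizontal path which starts there and then misses
`N` (`not_hasGap`). Gaps persist along orbits in `M`: only a singularity in the way of the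
horizontal path could interfere, but then the lane point of the half-disc in question lies in `M`,
and the edge of the half-disc already obstructs the gap. Without saddle connections the orbit avoids
the singularities in at least one time direction. By compactness it returns to a single box at two
distant times, at positions closer than the length of the gap. Either one position lies in the gap
of the other, or both points lie on one vertical line and the orbit is periodic. Both are
impossible.

Without gaps, `N` is open off the singularities, and also at them because punctured discs are
connected; hence `N = X` (`image_eq_univ`). Nonempty open sets of the fractured surface contain
whole fibres, so `M` is everything (`eq_univ`). Applied to omega-limit sets of the flow and of its
reverse, this makes all half-orbits dense. -/

/-- Uniqueness of continuation: the set of agreement is clopen. Straight paths, vertical lines in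
boxes and flow lines are all compared in this way. -/
theorem eq_of_locally_eq {Y Z : Type*} [TopologicalSpace Y] [PreconnectedSpace Y]
    [TopologicalSpace Z] [T2Space Z] {f g : Y → Z} (hf : Continuous f) (hg : Continuous g)
    (h : ∀ y, f y = g y → ∀ᶠ y' in 𝓝 y, f y' = g y') {y₀ : Y} (h₀ : f y₀ = g y₀) (y : Y) :
    f y = g y := by
  have hc : IsClopen {y | f y = g y} := ⟨isClosed_eq hf hg, isOpen_iff_mem_nhds.2 h⟩
  have := hc.eq_univ ⟨y₀, h₀⟩
  exact this.ge (mem_univ y)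

theorem eqOn_of_locally_eq {Z : Type*} [TopologicalSpace Z] [T2Space Z] {J : Set ℝ}
    (hJ : J.OrdConnected) {f g : ℝ → Z} (hf : ContinuousOn f J) (hg : ContinuousOn g J)
    (h : ∀ t ∈ J, f t = g t → ∀ᶠ r in 𝓝[J] t, f r = g r) {t₀ : ℝ} (ht₀ : t₀ ∈ J)
    (h₀ : f t₀ = g t₀) : EqOn f g J := by
  have : PreconnectedSpace J := Subtype.preconnectedSpace hJ.isPreconnected
  intro t ht
  refine eq_of_locally_eq (Y := J) (f := J.domRestrict f) (g := J.domRestrict g) hf.domRestrict hg.domRestrict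
    ?_ (y₀ := ⟨t₀, ht₀⟩) h₀ ⟨t, ht⟩
  rintro ⟨y, hy⟩ hyy
  have := h y hy hyy
  rw [nhdsWithin_eq_map_subtype_coe hy] at this
  exact this

/-! ### Local coordinates and straight paths -/

namespace TranslationSurface

variable {X : Type u} [TopologicalSpace X] (S : TranslationSurface X)

/-- Near `x`, the map `g` is a chart of the atlas up to translation. -/
def IsLocalCoord (g : X → ℂ) (x : X) : Prop :=
  ∀ c ∈ S.atlas, x ∈ c.source → ∃ v : ℂ, ∀ᶠ y in 𝓝 x, g y = c y + v

variable {S}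

theorem isLocalCoord_chart {c : OpenPartialHomeomorph X ℂ} (hc : c ∈ S.atlas) {x : X}
    (hx : x ∈ c.source) : S.IsLocalCoord c x := by
  intro c' hc' hx'
  exact S.atlas_compat c' hc' c hc x ⟨hx', hx⟩

theorem FlowBox.isLocalCoord (B : S.FlowBox) {x : X} (hx : x ∈ B.chart.source) :
    S.IsLocalCoord B.chart x := fun c hc hxc => B.compat c hc x ⟨hxc, hx⟩

theorem isLocalCoord_cone (b : S.sing) {x : X} (hx : x ∈ (S.cone b).source) (hxb : x ≠ b) :
    S.IsLocalCoord (fun y => S.cone b y ^ S.order b) x := by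
  intro c hc hxc
  obtain ⟨v, hv⟩ := S.cone_compat b x hx hxb c hc hxc
  exact ⟨-v, hv.mono fun y hy => by simp [hy]⟩

/-- Both coordinates differ from one atlas chart by a translation near `x`, so displacements from
`x` do not depend on the coordinate. -/
theorem IsLocalCoord.eventually_eq_add {g g' : X → ℂ} {x : X} (hg : S.IsLocalCoord g x)
    (hg' : S.IsLocalCoord g' x) (hx : x ∉ S.sing) :
    ∀ᶠ y in 𝓝 x, g' y - g' x = g y - g x := by
  obtain ⟨c, hc, hxc⟩ := S.atlas_cover x hx
  obtain ⟨v, hv⟩ := hg c hc hxc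
  obtain ⟨v', hv'⟩ := hg' c hc hxc
  have h1 := hv.self_of_nhds
  have h2 := hv'.self_of_nhds
  filter_upwards [hv, hv'] with y hy hy'
  rw [hy, hy', h1, h2]
  ring

theorem isOpen_compl_sing : IsOpen S.singᶜ := by
  rw [isOpen_iff_mem_nhds]
  intro x hx
  obtain ⟨c, hc, hxc⟩ := S.atlas_cover x hx
  exact mem_of_superset (c.open_source.mem_nhds hxc) (S.atlas_source c hc)

theorem IsLocalCoord.continuousAt {g : X → ℂ} {x : X} (hg : S.IsLocalCoord g x)
    (hx : x ∉ S.sing) : ContinuousAt g x := by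
  obtain ⟨c, hc, hxc⟩ := S.atlas_cover x hx
  obtain ⟨v, hv⟩ := hg c hc hxc
  exact ((c.continuousAt hxc).add continuousAt_const).congr (hv.mono fun y hy => hy.symm)

/-- Around a nonsingular point there are arbitrarily small square flow boxes with a prescribed
coordinate. -/
theorem IsLocalCoord.exists_flowBox {g : X → ℂ} {x : X} (hg : S.IsLocalCoord g x)
    (hx : x ∉ S.sing) {U : Set X} (hU : U ∈ 𝓝 x) :
    ∃ (B : S.FlowBox) (r : ℝ), 0 < r ∧ x ∈ B.chart.source ∧ B.chart.source ⊆ U ∧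
      EqOn B.chart g B.chart.source ∧ B.a = (g x).re - r ∧ B.b = (g x).re + r ∧
      B.c = (g x).im - r ∧ B.d = (g x).im + r := by
  obtain ⟨c, hc, hxc⟩ := S.atlas_cover x hx
  obtain ⟨v, hv⟩ := hg c hc hxc
  obtain ⟨V, hVU, hVo, hxV⟩ := mem_nhds_iff.1 (inter_mem hv hU)
  -- On `V` the shifted chart coincides with `g`. The box is the preimage of a square around `g x`.
  let e : OpenPartialHomeomorph X ℂ :=
    ((c.restrOpen V hVo).trans (Homeomorph.addRight v).toOpenPartialHomeomorph)
  have hes : e.source = c.source ∩ V := by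
    simp [e]
  have heV : ∀ y, e y = c y + v := fun y => rfl
  have heg : ∀ y ∈ e.source, e y = g y := by
    intro y hy
    rw [hes] at hy
    rw [heV]
    exact (hVU hy.2).1.symm
  have hxe : x ∈ e.source := by rw [hes]; exact ⟨hxc, hxV⟩
  have htar : e.target ∈ 𝓝 (g x) := by
    rw [← heg x hxe]
    exact e.open_target.mem_nhds (e.map_source hxe)
  obtain ⟨ε, hε, hball⟩ := Metric.mem_nhds_iff.1 htar
  -- The norm is at most `|re| + |im| < 2 * r`, so the square fits into the ball.
  let r := ε / 2
  have hr : 0 < r := by positivity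
  let R : Set ℂ := Ioo ((g x).re - r) ((g x).re + r) ×ℂ Ioo ((g x).im - r) ((g x).im + r)
  have hRo : IsOpen R := isOpen_Ioo.reProdIm isOpen_Ioo
  have hRe : R ⊆ e.target := by
    intro z hz
    apply hball
    rw [Metric.mem_ball, Complex.dist_eq]
    have h1 : |(z - g x).re| < r := by
      rw [Complex.sub_re, abs_lt]
      constructor <;> linarith [hz.1.1, hz.1.2]
    have h2 : |(z - g x).im| < r := by
      rw [Complex.sub_im, abs_lt]
      constructor <;> linarith [hz.2.1, hz.2.2]
    have := Complex.norm_le_abs_re_add_abs_im (z - g x)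
    simp only [r] at h1 h2
    linarith
  let e' : OpenPartialHomeomorph X ℂ := (e.symm.restrOpen R hRo).symm
  have he't : e'.target = R := by
    change e.target ∩ R = R
    exact inter_eq_right.2 hRe
  have he's : e'.source ⊆ e.source := by
    have : e'.source = e.source ∩ e ⁻¹' R := by
      simp [e', OpenPartialHomeomorph.restrOpen]
    rw [this]
    exact inter_subset_left
  have he'e : ∀ y, e' y = e y := fun y => rfl
  refine ⟨⟨(g x).re - r, (g x).re + r, (g x).im - r, (g x).im + r, e', he't, ?_, ?_⟩, r, hr, ?_, ?_,
    ?_, rfl, rfl, rfl, rfl⟩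
  · intro y hy
    have := he's hy
    rw [hes] at this
    exact S.atlas_source c hc this.1
  · rintro c' hc' y ⟨hyc', hy⟩
    have hye := he's hy
    have hyc := hye
    rw [hes] at hyc
    obtain ⟨w, hw⟩ := S.atlas_compat c' hc' c hc y ⟨hyc', hyc.1⟩
    exact ⟨w + v, hw.mono fun z hz => by rw [he'e, heV, hz]; ring⟩
  · have h1 : e' x = g x := heg x hxe
    have h2 : g x ∈ e'.target := by
      rw [he't]
      constructor <;> constructor <;> simp [hr]
    have h3 := e'.map_target h2
    have h4 : e'.symm (g x) = x := by
      rw [← heg x hxe]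
      exact e.left_inv hxe
    change x ∈ e'.source
    rwa [h4] at h3
  · intro y hy
    have := he's hy
    rw [hes] at this
    exact (hVU this.2).2
  · intro y hy
    exact heg y (he's hy)

theorem IsLocalCoord.eventually_injective {g : X → ℂ} {x : X} (hg : S.IsLocalCoord g x)
    (hx : x ∉ S.sing) : ∃ U ∈ 𝓝 x, InjOn g U := by
  obtain ⟨B, r, hr, hxB, -, hE, -⟩ := hg.exists_flowBox hx univ_mem
  refine ⟨B.chart.source, B.chart.open_source.mem_nhds hxB, fun y hy z hz h => ?_⟩
  rw [← hE hy, ← hE hz] at h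
  exact B.chart.injOn hy hz h

variable (S)

/-- A path in the nonsingular part of the surface which moves with velocity `v` in all charts. -/
structure IsStraight (v : ℂ) (J : Set ℝ) (γ : ℝ → X) : Prop where
  continuousOn : ContinuousOn γ J
  notMem : ∀ t ∈ J, γ t ∉ S.sing
  straight : ∀ t ∈ J, ∀ c ∈ S.atlas, γ t ∈ c.source →
    ∀ᶠ r in 𝓝[J] t, c (γ r) = c (γ t) + (r - t : ℝ) * v

variable {S}
namespace IsStraight

variable {v : ℂ} {J J' : Set ℝ} {γ γ' : ℝ → X}

theorem coord (h : S.IsStraight v J γ) {t : ℝ} (ht : t ∈ J) {g : X → ℂ}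
    (hg : S.IsLocalCoord g (γ t)) : ∀ᶠ r in 𝓝[J] t, g (γ r) = g (γ t) + (r - t : ℝ) * v := by
  obtain ⟨c, hc, hxc⟩ := S.atlas_cover _ (h.notMem t ht)
  obtain ⟨w, hw⟩ := hg c hc hxc
  filter_upwards [h.straight t ht c hc hxc, (h.continuousOn t ht).eventually hw] with r h1 h2
  rw [h2, h1, hw.self_of_nhds]
  ring

theorem of_coord (h1 : ContinuousOn γ J) (h2 : ∀ t ∈ J, γ t ∉ S.sing)
    (h3 : ∀ t ∈ J, ∃ g, S.IsLocalCoord g (γ t) ∧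
      ∀ᶠ r in 𝓝[J] t, g (γ r) = g (γ t) + (r - t : ℝ) * v) : S.IsStraight v J γ := by
  refine ⟨h1, h2, fun t ht c hc hxc => ?_⟩
  obtain ⟨g, hg, hgr⟩ := h3 t ht
  have := hg.eventually_eq_add (isLocalCoord_chart hc hxc) (h2 t ht)
  filter_upwards [hgr, (h1 t ht).eventually this] with r h4 h5
  rw [h4] at h5
  linear_combination h5

theorem mono (h : S.IsStraight v J γ) (hJ : J' ⊆ J) : S.IsStraight v J' γ :=
  ⟨h.continuousOn.mono hJ, fun t ht => h.notMem t (hJ ht), fun t ht c hc hx =>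
    (h.straight t (hJ ht) c hc hx).filter_mono (nhdsWithin_mono t hJ)⟩

theorem congr (h : S.IsStraight v J γ) (hE : EqOn γ' γ J) : S.IsStraight v J γ' := by
  refine ⟨h.continuousOn.congr hE, fun t ht => by rw [hE ht]; exact h.notMem t ht,
    fun t ht c hc hx => ?_⟩
  rw [hE ht] at hx ⊢
  filter_upwards [h.straight t ht c hc hx, self_mem_nhdsWithin] with r h1 h2
  rw [hE h2, h1]

/-- Affine change of the parameter. -/
theorem comp_affine (h : S.IsStraight v J γ) (σ a : ℝ) (hJ : ∀ t ∈ J', σ * t + a ∈ J) :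
    S.IsStraight (σ * v) J' (fun t => γ (σ * t + a)) := by
  have hc : ContinuousOn (fun t : ℝ => σ * t + a) J' := by fun_prop
  refine ⟨h.continuousOn.comp hc hJ, fun t ht => h.notMem _ (hJ t ht), fun t ht c hc' hx => ?_⟩
  have h1 := h.straight _ (hJ t ht) c hc' hx
  have h2 : Tendsto (fun t : ℝ => σ * t + a) (𝓝[J'] t) (𝓝[J] (σ * t + a)) :=
    (hc t ht).tendsto_nhdsWithin hJ
  filter_upwards [h2.eventually h1] with r h3
  rw [h3]
  push_cast
  ring

/-- The closure conditions ensure that a time which belongs to only one of the two sets is not a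
limit of the other. There the second filter `𝓝[J'] t` (or `𝓝[J] t`) is `⊥`, and both requirements
can be checked piece by piece. -/
theorem union (h : S.IsStraight v J γ) (h' : S.IsStraight v J' γ)
    (hJ : ∀ t ∈ J', t ∈ closure J → t ∈ J) (hJ' : ∀ t ∈ J, t ∈ closure J' → t ∈ J') :
    S.IsStraight v (J ∪ J') γ := by
  have key : ∀ t ∈ J ∪ J', (t ∈ J ∨ 𝓝[J] t = ⊥) ∧ (t ∈ J' ∨ 𝓝[J'] t = ⊥) := by
    intro t ht
    rw [← not_neBot, ← not_neBot, ← mem_closure_iff_nhdsWithin_neBot,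
      ← mem_closure_iff_nhdsWithin_neBot]
    rcases ht with ht | ht
    · have := hJ' t ht
      tauto
    · have := hJ t ht
      tauto
  refine ⟨fun t ht => ?_, fun t ht => ht.elim (h.notMem t) (h'.notMem t), fun t ht c hc hx => ?_⟩
  · rw [ContinuousWithinAt, nhdsWithin_union, tendsto_sup]
    obtain ⟨h1, h2⟩ := key t ht
    refine ⟨h1.elim (fun h1 => h.continuousOn t h1) fun h1 => by rw [h1]; exact tendsto_bot,
      h2.elim (fun h1 => h'.continuousOn t h1) fun h1 => by rw [h1]; exact tendsto_bot⟩
  · rw [nhdsWithin_union, eventually_sup]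
    obtain ⟨h1, h2⟩ := key t ht
    exact ⟨h1.elim (fun h1 => h.straight t h1 c hc hx) fun h1 => by rw [h1]; exact eventually_bot,
      h2.elim (fun h1 => h'.straight t h1 c hc hx) fun h1 => by rw [h1]; exact eventually_bot⟩

/-- A chart at a common point turns both paths into the same affine path, and charts are injective.
-/
theorem eqOn [T2Space X] (h : S.IsStraight v J γ) (h' : S.IsStraight v J γ')
    (hJ : J.OrdConnected) {t₀ : ℝ} (ht₀ : t₀ ∈ J) (h₀ : γ t₀ = γ' t₀) : EqOn γ γ' J := by
  refine eqOn_of_locally_eq hJ h.continuousOn h'.continuousOn (fun t ht hE => ?_) ht₀ h₀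
  obtain ⟨c, hc, hxc⟩ := S.atlas_cover _ (h.notMem t ht)
  have hxc' : γ' t ∈ c.source := hE ▸ hxc
  filter_upwards [h.straight t ht c hc hxc, h'.straight t ht c hc hxc',
    (h.continuousOn t ht).eventually (c.open_source.mem_nhds hxc),
    (h'.continuousOn t ht).eventually (c.open_source.mem_nhds hxc')] with r h1 h2 h3 h4
  apply c.injOn h3 h4
  rw [h1, h2, hE]

end IsStraight

theorem fallsIntoSing_iff {σ : ℝ} {x : X} : S.FallsIntoSing σ x ↔
    ∃ T > 0, ∃ γ : ℝ → X, γ 0 = x ∧ γ T ∈ S.sing ∧ ContinuousOn γ (Icc 0 T) ∧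
      S.IsStraight (σ * Complex.I) (Ico 0 T) γ := by
  constructor
  · rintro ⟨T, hT, γ, h0, h1, h2, h3⟩
    refine ⟨T, hT, γ, h0, h1, h2, h2.mono Ico_subset_Icc_self, fun t ht => (h3 t ht).1,
      fun t ht c hc hx => ?_⟩
    filter_upwards [(h3 t ht).2 c hc hx] with r hr
    rw [hr]
    push_cast
    ring
  · rintro ⟨T, hT, γ, h0, h1, h2, h3⟩
    refine ⟨T, hT, γ, h0, h1, h2, fun t ht => ⟨h3.notMem t ht, fun c hc hx => ?_⟩⟩
    filter_upwards [h3.straight t ht c hc hx] with r hr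
    rw [hr]
    push_cast
    ring

theorem FallsIntoSing.notMem {σ : ℝ} {x : X} (h : S.FallsIntoSing σ x) : x ∉ S.sing := by
  obtain ⟨T, hT, γ, h0, h1, h2, h3⟩ := fallsIntoSing_iff.1 h
  rw [← h0]
  exact h3.notMem 0 ⟨le_rfl, hT⟩

/-- A straight path which starts out like the fall into a singularity ends before it reaches it. -/
theorem IsStraight.not_fall [T2Space X] {v : ℂ} {T T' : ℝ} {γ α : ℝ → X} (hT : 0 < T)
    (hα : S.IsStraight v (Ico 0 T) α) (hc : ContinuousOn α (Icc 0 T)) (h1 : α T ∈ S.sing)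
    (hγ : S.IsStraight v (Icc 0 T') γ) (h0 : γ 0 = α 0) : T' < T := by
  by_contra! hTT
  have h2 := hα.eqOn (hγ.mono (J' := Ico 0 T) fun t ht => ⟨ht.1, ht.2.le.trans hTT⟩)
    ordConnected_Ico ⟨le_rfl, hT⟩ h0.symm
  -- By continuity the paths still agree at time `T`, where `α` is singular and `γ` is not.
  have h3 : EqOn α γ (Icc 0 T) := by
    have hγc : ContinuousOn γ (Icc 0 T) :=
      hγ.continuousOn.mono fun t ht => ⟨ht.1, ht.2.trans hTT⟩
    have hcl : closure (Ico 0 T) = Icc 0 T := closure_Ico hT.ne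
    exact h2.of_subset_closure hc hγc Ico_subset_Icc_self hcl.ge
  rw [h3 ⟨hT.le, le_rfl⟩] at h1
  exact hγ.notMem T ⟨hT.le, hTT⟩ h1

/-- If `t'` lies ahead, the fall from `γ t` runs along `γ` as far as `γ t'`, and its tail is the
required fall; `IsStraight.not_fall` excludes that the singularity comes earlier. If `t'` lies
behind, the stretch of `γ` between the two times is put in front of the fall. -/
theorem FallsIntoSing.along [T2Space X] {σ : ℝ} {J : Set ℝ} (hJ : J.OrdConnected) {γ : ℝ → X}
    (hγ : S.IsStraight (σ * Complex.I) J γ) {t t' : ℝ} (ht : t ∈ J) (ht' : t' ∈ J)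
    (h : S.FallsIntoSing σ (γ t)) : S.FallsIntoSing σ (γ t') := by
  obtain ⟨T, hT, α, h0, h1, h2, h3⟩ := fallsIntoSing_iff.1 h
  rw [fallsIntoSing_iff]
  have shift : ∀ {a : ℝ} {J' : Set ℝ}, (∀ r ∈ J', r + a ∈ J) →
      S.IsStraight (σ * Complex.I) J' (fun r => γ (r + a)) := by
    intro a J' h
    simpa using hγ.comp_affine 1 a (J' := J') (by simpa using h)
  rcases le_total t t' with hle | hle
  · have hs : S.IsStraight (σ * Complex.I) (Icc 0 (t' - t)) (fun r => γ (r + t)) :=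
      shift fun r hr => hJ.out ht ht' ⟨by linarith [hr.1], by linarith [hr.2]⟩
    have hlt := IsStraight.not_fall hT h3 h2 h1 hs (by simp [h0])
    have hE : EqOn α (fun r => γ (r + t)) (Icc 0 (t' - t)) :=
      (h3.mono fun r hr => ⟨hr.1, hr.2.trans_lt hlt⟩).eqOn hs ordConnected_Icc
        ⟨le_rfl, by linarith⟩ (by simp [h0])
    refine ⟨T - (t' - t), by linarith, fun r => α (r + (t' - t)), ?_, ?_, ?_, ?_⟩
    · have := hE (x := t' - t) ⟨by linarith, le_rfl⟩
      simp only [zero_add, this]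
      congr 1
      ring
    · simpa using h1
    · exact h2.comp (by fun_prop) fun r hr => ⟨by linarith [hr.1], by linarith [hr.2]⟩
    · simpa using h3.comp_affine 1 (t' - t) (J' := Ico 0 (T - (t' - t)))
        fun r hr => ⟨by linarith [hr.1], by linarith [hr.2]⟩
  · classical
    let a := t - t'
    have ha : 0 ≤ a := by simp [a, hle]
    let β : ℝ → X := fun r => if r < a then γ (r + t') else α (r - a)
    have hβα : EqOn β (fun r => α (r - a)) (Ici a) := fun r hr => if_neg (not_lt.2 hr)
    have hβγ : EqOn β (fun r => γ (r + t')) (Icc 0 a) := by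
      intro r hr
      rcases hr.2.lt_or_eq with h | h
      · exact if_pos h
      · simp only [β, h, lt_irrefl, if_false, sub_self, h0, a]
        congr 1
        ring
    have s1 : S.IsStraight (σ * Complex.I) (Icc 0 a) β :=
      (shift fun r hr => hJ.out ht' ht ⟨by linarith [hr.1], by simp only [a] at hr; linarith [hr.2]⟩).congr hβγ
    have s2 : S.IsStraight (σ * Complex.I) (Ico a (a + T)) β := by
      have := h3.comp_affine 1 (-a) (J' := Ico a (a + T))
        fun r hr => ⟨by linarith [hr.1], by linarith [hr.2]⟩
      simp only [one_mul, Complex.ofReal_one, ← sub_eq_add_neg] at this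
      exact this.congr fun r hr => hβα hr.1
    have hun : Icc 0 a ∪ Ico a (a + T) = Ico 0 (a + T) :=
      Icc_union_Ico_eq_Ico ha (by linarith)
    have hun' : Icc 0 a ∪ Icc a (a + T) = Icc 0 (a + T) :=
      Icc_union_Icc_eq_Icc ha (by linarith)
    refine ⟨a + T, by linarith, β, ?_, ?_, ?_, ?_⟩
    · rw [hβγ ⟨le_rfl, ha⟩]
      simp
    · rw [hβα (by simp [hT.le] : a + T ∈ Ici a)]
      simpa using h1
    · rw [← hun']
      refine s1.continuousOn.union_of_isClosed ?_ isClosed_Icc isClosed_Icc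
      refine ContinuousOn.congr ?_ fun r (hr : r ∈ Icc a (a + T)) => hβα hr.1
      exact h2.comp (by fun_prop) fun r hr => ⟨by linarith [hr.1], by linarith [hr.2]⟩
    · rw [← hun]
      refine s1.union s2 (fun r hr hr' => by rwa [isClosed_Icc.closure_eq] at hr')
        fun r hr hr' => ?_
      rw [closure_Ico (by linarith)] at hr'
      exact ⟨hr'.1, by linarith [hr.2]⟩

/-- Critical leaves are unions of vertical leaves. -/
theorem IsStraight.critical_iff [T2Space X] {J : Set ℝ} (hJ : J.OrdConnected) {γ : ℝ → X}
    (hγ : S.IsStraight Complex.I J γ) {t t' : ℝ} (ht : t ∈ J) (ht' : t' ∈ J) :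
    γ t ∈ S.critical ↔ γ t' ∈ S.critical := by
  have key : ∀ {t t'}, t ∈ J → t' ∈ J → γ t ∈ S.critical → γ t' ∈ S.critical := by
    rintro t t' ht ht' (h | h)
    · exact Or.inl (FallsIntoSing.along hJ (by simpa using hγ) ht ht' h)
    · right
      -- Time is reversed, so that the downward fall also follows a path of velocity `σ * I`, now
      -- with `σ = -1`.
      let J' : Set ℝ := (fun r => -r) ⁻¹' J
      have hJ' : J'.OrdConnected := by
        refine ⟨fun x hx y hy z hz => hJ.out hy hx ⟨neg_le_neg hz.2, neg_le_neg hz.1⟩⟩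
      have h1 := hγ.comp_affine (-1) 0 (J' := J') fun r hr => by simpa [J'] using hr
      have := FallsIntoSing.along (σ := -1) hJ' (t := -t) (t' := -t') (by simpa using h1)
        (by simpa [J'] using ht) (by simpa [J'] using ht') (by simpa [backwardCritical] using h)
      simpa [backwardCritical] using this
  exact ⟨key ht ht', key ht' ht⟩

end TranslationSurface

namespace TranslationSurface

/-! ### Branches of the root -/

/-- The branches of one parity realize all `k` roots: `w` divided by the value of the branch `e` is
a root of unity `exp (2 π i / k) ^ i`, and this factor raises the number of the sector by `2 * i`.
-/
theorem exists_sectorRoot_eq {k : ℕ} (hk : 0 < k) {e : ℕ} (he : e < 2) (w : ℂ) :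
    ∃ m : Fin (2 * k), (Even (m : ℕ) ↔ Even e) ∧ sectorRoot k m (w ^ k) = w := by
  rcases eq_or_ne w 0 with rfl | hw
  · exact ⟨⟨e, by omega⟩, Iff.rfl, by rw [zero_pow hk.ne', sectorRoot_zero hk]⟩
  have hk' : (k : ℂ) ≠ 0 := by exact_mod_cast hk.ne'
  have : NeZero k := ⟨hk.ne'⟩
  have hexp : ∀ m : ℕ, Complex.exp (Real.pi * m / k * Complex.I) ^ k = (-1) ^ m := by
    intro m
    rw [← Complex.exp_nat_mul]
    have h1 : (k : ℂ) * (Real.pi * m / k * Complex.I) = m * (Real.pi * Complex.I) := by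
      field_simp
    rw [h1, Complex.exp_nat_mul, Complex.exp_pi_mul_I]
  set u : ℂ := ((-1) ^ e * w ^ k) ^ (k : ℂ)⁻¹ with hu
  have huk : u ^ k = (-1) ^ e * w ^ k := Complex.cpow_nat_inv_pow _ hk.ne'
  have hsq : ((-1 : ℂ) ^ e) * (-1) ^ e = 1 := by rw [← mul_pow]; simp
  have hu0 : u ≠ 0 := by
    intro h
    rw [h, zero_pow hk.ne'] at huk
    have : w ^ k = 0 := by linear_combination (-1) ^ e * (-huk) - w ^ k * hsq
    exact hw (pow_eq_zero_iff hk.ne' |>.1 this)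
  set E : ℂ := Complex.exp (Real.pi * e / k * Complex.I) with hE
  have hE0 : E ≠ 0 := Complex.exp_ne_zero _
  have h1 : (w / (u * E)) ^ k = 1 := by
    rw [div_pow, mul_pow, huk, hexp, mul_right_comm, hsq, one_mul, div_self (pow_ne_zero _ hw)]
  obtain ⟨i, hi, hi'⟩ := (Complex.isPrimitiveRoot_exp k hk.ne').eq_pow_of_pow_eq_one h1
  refine ⟨⟨2 * i + e, by omega⟩, by simp [Nat.even_add], ?_⟩
  have h2 : Complex.exp (Real.pi * ((2 * i + e : ℕ) : ℂ) / k * Complex.I)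
      = Complex.exp (2 * Real.pi * Complex.I / k) ^ i * E := by
    rw [← Complex.exp_nat_mul, hE, ← Complex.exp_add]
    congr 1
    push_cast
    ring
  have h3 : ((-1 : ℂ)) ^ (2 * i + e) = (-1) ^ e := by simp [pow_add, pow_mul]
  simp only [sectorRoot]
  rw [h2, hi', h3, ← hu]
  field_simp

/-- Branches of equal parity take the principal root of the same number, so their values differ by
`exp (π i (m - m') / k)`. This is `1` only if `2 * k` divides `m - m'`. -/
theorem sectorRoot_injective {k : ℕ} {m m' : Fin (2 * k)}
    (hm : Even (m : ℕ) ↔ Even (m' : ℕ)) {z : ℂ} (hz : z ≠ 0)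
    (h : sectorRoot k m z = sectorRoot k m' z) : m = m' := by
  have hk : 0 < k := by have := m.2; omega
  have hk' : (k : ℂ) ≠ 0 := by exact_mod_cast hk.ne'
  have hs : ((-1 : ℂ)) ^ (m : ℕ) = (-1) ^ (m' : ℕ) := by
    by_cases he : Even (m : ℕ)
    · rw [he.neg_one_pow, (hm.1 he).neg_one_pow]
    · rw [(Nat.not_even_iff_odd.1 he).neg_one_pow,
        (Nat.not_even_iff_odd.1 (fun h => he (hm.2 h))).neg_one_pow]
  simp only [sectorRoot, hs] at h
  have hne : ((-1) ^ (m' : ℕ) * z) ^ (k : ℂ)⁻¹ ≠ 0 := by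
    intro h0
    have := Complex.cpow_nat_inv_pow ((-1) ^ (m' : ℕ) * z) hk.ne'
    rw [h0, zero_pow hk.ne'] at this
    exact mul_ne_zero (pow_ne_zero _ (by norm_num)) hz this.symm
  have h1 := mul_left_cancel₀ hne h
  obtain ⟨n, hn⟩ := Complex.exp_eq_exp_iff_exists_int.1 h1
  have hpi : (Real.pi : ℂ) ≠ 0 := by exact_mod_cast Real.pi_ne_zero
  have h2 : (m : ℂ) = m' + 2 * k * n := by
    field_simp at hn
    have h3 : ((m : ℂ) - (m' + 2 * k * n)) * (Real.pi * Complex.I) = 0 := by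
      linear_combination (Real.pi * Complex.I) * hn
    have h4 := (mul_eq_zero.1 h3).resolve_right (mul_ne_zero hpi Complex.I_ne_zero)
    linear_combination h4
  have h3 : ((m : ℕ) : ℤ) = (m' : ℕ) + 2 * k * n := by exact_mod_cast h2
  have hm1 := m.2
  have hm2 := m'.2
  have hn0 : n = 0 := by
    by_contra hn0
    rcases lt_or_gt_of_ne hn0 with h | h
    · have : (k : ℤ) * n ≤ k * (-1) := by gcongr; omega
      rw [mul_assoc] at h3
      omega
    · have : (k : ℤ) * 1 ≤ k * n := by gcongr; omega
      rw [mul_assoc] at h3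
      omega
  ext
  rw [hn0] at h3
  omega

/-- Every other branch of the same parity misses `w₀`, and by continuity it misses all `w` nearby.
Some branch of this parity must hit `w`, so it is the branch `m`. The sign condition keeps `w₀ ^ k`
off the cut of these branches; the boundary line of the half-plane is harmless. -/
theorem eventually_sectorRoot_eq {k : ℕ} {m : Fin (2 * k)} {w₀ : ℂ} (hw₀ : w₀ ≠ 0)
    (h0 : 0 ≤ (-1) ^ (m : ℕ) * (w₀ ^ k).re) (h : sectorRoot k m (w₀ ^ k) = w₀) :
    ∀ᶠ w in 𝓝 w₀, sectorRoot k m (w ^ k) = w := by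
  have hk : 0 < k := by have := m.2; omega
  have key : ∀ m' : Fin (2 * k), (Even (m' : ℕ) ↔ Even (m : ℕ)) → m' ≠ m →
      ∀ᶠ w in 𝓝 w₀, sectorRoot k m' (w ^ k) ≠ w := by
    intro m' hp hne
    have hs : ((-1 : ℝ)) ^ (m' : ℕ) = (-1) ^ (m : ℕ) := by
      by_cases he : Even (m' : ℕ)
      · rw [he.neg_one_pow, (hp.1 he).neg_one_pow]
      · rw [(Nat.not_even_iff_odd.1 he).neg_one_pow,
          (Nat.not_even_iff_odd.1 (fun h => he (hp.2 h))).neg_one_pow]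
    have hc : ContinuousAt (fun w : ℂ => sectorRoot k m' (w ^ k)) w₀ :=
      ContinuousAt.comp (f := fun w : ℂ => w ^ k)
        (HalfBox.continuousAt_sectorRoot hk (by rw [hs]; exact h0)) (by fun_prop)
    have h1 : sectorRoot k m' (w₀ ^ k) - w₀ ≠ 0 := fun h1 =>
      hne (sectorRoot_injective hp (pow_ne_zero k hw₀) ((sub_eq_zero.1 h1).trans h.symm))
    exact ((hc.sub continuousAt_id).eventually_ne h1).mono fun w hw h2 => hw (sub_eq_zero.2 h2)
  have hall : ∀ᶠ w in 𝓝 w₀, ∀ m' : Fin (2 * k), (Even (m' : ℕ) ↔ Even (m : ℕ)) → m' ≠ m →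
      sectorRoot k m' (w ^ k) ≠ w := by
    rw [eventually_all]
    intro m'
    by_cases h1 : (Even (m' : ℕ) ↔ Even (m : ℕ)) ∧ m' ≠ m
    · exact (key m' h1.1 h1.2).mono fun w hw _ _ => hw
    · exact Eventually.of_forall fun w h2 h3 => absurd ⟨h2, h3⟩ h1
  filter_upwards [hall] with w hw
  obtain ⟨m', hp, hm'⟩ := exists_sectorRoot_eq hk (e := (m : ℕ) % 2) (by omega) w
  have hp' : Even (m' : ℕ) ↔ Even (m : ℕ) := by
    rw [hp, Nat.even_iff, Nat.even_iff]; omega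
  by_cases hne : m' = m
  · rw [← hne, hm']
  · exact absurd hm' (hw m' hp' hne)

variable {X : Type u} [TopologicalSpace X] (S : TranslationSurface X)

/-! ### Patches: rectangles in the surface -/

/-- A rectangle in the surface which is parametrized by `sec`, with inverse `coord`. -/
structure Patch where
  J : Set ℝ
  lo : ℝ
  hi : ℝ
  sec : ℂ → X
  coord : X → ℂ
  ordConnected : J.OrdConnected
  continuousOn : ContinuousOn sec (J ×ℂ Ioo lo hi)
  coord_sec : ∀ z ∈ J ×ℂ Ioo lo hi, coord (sec z) = z
  isLocalCoord : ∀ z ∈ J ×ℂ Ioo lo hi, sec z ∉ S.sing → S.IsLocalCoord coord (sec z)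

variable {S}

namespace Patch

variable (P : S.Patch)

theorem isStraight {z v : ℂ} {A : Set ℝ} (hA : ∀ t ∈ A, z + t * v ∈ P.J ×ℂ Ioo P.lo P.hi)
    (h : ∀ t ∈ A, P.sec (z + t * v) ∉ S.sing) : S.IsStraight v A (fun t => P.sec (z + t * v)) := by
  refine IsStraight.of_coord (P.continuousOn.comp (by fun_prop) hA) h fun t ht =>
    ⟨P.coord, P.isLocalCoord _ (hA t ht) (h t ht), ?_⟩
  filter_upwards [self_mem_nhdsWithin] with r hr
  rw [P.coord_sec _ (hA t ht), P.coord_sec _ (hA r hr)]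
  push_cast
  ring

theorem isStraight_vertical {s : ℝ} (hs : s ∈ P.J) (h : ∀ h ∈ Ioo P.lo P.hi, P.sec ⟨s, h⟩ ∉ S.sing) :
    S.IsStraight Complex.I (Ioo P.lo P.hi) (fun h => P.sec ⟨s, h⟩) := by
  have key : ∀ t : ℝ, (⟨s, 0⟩ : ℂ) + t * Complex.I = ⟨s, t⟩ := fun t => by
    apply Complex.ext <;> simp
  have := P.isStraight (z := ⟨s, 0⟩) (v := Complex.I) (A := Ioo P.lo P.hi)
    (fun t ht => by rw [key]; exact ⟨hs, ht⟩) (fun t ht => by rw [key]; exact h t ht)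
  simpa only [key] using this

theorem critical_iff [T2Space X] {s h h' : ℝ} (hs : s ∈ P.J)
    (hn : ∀ h ∈ Ioo P.lo P.hi, P.sec ⟨s, h⟩ ∉ S.sing) (hh : h ∈ Ioo P.lo P.hi)
    (hh' : h' ∈ Ioo P.lo P.hi) : P.sec ⟨s, h⟩ ∈ S.critical ↔ P.sec ⟨s, h'⟩ ∈ S.critical :=
  (P.isStraight_vertical hs hn).critical_iff ordConnected_Ioo hh hh'

end Patch

namespace FlowBox

variable (B : S.FlowBox)

def patch : S.Patch where
  J := Ioo B.a B.b
  lo := B.c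
  hi := B.d
  sec := B.chart.symm
  coord := B.chart
  ordConnected := ordConnected_Ioo
  continuousOn := by
    rw [← B.target_eq]
    exact B.chart.continuousOn_symm
  coord_sec z hz := B.chart.right_inv (by rwa [B.target_eq])
  isLocalCoord z hz _ := B.isLocalCoord (B.chart.map_target (by rwa [B.target_eq]))

theorem symm_notMem {z : ℂ} (h1 : z.re ∈ Ioo B.a B.b) (h2 : z.im ∈ Ioo B.c B.d) :
    B.chart.symm z ∉ S.sing :=
  B.source_subset (B.chart.map_target (by rw [B.target_eq]; exact ⟨h1, h2⟩))

/-- Criticality is constant along a vertical line, so one point of the line decides. -/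
theorem mem_cuts_iff [T2Space X] {s h : ℝ} (hs : s ∈ Ioo B.a B.b) (hh : h ∈ Ioo B.c B.d) :
    s ∈ B.cuts ↔ B.chart.symm ⟨s, h⟩ ∈ S.critical :=
  ⟨fun H => H.2 h hh, fun H => ⟨hs, fun _ hh' =>
    (B.patch.critical_iff hs (fun _ h => B.symm_notMem hs h) hh hh').1 H⟩⟩

end FlowBox

namespace HalfBox

variable (B : S.HalfBox)

/-- The coordinate `w ^ k` need not be a chart at the singularity, which lies on the edge of this
half-open rectangle. For this reason `Patch` asks for a local coordinate only at nonsingular points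
and allows any order-connected `J`. -/
def patch : S.Patch where
  J := {s | s ∈ Ioo (-B.r) B.r ∧ 0 ≤ (-1) ^ (B.m : ℕ) * s}
  lo := -B.r
  hi := B.r
  sec := B.map
  coord y := S.cone B.b y ^ S.order B.b
  ordConnected := by
    refine ⟨fun x hx y hy z hz => ⟨ordConnected_Ioo.out hx.1 hy.1 hz, ?_⟩⟩
    have h1 := hx.2
    have h2 := hy.2
    rcases neg_one_pow_eq_or ℝ (B.m : ℕ) with h | h <;> rw [h] at h1 h2 ⊢ <;>
      linarith [hz.1, hz.2]
  continuousOn := by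
    intro z hz
    apply ContinuousAt.continuousWithinAt
    exact ContinuousAt.comp ((S.cone B.b).continuousAt_symm (B.fits z hz.1.1 hz.2 hz.1.2))
      (continuousAt_sectorRoot (S.order_pos _) hz.1.2)
  coord_sec z hz := B.cone_map_pow hz.1.1 hz.2 hz.1.2
  isLocalCoord z hz h := isLocalCoord_cone B.b (B.map_mem_source hz.1.1 hz.2 hz.1.2)
    fun h' => h (h' ▸ B.b.2)

theorem mem_cuts_iff [T2Space X] {s h : ℝ} (hs : s ∈ B.patch.J) (hs0 : s ≠ 0)
    (hh : h ∈ Ioo (-B.r) B.r) : s ∈ B.cuts ↔ B.map ⟨s, h⟩ ∈ S.critical := by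
  refine ⟨fun H => (H.resolve_left hs0).2 h hh, fun H => Or.inr ⟨hs.2, fun _ hh' =>
    (B.patch.critical_iff hs (fun h hh => ?_) hh hh').1 H⟩⟩
  exact B.map_notMem_sing hs.1 hh hs.2 fun h0 => hs0 (congrArg Complex.re h0)

end HalfBox

/-! ### Neighbourhoods of singularities -/

/-- All `2 k` branches are continuous at `0` with value `0`, on either side of their cuts, so one
radius serves all of them on the full square. -/
theorem exists_halfBox_radius (b : S.sing) {U : Set X} (hU : U ∈ 𝓝 (b : X)) :
    ∃ r > 0, ∀ (m : Fin (2 * S.order b)) (z : ℂ), z.re ∈ Ioo (-r) r → z.im ∈ Ioo (-r) r →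
      sectorRoot (S.order b) m z ∈ (S.cone b).target ∧
      (S.cone b).symm (sectorRoot (S.order b) m z) ∈ U := by
  have h1 : ∀ m : Fin (2 * S.order b), ∀ᶠ z in 𝓝 (0 : ℂ),
      sectorRoot (S.order b) m z ∈ (S.cone b).target ∧
      (S.cone b).symm (sectorRoot (S.order b) m z) ∈ U := by
    intro m
    have hc : Tendsto (sectorRoot (S.order b) m) (𝓝 0) (𝓝 (S.cone b b)) := by
      have : ContinuousAt (sectorRoot (S.order b) m) 0 :=
        HalfBox.continuousAt_sectorRoot (S.order_pos b) (by simp)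
      have h := this.tendsto
      rw [sectorRoot_zero (S.order_pos b)] at h
      rwa [S.cone_self b]
    have ht : (S.cone b).target ∈ 𝓝 (S.cone b b) :=
      (S.cone b).open_target.mem_nhds ((S.cone b).map_source (S.mem_cone_source b))
    have hs : Tendsto (S.cone b).symm (𝓝 (S.cone b b)) (𝓝 b) :=
      (S.cone b).tendsto_symm (S.mem_cone_source b)
    exact (hc.eventually ht).and ((hs.comp hc).eventually hU)
  obtain ⟨ε, hε, hε'⟩ := Metric.eventually_nhds_iff.1 (eventually_all.2 h1)
  refine ⟨ε / 2, by positivity, fun m z h1 h2 => hε' ?_ m⟩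
  rw [Complex.dist_eq, sub_zero]
  have := Complex.norm_le_abs_re_add_abs_im z
  have h3 := abs_lt.2 h1
  have h4 := abs_lt.2 h2
  linarith

theorem eq_of_cone_pow_eq_zero (b : S.sing) {y : X} (hy : y ∈ (S.cone b).source)
    (h : S.cone b y ^ S.order b = 0) : y = b := by
  have h0 := pow_eq_zero_iff (S.order_pos b).ne' |>.1 h
  rw [← S.cone_self b] at h0
  exact (S.cone b).injOn hy (S.mem_cone_source b) h0

theorem continuousAt_cone_pow (b : S.sing) {y : X} (hy : y ∈ (S.cone b).source) :
    ContinuousAt (fun y => S.cone b y ^ S.order b) y :=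
  ((S.cone b).continuousAt hy).pow _

end TranslationSurface

/-! ### Neighbourhoods in a divided interval -/

/-- In a divided line, the position `s'` with lane `l'` lies on the same side of position `s` as
its lane `l`. Every point does so if `l` is the median. -/
def laneSide (l : SignType) (s s' : ℝ) (l' : SignType) : Prop :=
  l = 0 ∨ 0 < (l : ℝ) * (s' - s) ∨ (s' = s ∧ l' = l)

theorem laneSide_self (l : SignType) (s : ℝ) : laneSide l s s l := Or.inr (Or.inr ⟨rfl, rfl⟩)

/-- Only the displacement enters, so the side of a lane is the same in all local coordinates. -/
theorem laneSide_congr {l l' : SignType} {s s' u u' : ℝ} (h : s' - s = u' - u) :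
    laneSide l s s' l' ↔ laneSide l u u' l' := by
  unfold laneSide
  rw [h, ← sub_eq_zero (a := s'), h, sub_eq_zero]

namespace DividedInterval

variable {a b : ℝ} {W : Set ℝ}

theorem ext {p q : DividedInterval a b W} (h1 : p.pos = q.pos) (h2 : p.lane = q.lane) : p = q := by
  apply Subtype.ext
  exact ofLex.injective (Prod.ext h1 h2)

theorem lt_iff {p q : DividedInterval a b W} :
    p < q ↔ p.pos < q.pos ∨ p.pos = q.pos ∧ p.lane < q.lane := Prod.Lex.lt_iff

/-- The median point at a position. -/
def median (s : ℝ) (hs : s ∈ Ioo a b) : DividedInterval a b W := ⟨toLex (s, 0), hs, Or.inl rfl⟩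

@[simp] theorem lane_median (s : ℝ) (hs : s ∈ Ioo a b) :
    (median s hs : DividedInterval a b W).lane = 0 := rfl

/-- In this form, a condition on the position together with a condition on the side, the topology
can be transported to the surface without reference to the order. -/
theorem nhds_eq (p : DividedInterval a b W) :
    𝓝 p = comap pos (𝓝 p.pos) ⊓ 𝓟 {q | laneSide p.lane p.pos q.pos q.lane} := by
  have hp : p.pos ∈ Ioo a b := p.2.1
  apply le_antisymm
  -- Medians exist at every position and are admissible as either end of a generating interval.
  · have basic : ∀ s t (hs : s ∈ Ioo a b) (ht : t ∈ Ioo a b), median s hs < p → p < median t ht →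
        Ioo (median s hs) (median t ht) ∈ 𝓝 p := by
      intro s t hs ht h1 h2
      have : IsOpen (Ioo (median s hs) (median t ht) : Set (DividedInterval a b W)) :=
        TopologicalSpace.isOpen_generateFrom_of_mem
          ⟨_, _, by simp, by simp, ⟨p, h1, h2⟩, rfl⟩
      exact this.mem_nhds ⟨h1, h2⟩
    refine le_inf ?_ ?_
    · rw [← tendsto_iff_comap]
      refine (nhds_basis_Ioo_pos p.pos).tendsto_right_iff.2 fun ε hε => ?_
      obtain ⟨s, hs1, hs2⟩ := exists_between (max_lt hp.1 (by linarith : p.pos - ε < p.pos))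
      obtain ⟨t, ht1, ht2⟩ := exists_between (lt_min hp.2 (by linarith : p.pos < p.pos + ε))
      rw [max_lt_iff] at hs1
      rw [lt_min_iff] at ht2
      have := basic s t ⟨hs1.1, hs2.trans hp.2⟩ ⟨hp.1.trans ht1, ht2.1⟩
        (lt_iff.2 (Or.inl hs2)) (lt_iff.2 (Or.inl ht1))
      filter_upwards [this] with q hq
      have h1 : s ≤ q.pos := by
        rcases lt_iff.1 hq.1 with h | h
        · exact h.le
        · exact h.1.le
      have h2 : q.pos ≤ t := by
        rcases lt_iff.1 hq.2 with h | h
        · exact h.le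
        · exact h.1.le
      exact ⟨hs1.2.trans_le h1, h2.trans_lt ht2.2⟩
    · rw [le_principal_iff]
      obtain ⟨s, hs1, hs2⟩ := exists_between hp.1
      obtain ⟨t, ht1, ht2⟩ := exists_between hp.2
      rcases h : p.lane with _ | _ | _
      · exact univ_mem' fun q => Or.inl rfl
      -- For a left lane point the median at its own position serves as upper end. Of the three
      -- points at this position only the left lane remains.
      · have := basic s p.pos ⟨hs1, hs2.trans hp.2⟩ hp (lt_iff.2 (Or.inl hs2))
          (lt_iff.2 (Or.inr ⟨rfl, by rw [h, lane_median]; decide⟩))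
        filter_upwards [this] with q hq
        rcases lt_iff.1 hq.2 with h1 | ⟨h1, h2⟩
        · right; left
          have : q.pos < p.pos := h1
          change 0 < ((-1 : SignType) : ℝ) * _
          simp only [SignType.coe_neg, SignType.coe_one]
          linarith
        · right; right
          refine ⟨h1, ?_⟩
          revert h2
          rw [lane_median]
          generalize q.lane = l
          revert l
          decide
      · have := basic p.pos t hp ⟨hp.1.trans ht1, ht2⟩
          (lt_iff.2 (Or.inr ⟨rfl, by rw [h, lane_median]; decide⟩)) (lt_iff.2 (Or.inl ht1))
        filter_upwards [this] with q hq
        rcases lt_iff.1 hq.1 with h1 | ⟨h1, h2⟩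
        · right; left
          have : p.pos < q.pos := h1
          change 0 < ((1 : SignType) : ℝ) * _
          simp only [SignType.coe_one]
          linarith
        · right; right
          refine ⟨h1.symm, ?_⟩
          revert h2
          rw [lane_median]
          generalize q.lane = l
          revert l
          decide
  · rw [TopologicalSpace.nhds_generateFrom]
    refine le_iInf₂ fun U hU => ?_
    obtain ⟨hpU, u, v, hu, hv, -, rfl⟩ := hU
    rw [le_principal_iff, mem_inf_principal]
    obtain ⟨h1, h2⟩ := hpU
    rw [lt_iff] at h1 h2
    -- An admissible lower end at the position of `p` is never a left lane point, so it is the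
    -- median and `p` is in the right lane. The upper end is treated symmetrically.
    have h1' : u.pos < p.pos ∨ u.pos = p.pos ∧ u.lane = 0 ∧ p.lane = 1 := by
      refine h1.imp_right fun h => ⟨h.1, ?_⟩
      have := h.2
      revert hu this
      generalize u.lane = l
      generalize p.lane = l'
      revert l l'
      decide
    have h2' : p.pos < v.pos ∨ p.pos = v.pos ∧ v.lane = 0 ∧ p.lane = -1 := by
      refine h2.imp_right fun h => ⟨h.1, ?_⟩
      have := h.2
      revert hv this
      generalize v.lane = l
      generalize p.lane = l'
      revert l l'
      decide
    have e1 : ∀ᶠ q : DividedInterval a b W in comap pos (𝓝 p.pos), u.pos < p.pos → u.pos < q.pos := by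
      by_cases h : u.pos < p.pos
      · exact (tendsto_comap.eventually (lt_mem_nhds h)).mono fun q hq _ => hq
      · exact Eventually.of_forall fun q hq => absurd hq h
    have e2 : ∀ᶠ q : DividedInterval a b W in comap pos (𝓝 p.pos), p.pos < v.pos → q.pos < v.pos := by
      by_cases h : p.pos < v.pos
      · exact (tendsto_comap.eventually (gt_mem_nhds h)).mono fun q hq _ => hq
      · exact Eventually.of_forall fun q hq => absurd hq h
    filter_upwards [e1, e2] with q hq1 hq2 hq
    constructor
    · rw [lt_iff]
      rcases h1' with h | ⟨ha, hb, hc⟩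
      · exact Or.inl (hq1 h)
      · rcases hq with h | h | h
        · rw [hc] at h; exact absurd h (by decide)
        · rw [hc, SignType.coe_one] at h
          left; linarith
        · right
          refine ⟨by rw [ha, h.1], ?_⟩
          rw [hb, h.2, hc]; decide
    · rw [lt_iff]
      rcases h2' with h | ⟨ha, hb, hc⟩
      · exact Or.inl (hq2 h)
      · rcases hq with h | h | h
        · rw [hc] at h; exact absurd h (by decide)
        · rw [hc, SignType.coe_neg, SignType.coe_one] at h
          left; linarith
        · right
          refine ⟨by rw [h.1, ha], ?_⟩
          rw [hb, h.2, hc]; decide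

end DividedInterval

/-! ### Neighbourhood filters of the divided surface and product boxes -/

namespace TranslationSurface

variable {X : Type u} [TopologicalSpace X] {S : TranslationSurface X}

/-- The lane of the lane points over a singularity in the `m`-th half-disc. -/
def halfLane (m : ℕ) : SignType := if Even m then 1 else -1

theorem halfLane_cast (m : ℕ) : ((halfLane m : SignType) : ℝ) = (-1) ^ m := by
  unfold halfLane
  split_ifs with h
  · rw [h.neg_one_pow, SignType.coe_one]
  · rw [(Nat.not_even_iff_odd.1 h).neg_one_pow, SignType.coe_neg, SignType.coe_one]

theorem halfLane_ne_zero (m : ℕ) : halfLane m ≠ 0 := by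
  unfold halfLane
  split_ifs <;> decide

theorem halfLane_eq_iff {m m' : ℕ} : halfLane m = halfLane m' ↔ (Even m ↔ Even m') := by
  unfold halfLane
  by_cases h : Even m <;> by_cases h' : Even m' <;> simp [h, h']

/-- The projection of the divided surface to the surface. -/
def proj : S.Divided → X
  | .point x _ _ _ => x
  | .singLane b _ => b

def lane : S.Divided → SignType
  | .point _ l _ _ => l
  | .singLane _ m => halfLane m

/-- Over a singularity of order at least `2` this fails: half-discs of equal parity have lane points
with the same projection and the same lane. -/
theorem Divided.ext_point {p q : S.Divided} (h1 : proj p = proj q) (h2 : lane p = lane q)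
    (h3 : proj p ∉ S.sing) : p = q := by
  rcases p with ⟨x, l, hx, hl⟩ | ⟨b, m⟩
  · rcases q with ⟨x', l', hx', hl'⟩ | ⟨b', m'⟩
    · change x = x' at h1
      change l = l' at h2
      subst h1 h2
      rfl
    · exact absurd (h1 ▸ b'.2 : proj (.point x l hx hl : S.Divided) ∈ S.sing) h3
  · exact absurd b.2 h3

theorem lane_eq_zero_or_critical {p : S.Divided} (h : proj p ∉ S.sing) :
    lane p = 0 ∨ proj p ∈ S.critical := by
  rcases p with ⟨x, l, hx, hl⟩ | ⟨b, m⟩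
  · exact hl
  · exact absurd b.2 h

/-- The part of the divided surface over the cone coordinate which belongs to a half-disc. -/
def sector (b : S.sing) (m : Fin (2 * S.order b)) : Set S.Divided :=
  {q | proj q ∈ (S.cone b).source ∧
    0 ≤ (-1) ^ (m : ℕ) * (S.cone b (proj q) ^ S.order b).re ∧
    sectorRoot (S.order b) m (S.cone b (proj q) ^ S.order b) = S.cone b (proj q) ∧
    ((S.cone b (proj q) ^ S.order b).re = 0 → lane q = halfLane m) ∧
    (proj q = b → q = .singLane b m)}

/-- An explicit description of the neighbourhood filters of the divided surface. -/
def nhdsFilter : S.Divided → Filter S.Divided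
  | .point x l hx _ => comap proj (𝓝 x) ⊓
      𝓟 {q | laneSide l ((S.atlas_cover x hx).choose x).re
        ((S.atlas_cover x hx).choose (proj q)).re (lane q)}
  | .singLane b m => comap proj (𝓝 (b : X)) ⊓ 𝓟 (sector b m)

theorem nhdsFilter_eq {q : S.Divided} (hq : proj q ∉ S.sing) {g : X → ℂ}
    (hg : S.IsLocalCoord g (proj q)) : nhdsFilter q = comap proj (𝓝 (proj q)) ⊓
      𝓟 {q' | laneSide (lane q) (g (proj q)).re (g (proj q')).re (lane q')} := by
  rcases q with ⟨x, l, hx, hl⟩ | ⟨b, m⟩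
  · have hc := (S.atlas_cover x hx).choose_spec
    have h1 := hg.eventually_eq_add (isLocalCoord_chart hc.1 hc.2) hx
    have h2 : ∀ᶠ q' in comap (proj : S.Divided → X) (𝓝 x),
        laneSide l ((S.atlas_cover x hx).choose x).re
          ((S.atlas_cover x hx).choose (proj q')).re (lane q') ↔
        laneSide l (g x).re (g (proj q')).re (lane q') := by
      filter_upwards [tendsto_comap.eventually h1] with q' hq'
      refine laneSide_congr ?_
      have h3 := congrArg Complex.re hq'
      rwa [Complex.sub_re, Complex.sub_re] at h3
    apply Filter.ext
    intro s
    simp only [nhdsFilter]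
    rw [mem_inf_principal, mem_inf_principal]
    change (∀ᶠ _ in _, _) ↔ (∀ᶠ _ in _, _)
    apply eventually_congr
    filter_upwards [h2] with q' hq'
    exact imp_congr_left hq'
  · exact absurd b.2 hq

theorem pure_le_nhdsFilter (q : S.Divided) : pure q ≤ nhdsFilter q := by
  rcases q with ⟨x, l, hx, hl⟩ | ⟨b, m⟩
  · refine le_inf ?_ ?_
    · rw [← map_le_iff_le_comap, map_pure]
      exact pure_le_nhds x
    · rw [le_principal_iff]
      exact laneSide_self _ _
  · refine le_inf ?_ ?_
    · rw [← map_le_iff_le_comap, map_pure]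
      exact pure_le_nhds _
    · rw [le_principal_iff]
      refine ⟨S.mem_cone_source b, ?_⟩
      simp only [proj, lane, S.cone_self, zero_pow (S.order_pos b).ne',
        sectorRoot_zero (S.order_pos b)]
      simp

theorem Divided.isOpen_iff_lift {W : Set S.Divided} : IsOpen W ↔
    (∀ B : S.FlowBox, IsOpen (B.lift ⁻¹' W)) ∧ ∀ B : S.HalfBox, IsOpen (B.lift ⁻¹' W) := by
  have key : ∀ t₁ t₂ : TopologicalSpace S.Divided,
      IsOpen[t₁ ⊔ t₂] W ↔ IsOpen[t₁] W ∧ IsOpen[t₂] W := fun _ _ => Iff.rfl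
  refine (key _ _).trans (and_congr ?_ ?_)
  · rw [isOpen_iSup_iff]
    exact forall_congr' fun _ => isOpen_coinduced
  · rw [isOpen_iSup_iff]
    exact forall_congr' fun _ => isOpen_coinduced

/-- A divided rectangle in the divided surface, as a product of a transversal `T` and an interval
in the vertical direction. -/
structure ProdBox (S : TranslationSurface X) where
  patch : S.Patch
  T : Type
  top : TopologicalSpace T
  pos : T → ℝ
  lane : T → SignType
  lift : T × Ioo patch.lo patch.hi → S.Divided
  pos_mem : ∀ s, pos s ∈ patch.J
  ext : ∀ s s', pos s = pos s' → lane s = lane s' → s = s'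
  nhds_eq : ∀ s, 𝓝 s = comap pos (𝓝 (pos s)) ⊓ 𝓟 {s' | laneSide (lane s) (pos s) (pos s') (lane s')}
  proj_lift : ∀ p, proj (lift p) = patch.sec ⟨pos p.1, p.2⟩
  lane_lift : ∀ p, TranslationSurface.lane (lift p) = lane p.1
  continuous_lift : Continuous lift
  sing_line : ∀ b m p, lift p = .singLane b m → (p.2 : ℝ) = 0 ∧ ∀ h : Ioo patch.lo patch.hi,
    proj (lift (p.1, h)) = (S.cone b).symm (sectorRoot (S.order b) m ⟨0, h⟩)
  localFlow : ∀ s (h h' : Ioo patch.lo patch.hi), S.LocalFlow (h' - h) (lift (s, h)) (lift (s, h'))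
  range_mem : ∀ p, range lift ∈ nhdsFilter (lift p)
  nhds_sing : ∀ p, proj (lift p) ∈ S.sing → ContinuousAt patch.coord (proj (lift p)) ∧
    ∃ A : Set S.Divided, nhdsFilter (lift p) = comap proj (𝓝 (proj (lift p))) ⊓ 𝓟 A ∧
      ∀ p', lift p' ∈ A ∧ laneSide (lane p.1) (pos p.1) (pos p'.1) (lane p'.1)

attribute [instance] ProdBox.top

namespace ProdBox

variable (B : S.ProdBox)

/-- The coordinate of a point of the box in the plane. -/
def plane (p : B.T × Ioo B.patch.lo B.patch.hi) : ℂ := ⟨B.pos p.1, p.2⟩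

theorem plane_mem (p : B.T × Ioo B.patch.lo B.patch.hi) :
    B.plane p ∈ B.patch.J ×ℂ Ioo B.patch.lo B.patch.hi := ⟨B.pos_mem p.1, p.2.2⟩

theorem coord_lift (p : B.T × Ioo B.patch.lo B.patch.hi) :
    B.patch.coord (proj (B.lift p)) = B.plane p := by
  rw [B.proj_lift]
  exact B.patch.coord_sec _ (B.plane_mem p)

theorem injective_lift : Function.Injective B.lift := by
  intro p p' h
  have h1 : B.plane p = B.plane p' := by rw [← B.coord_lift, h, B.coord_lift]
  have h2 : B.lane p.1 = B.lane p'.1 := by rw [← B.lane_lift, h, B.lane_lift]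
  exact Prod.ext (B.ext _ _ (congrArg Complex.re h1) h2) (Subtype.ext (congrArg Complex.im h1))

theorem continuous_pos : Continuous B.pos :=
  continuous_iff_continuousAt.2 fun s => by
    rw [ContinuousAt, B.nhds_eq]
    exact tendsto_comap.mono_left inf_le_left

theorem continuous_plane : Continuous B.plane := by
  have h1 : Continuous fun p : B.T × Ioo B.patch.lo B.patch.hi => B.pos p.1 :=
    B.continuous_pos.comp continuous_fst
  have h2 : Continuous fun p : B.T × Ioo B.patch.lo B.patch.hi => (p.2 : ℝ) := by fun_prop
  have : B.plane = fun p => Complex.equivRealProdCLM.symm (B.pos p.1, (p.2 : ℝ)) := by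
    funext p
    apply Complex.ext <;> simp [plane]
  rw [this]
  exact Complex.equivRealProdCLM.symm.continuous.comp (h1.prodMk h2)

theorem continuous_proj_lift : Continuous fun p => proj (B.lift p) := by
  have := B.patch.continuousOn.comp_continuous B.continuous_plane B.plane_mem
  refine this.congr fun p => (B.proj_lift p).symm

theorem isLocalCoord {p : B.T × Ioo B.patch.lo B.patch.hi} (hp : proj (B.lift p) ∉ S.sing) :
    S.IsLocalCoord B.patch.coord (proj (B.lift p)) := by
  have h := B.proj_lift p
  rw [h] at hp ⊢
  exact B.patch.isLocalCoord _ (B.plane_mem p) hp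

/-- As the range of the box belongs to the filter, it suffices that `nhdsFilter` pulls back to the
topology of the box. Both are described by position, height and side; position and height are
recovered from `coord`. Over a singularity `nhds_sing` replaces the missing chart: `coord` is still
continuous, and both side conditions hold on the whole box. -/
theorem map_lift_nhds (p : B.T × Ioo B.patch.lo B.patch.hi) :
    map B.lift (𝓝 p) = nhdsFilter (B.lift p) := by
  obtain ⟨hc, A, hA, hA'⟩ : ContinuousAt B.patch.coord (proj (B.lift p)) ∧
      ∃ A : Set S.Divided, nhdsFilter (B.lift p) = comap proj (𝓝 (proj (B.lift p))) ⊓ 𝓟 A ∧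
      ∀ p', B.lift p' ∈ A ↔ laneSide (B.lane p.1) (B.pos p.1) (B.pos p'.1) (B.lane p'.1) := by
    by_cases hp : proj (B.lift p) ∈ S.sing
    · obtain ⟨h1, A, h2, h3⟩ := B.nhds_sing p hp
      exact ⟨h1, A, h2, fun p' => iff_of_true (h3 p').1 (h3 p').2⟩
    · refine ⟨(B.isLocalCoord hp).continuousAt hp, _, nhdsFilter_eq hp (B.isLocalCoord hp), ?_⟩
      intro p'
      simp only [mem_ofPred_eq, B.coord_lift, B.lane_lift]
      rfl
  have key : 𝓝 p = comap B.lift (nhdsFilter (B.lift p)) := by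
    rw [hA, comap_inf, comap_principal, comap_comap]
    apply le_antisymm
    · refine le_inf ?_ ?_
      · rw [← tendsto_iff_comap]
        exact B.continuous_proj_lift.continuousAt
      · rw [le_principal_iff]
        have : ∀ᶠ s in 𝓝 p.1, laneSide (B.lane p.1) (B.pos p.1) (B.pos s) (B.lane s) := by
          rw [B.nhds_eq]
          exact mem_inf_of_right (mem_principal_self _)
        filter_upwards [(continuous_fst.tendsto p).eventually this] with p' hp'
        exact (hA' p').2 hp'
    · have hpl : Tendsto B.plane (comap (proj ∘ B.lift) (𝓝 (proj (B.lift p)))) (𝓝 (B.plane p)) := by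
        rw [← B.coord_lift]
        refine (hc.tendsto.comp tendsto_comap).congr fun p' => B.coord_lift p'
      rw [← Prod.mk.eta (p := p), nhds_prod_eq, Filter.prod_eq_inf, B.nhds_eq,
        nhds_subtype, comap_inf, comap_comap, comap_principal, comap_comap]
      refine le_inf (le_inf (inf_le_left.trans ?_) (inf_le_right.trans ?_)) (inf_le_left.trans ?_)
      · rw [← tendsto_iff_comap]
        exact (Complex.continuous_re.tendsto _).comp hpl
      · rw [principal_mono]
        exact fun p' hp' => (hA' p').1 hp'
      · rw [← tendsto_iff_comap]
        exact (Complex.continuous_im.tendsto _).comp hpl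
  rw [key, map_comap_of_mem (B.range_mem p)]

end ProdBox

end TranslationSurface

/-! ### The divided charts as product boxes, and the topology of the divided surface -/

namespace TranslationSurface

variable {X : Type u} [TopologicalSpace X] {S : TranslationSurface X}

theorem nhdsFilter_le (q : S.Divided) : nhdsFilter q ≤ comap proj (𝓝 (proj q)) := by
  rcases q with ⟨x, l, hx, hl⟩ | ⟨b, m⟩ <;> exact inf_le_left

theorem singLane_mem_sector (b : S.sing) (m : Fin (2 * S.order b)) :
    (.singLane b m : S.Divided) ∈ sector b m := by
  refine ⟨S.mem_cone_source b, ?_⟩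
  simp only [proj, lane, S.cone_self, zero_pow (S.order_pos b).ne',
    sectorRoot_zero (S.order_pos b)]
  simp

namespace FlowBox

variable (B : S.FlowBox)

theorem mem_range_lift [T2Space X] {q : S.Divided} (hq : proj q ∈ B.chart.source) :
    q ∈ range B.lift := by
  have h1 := B.chart.map_source hq
  rw [B.target_eq] at h1
  have hx : B.chart.symm (B.chart (proj q)) = proj q := B.chart.left_inv hq
  have hns : proj q ∉ S.sing := B.source_subset hq
  have hl : lane q = 0 ∨ (B.chart (proj q)).re ∈ B.cuts := by
    refine (lane_eq_zero_or_critical hns).imp_right fun h => ?_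
    rw [B.mem_cuts_iff h1.1 h1.2]
    change B.chart.symm (B.chart (proj q)) ∈ _
    rwa [hx]
  refine ⟨(⟨toLex ((B.chart (proj q)).re, lane q), h1.1, hl⟩, ⟨_, h1.2⟩), ?_⟩
  refine Divided.ext_point hx rfl ?_
  exact B.symm_notMem (z := ⟨_, _⟩) h1.1 h1.2

/-- The divided flow box. -/
def prodBox [T2Space X] : S.ProdBox where
  patch := B.patch
  T := DividedInterval B.a B.b B.cuts
  top := inferInstance
  pos := DividedInterval.pos
  lane := DividedInterval.lane
  lift := B.lift
  pos_mem s := s.2.1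
  ext _ _ := DividedInterval.ext
  nhds_eq := DividedInterval.nhds_eq
  proj_lift _ := rfl
  lane_lift _ := rfl
  continuous_lift := continuous_def.2 fun _ hW => (Divided.isOpen_iff_lift.1 hW).1 B
  sing_line _ _ _ h := by cases h
  localFlow s h h' := Or.inl ⟨B, s, h, h', by ring, rfl, rfl⟩
  range_mem p := by
    refine mem_inf_of_left (mem_of_superset (preimage_mem_comap (B.chart.open_source.mem_nhds ?_))
      fun q hq => B.mem_range_lift hq)
    exact B.chart.map_target (by rw [B.target_eq]; exact ⟨p.1.2.1, p.2.2⟩)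
  nhds_sing p hp := absurd hp (B.symm_notMem (z := ⟨_, _⟩) p.1.2.1 p.2.2)

end FlowBox

namespace HalfBox

variable (B : S.HalfBox)

theorem half_mem_iff {a b : ℝ} {W : Set ℝ} {m : ℕ} (d : DividedInterval a b W) :
    (if Even m then toLex (0, 1) ≤ d.1 else d.1 ≤ toLex (0, -1)) ↔
      0 < (-1) ^ m * d.pos ∨ d.pos = 0 ∧ d.lane = halfLane m := by
  unfold halfLane
  split_ifs with h
  · rw [h.neg_one_pow, one_mul, Prod.Lex.le_iff]
    have e : (1 : SignType) ≤ d.lane ↔ d.lane = 1 := by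
      generalize d.lane = l; revert l; decide
    change 0 < d.pos ∨ 0 = d.pos ∧ 1 ≤ d.lane ↔ _
    rw [e, eq_comm (a := (0 : ℝ))]
  · rw [(Nat.not_even_iff_odd.1 h).neg_one_pow, Prod.Lex.le_iff]
    have e : d.lane ≤ (-1 : SignType) ↔ d.lane = -1 := by
      generalize d.lane = l; revert l; decide
    change d.pos < 0 ∨ d.pos = 0 ∧ d.lane ≤ -1 ↔ _
    rw [e, neg_one_mul, neg_pos]

theorem half_pos_or (s : B.Half) : 0 < (-1) ^ (B.m : ℕ) * s.1.pos ∨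
    s.1.pos = 0 ∧ s.1.lane = halfLane B.m := (half_mem_iff s.1).1 s.2

theorem pos_mem (s : B.Half) : s.1.pos ∈ B.patch.J := ⟨s.1.2.1, B.half_re s⟩

theorem lift_of_eq_zero {p : B.Half × Ioo (-B.r) B.r} (h : (⟨p.1.1.pos, p.2⟩ : ℂ) = 0) :
    B.lift p = .singLane B.b B.m := by
  rw [lift, dif_pos h]

theorem proj_lift (p : B.Half × Ioo (-B.r) B.r) :
    proj (B.lift p) = B.map ⟨p.1.1.pos, p.2⟩ := by
  by_cases h : (⟨p.1.1.pos, p.2⟩ : ℂ) = 0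
  · rw [B.lift_of_eq_zero h, h, B.map_zero]
    rfl
  · rw [lift, dif_neg h]
    rfl

theorem lane_lift (p : B.Half × Ioo (-B.r) B.r) : lane (B.lift p) = p.1.1.lane := by
  by_cases h : (⟨p.1.1.pos, p.2⟩ : ℂ) = 0
  · have h0 : p.1.1.pos = 0 := congrArg Complex.re h
    rw [B.lift_of_eq_zero h]
    rcases B.half_pos_or p.1 with h1 | h1
    · rw [h0, mul_zero] at h1
      exact absurd h1 (lt_irrefl _)
    · exact h1.2.symm
  · rw [lift, dif_neg h]
    rfl

theorem proj_lift_mem_source (p : B.Half × Ioo (-B.r) B.r) :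
    proj (B.lift p) ∈ (S.cone B.b).source := by
  rw [B.proj_lift]
  exact B.map_mem_source (z := ⟨_, _⟩) p.1.1.2.1 p.2.2 (B.half_re p.1)

theorem cone_proj_lift_pow (p : B.Half × Ioo (-B.r) B.r) :
    S.cone B.b (proj (B.lift p)) ^ S.order B.b = ⟨p.1.1.pos, p.2⟩ := by
  rw [B.proj_lift]
  exact B.cone_map_pow (z := ⟨_, _⟩) p.1.1.2.1 p.2.2 (B.half_re p.1)

theorem cone_proj_lift (p : B.Half × Ioo (-B.r) B.r) :
    S.cone B.b (proj (B.lift p)) = sectorRoot (S.order B.b) B.m ⟨p.1.1.pos, p.2⟩ := by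
  rw [B.proj_lift, map, (S.cone B.b).right_inv]
  exact B.fits ⟨_, _⟩ p.1.1.2.1 p.2.2 (B.half_re p.1)

theorem eq_zero_of_proj_lift_mem {p : B.Half × Ioo (-B.r) B.r} (h : proj (B.lift p) ∈ S.sing) :
    (⟨p.1.1.pos, p.2⟩ : ℂ) = 0 := by
  by_contra hne
  rw [B.proj_lift] at h
  exact B.map_notMem_sing (z := ⟨_, _⟩) p.1.1.2.1 p.2.2 (B.half_re p.1) hne h

theorem lift_mem_sector (p : B.Half × Ioo (-B.r) B.r) : B.lift p ∈ sector B.b B.m := by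
  refine ⟨B.proj_lift_mem_source p, ?_, ?_, ?_, ?_⟩
  · rw [B.cone_proj_lift_pow]
    exact B.half_re p.1
  · rw [B.cone_proj_lift_pow, B.cone_proj_lift]
  · rw [B.cone_proj_lift_pow, B.lane_lift]
    intro h
    have h0 : p.1.1.pos = 0 := h
    rcases B.half_pos_or p.1 with h1 | h1
    · rw [h0, mul_zero] at h1
      exact absurd h1 (lt_irrefl _)
    · exact h1.2
  · intro h
    exact B.lift_of_eq_zero (B.eq_zero_of_proj_lift_mem (h ▸ B.b.2))

/-- Together with `lift_mem_sector` this identifies the range as the part of the sector over the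
square of radius `r`. -/
theorem mem_range_lift [T2Space X] {q : S.Divided} (hq : q ∈ sector B.b B.m)
    (h1 : (S.cone B.b (proj q) ^ S.order B.b).re ∈ Ioo (-B.r) B.r)
    (h2 : (S.cone B.b (proj q) ^ S.order B.b).im ∈ Ioo (-B.r) B.r) : q ∈ range B.lift := by
  obtain ⟨q1, q2, q3, q4, q5⟩ := hq
  set z := S.cone B.b (proj q) ^ S.order B.b with hz
  have hmap : B.map z = proj q := by
    rw [map, q3, (S.cone B.b).left_inv q1]
  have hside : 0 < (-1) ^ (B.m : ℕ) * z.re ∨ z.re = 0 ∧ lane q = halfLane B.m := by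
    rcases q2.lt_or_eq with h | h
    · exact Or.inl h
    · have h0 : z.re = 0 := by
        rcases mul_eq_zero.1 h.symm with h | h
        · exact absurd h (pow_ne_zero _ (by norm_num))
        · exact h
      exact Or.inr ⟨h0, q4 h0⟩
  have hl : lane q = 0 ∨ z.re ∈ B.cuts := by
    by_cases h0 : z.re = 0
    · exact Or.inr (Or.inl h0)
    · have hz0 : z ≠ 0 := fun h => h0 (by rw [h]; rfl)
      have hns : proj q ∉ S.sing := by
        rw [← hmap]
        exact B.map_notMem_sing h1 h2 q2 hz0
      refine (lane_eq_zero_or_critical hns).imp_right fun h => ?_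
      rw [B.mem_cuts_iff ⟨h1, q2⟩ h0 h2]
      change B.map z ∈ _
      rwa [hmap]
  let d : DividedInterval (-B.r) B.r B.cuts := ⟨toLex (z.re, lane q), h1, hl⟩
  let p : B.Half × Ioo (-B.r) B.r := (⟨d, (half_mem_iff d).2 hside⟩, ⟨z.im, h2⟩)
  refine ⟨p, ?_⟩
  have hp : proj (B.lift p) = proj q := by
    rw [B.proj_lift, ← hmap]
    rfl
  by_cases h0 : proj q ∈ S.sing
  · have hb : proj q = B.b := by
      have : proj q ∈ (S.cone B.b).source ∩ S.sing := ⟨q1, h0⟩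
      rwa [S.cone_source_inter] at this
    rw [q5 hb]
    apply B.lift_of_eq_zero
    have : z = 0 := by rw [hz, hb, S.cone_self, zero_pow (S.order_pos _).ne']
    exact this
  · exact Divided.ext_point hp (B.lane_lift p) (hp ▸ h0)

/-- The branch of the root persists by `eventually_sectorRoot_eq`, and so does a strict sign of the
real part. At a nonsingular point of the edge the side condition of its lane keeps the neighbours in
the half-disc. -/
theorem sector_mem (p : B.Half × Ioo (-B.r) B.r) : sector B.b B.m ∈ nhdsFilter (B.lift p) := by
  by_cases hs : proj (B.lift p) ∈ S.sing
  · rw [B.lift_of_eq_zero (B.eq_zero_of_proj_lift_mem hs)]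
    exact mem_inf_of_right (mem_principal_self _)
  have hsrc := B.proj_lift_mem_source p
  have hne : proj (B.lift p) ≠ B.b := fun h => hs (h ▸ B.b.2)
  have hz := B.cone_proj_lift_pow p
  rw [nhdsFilter_eq hs (isLocalCoord_cone B.b hsrc hne), B.lane_lift, hz, mem_inf_principal]
  have hw0 : S.cone B.b (proj (B.lift p)) ≠ 0 := fun h =>
    hne (eq_of_cone_pow_eq_zero B.b hsrc (by rw [h, zero_pow (S.order_pos _).ne']))
  have hroot := (B.lift_mem_sector p).2.2.1
  have hre := (B.lift_mem_sector p).2.1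
  have e1 : ∀ᶠ y in 𝓝 (proj (B.lift p)), y ∈ (S.cone B.b).source ∧ y ≠ B.b ∧
      sectorRoot (S.order B.b) B.m (S.cone B.b y ^ S.order B.b) = S.cone B.b y := by
    have h0 : ∀ᶠ y in 𝓝 (proj (B.lift p)), y ∈ (S.cone B.b).source :=
      (S.cone B.b).open_source.mem_nhds hsrc
    refine h0.and (Eventually.and ?_ ?_)
    · have : ∀ᶠ y in 𝓝 (proj (B.lift p)), S.cone B.b y ≠ 0 :=
        ((S.cone B.b).continuousAt hsrc).eventually_ne hw0
      exact this.mono fun y hy h => hy (by rw [h, S.cone_self])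
    · exact ((S.cone B.b).continuousAt hsrc).eventually
        (eventually_sectorRoot_eq hw0 hre hroot)
  have e2 : ∀ᶠ y in 𝓝 (proj (B.lift p)), 0 < (-1) ^ (B.m : ℕ) * p.1.1.pos →
      0 < (-1) ^ (B.m : ℕ) * (S.cone B.b y ^ S.order B.b).re := by
    by_cases h : 0 < (-1) ^ (B.m : ℕ) * p.1.1.pos
    · have hc : ContinuousAt (fun y => (-1) ^ (B.m : ℕ) * (S.cone B.b y ^ S.order B.b).re)
          (proj (B.lift p)) :=
        continuousAt_const.mul
          (Complex.continuous_re.continuousAt.comp (continuousAt_cone_pow B.b hsrc))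
      have := hc.eventually (lt_mem_nhds (a := 0) (by simp only [hz]; exact h))
      exact this.mono fun y hy _ => hy
    · exact Eventually.of_forall fun y hy => absurd hy h
  filter_upwards [tendsto_comap.eventually e1, tendsto_comap.eventually e2] with q h1 h2 hq
  have hq' : 0 < (-1) ^ (B.m : ℕ) * (S.cone B.b (proj q) ^ S.order B.b).re ∨
      (S.cone B.b (proj q) ^ S.order B.b).re = 0 ∧ lane q = halfLane B.m := by
    rcases B.half_pos_or p.1 with h | ⟨h3, h4⟩
    · exact Or.inl (h2 h)
    · rw [h3, h4] at hq
      rcases hq with h | h | h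
      · exact absurd h (halfLane_ne_zero _)
      · left
        rwa [halfLane_cast, sub_zero] at h
      · exact Or.inr h
  refine ⟨h1.1, ?_, h1.2.2, fun h => ?_, fun h => absurd h h1.2.1⟩
  · rcases hq' with h | h
    · exact h.le
    · rw [h.1, mul_zero]
  · rcases hq' with h' | h'
    · rw [h, mul_zero] at h'
      exact absurd h' (lt_irrefl _)
    · exact h'.2

theorem laneSide_zero (s : B.Half) : laneSide (halfLane B.m) 0 s.1.pos s.1.lane := by
  rcases B.half_pos_or s with h | h
  · exact Or.inr (Or.inl (by rwa [halfLane_cast, sub_zero]))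
  · exact Or.inr (Or.inr h)

theorem nhds_half (s : B.Half) : 𝓝 s = comap (fun s : B.Half => s.1.pos) (𝓝 s.1.pos) ⊓
    𝓟 {s' | laneSide s.1.lane s.1.pos s'.1.pos s'.1.lane} := by
  have h : 𝓝 s = comap (fun s : B.Half => s.1) (𝓝 s.1) := nhds_induced _ _
  rw [h, DividedInterval.nhds_eq, comap_inf, comap_comap, comap_principal]
  rfl

/-- The line through a lane point over `b` is the image of the imaginary axis under the branch `m`.
It depends on `b` and `m` only, which permits the comparison of different half-open boxes. -/
theorem proj_lift_of_eq_singLane (b : S.sing) (m : Fin (2 * S.order b))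
    (p : B.Half × Ioo (-B.r) B.r) (hp : B.lift p = .singLane b m) :
    (p.2 : ℝ) = 0 ∧ ∀ h : Ioo (-B.r) B.r,
      proj (B.lift (p.1, h)) = (S.cone b).symm (sectorRoot (S.order b) m ⟨0, h⟩) := by
  have hs : proj (B.lift p) ∈ S.sing := hp ▸ b.2
  have h0 := B.eq_zero_of_proj_lift_mem hs
  rw [B.lift_of_eq_zero h0] at hp
  refine ⟨congrArg Complex.im h0, fun h => ?_⟩
  rw [B.proj_lift]
  have h1 : p.1.1.pos = 0 := congrArg Complex.re h0
  change B.map ⟨p.1.1.pos, h⟩ = _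
  rw [h1, map]
  obtain ⟨hb, hm⟩ : ∃ e : B.b = b, e ▸ B.m = m := by
    cases hp
    exact ⟨rfl, rfl⟩
  subst hb
  subst hm
  rfl

theorem range_lift_mem [T2Space X] (p : B.Half × Ioo (-B.r) B.r) :
    range B.lift ∈ nhdsFilter (B.lift p) := by
  have hc : ContinuousAt (fun y => S.cone B.b y ^ S.order B.b) (proj (B.lift p)) :=
    continuousAt_cone_pow B.b (B.proj_lift_mem_source p)
  have hz := B.cone_proj_lift_pow p
  have h1 : ∀ᶠ y in 𝓝 (proj (B.lift p)), (S.cone B.b y ^ S.order B.b).re ∈ Ioo (-B.r) B.r ∧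
      (S.cone B.b y ^ S.order B.b).im ∈ Ioo (-B.r) B.r := by
    have h2 : (S.cone B.b (proj (B.lift p)) ^ S.order B.b).re ∈ Ioo (-B.r) B.r := by
      rw [hz]; exact p.1.1.2.1
    have h3 : (S.cone B.b (proj (B.lift p)) ^ S.order B.b).im ∈ Ioo (-B.r) B.r := by
      rw [hz]; exact p.2.2
    exact ((Complex.continuous_re.continuousAt.comp hc).eventually (Ioo_mem_nhds h2.1 h2.2)).and
      ((Complex.continuous_im.continuousAt.comp hc).eventually (Ioo_mem_nhds h3.1 h3.2))
  have h2 : ∀ᶠ q in nhdsFilter (B.lift p),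
      (S.cone B.b (proj q) ^ S.order B.b).re ∈ Ioo (-B.r) B.r ∧
      (S.cone B.b (proj q) ^ S.order B.b).im ∈ Ioo (-B.r) B.r :=
    nhdsFilter_le _ (tendsto_comap.eventually h1)
  filter_upwards [B.sector_mem p, h2] with q hq hq'
  exact B.mem_range_lift hq hq'.1 hq'.2

theorem nhdsFilter_lift_of_mem_sing (p : B.Half × Ioo (-B.r) B.r) (hp : proj (B.lift p) ∈ S.sing) :
    ContinuousAt (fun y => S.cone B.b y ^ S.order B.b) (proj (B.lift p)) ∧
    ∃ A : Set S.Divided, nhdsFilter (B.lift p) = comap proj (𝓝 (proj (B.lift p))) ⊓ 𝓟 A ∧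
      ∀ p', B.lift p' ∈ A ∧ laneSide p.1.1.lane p.1.1.pos p'.1.1.pos p'.1.1.lane := by
  have h0 := B.eq_zero_of_proj_lift_mem hp
  refine ⟨continuousAt_cone_pow B.b (B.proj_lift_mem_source p), sector B.b B.m, ?_, ?_⟩
  · rw [B.lift_of_eq_zero h0]
    rfl
  · refine fun p' => ⟨B.lift_mem_sector p', ?_⟩
    have h1 : p.1.1.pos = 0 := congrArg Complex.re h0
    have h2 : p.1.1.lane = halfLane B.m := by
      rw [← B.lane_lift, B.lift_of_eq_zero h0]
      rfl
    rw [h1, h2]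
    exact B.laneSide_zero p'.1

/-- The divided half-open box. -/
def prodBox [T2Space X] : S.ProdBox where
  patch := B.patch
  T := B.Half
  top := inferInstance
  pos s := s.1.pos
  lane s := s.1.lane
  lift := B.lift
  pos_mem := B.pos_mem
  ext _ _ h h' := Subtype.ext (DividedInterval.ext h h')
  nhds_eq := B.nhds_half
  proj_lift := B.proj_lift
  lane_lift := B.lane_lift
  continuous_lift := continuous_def.2 fun _ hW => (Divided.isOpen_iff_lift.1 hW).2 B
  sing_line := B.proj_lift_of_eq_singLane
  localFlow s h h' := Or.inr ⟨B, s, h, h', by ring, rfl, rfl⟩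
  range_mem := B.range_lift_mem
  nhds_sing := B.nhdsFilter_lift_of_mem_sing

end HalfBox

theorem LocalFlow.exists_prodBox [T2Space X] {t : ℝ} {p q : S.Divided} (h : S.LocalFlow t p q) :
    ∃ (B : S.ProdBox) (s : B.T) (h h' : Ioo B.patch.lo B.patch.hi), (h' : ℝ) = h + t ∧
      B.lift (s, h) = p ∧ B.lift (s, h') = q := by
  rcases h with ⟨B, s, h, h', e, h1, h2⟩ | ⟨B, s, h, h', e, h1, h2⟩
  · exact ⟨B.prodBox, s, h, h', e, h1, h2⟩
  · exact ⟨B.prodBox, s, h, h', e, h1, h2⟩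

theorem exists_prodBox [T2Space X] (p : S.Divided) :
    ∃ (B : S.ProdBox) (q : B.T × Ioo B.patch.lo B.patch.hi), B.lift q = p := by
  by_cases hp : proj p ∈ S.sing
  · rcases p with ⟨x, l, hx, hl⟩ | ⟨b, m⟩
    · exact absurd hp hx
    · obtain ⟨r, hr, h⟩ := exists_halfBox_radius b univ_mem
      let B : S.HalfBox := ⟨b, m, r, fun z h1 h2 _ => (h m z h1 h2).1⟩
      have h0 : S.cone b (proj (.singLane b m : S.Divided)) ^ S.order b = 0 := by
        simp only [proj, S.cone_self, zero_pow (S.order_pos b).ne']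
      obtain ⟨q, hq⟩ := B.mem_range_lift (q := .singLane b m) (singLane_mem_sector b m)
        (by change (S.cone b _ ^ S.order b).re ∈ Ioo (-r) r; rw [h0]; simpa using hr)
        (by change (S.cone b _ ^ S.order b).im ∈ Ioo (-r) r; rw [h0]; simpa using hr)
      exact ⟨B.prodBox, q, hq⟩
  · obtain ⟨c, hc, hxc⟩ := S.atlas_cover _ hp
    obtain ⟨B, -, -, hB, -⟩ := (isLocalCoord_chart hc hxc).exists_flowBox hp univ_mem
    obtain ⟨q, hq⟩ := B.mem_range_lift hB
    exact ⟨B.prodBox, q, hq⟩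

theorem Divided.isOpen_iff [T2Space X] {W : Set S.Divided} :
    IsOpen W ↔ ∀ p ∈ W, W ∈ nhdsFilter p := by
  constructor
  · intro hW p hp
    obtain ⟨B, q, rfl⟩ := exists_prodBox p
    rw [← B.map_lift_nhds]
    exact (hW.preimage B.continuous_lift).mem_nhds hp
  · intro h
    rw [Divided.isOpen_iff_lift]
    constructor
    · intro B
      refine isOpen_iff_mem_nhds.2 fun q hq => ?_
      exact (B.prodBox.map_lift_nhds q).le (h _ hq)
    · intro B
      refine isOpen_iff_mem_nhds.2 fun q hq => ?_
      exact (B.prodBox.map_lift_nhds q).le (h _ hq)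

/-- The condition needed is that a set in the filter of a point belongs to the filters of all nearby
points. It holds in the product topology of a box and is carried over by `map_lift_nhds`. -/
theorem Divided.nhds_eq [T2Space X] (p : S.Divided) : 𝓝 p = nhdsFilter p := by
  apply le_antisymm
  · intro W hW
    have hsub : {q | W ∈ nhdsFilter q} ⊆ W := fun q hq => pure_le_nhdsFilter q hq
    refine mem_of_superset (IsOpen.mem_nhds (Divided.isOpen_iff.2 fun q hq => ?_) hW) hsub
    obtain ⟨B, q', rfl⟩ := exists_prodBox q
    change W ∈ nhdsFilter (B.lift q') at hq
    rw [← B.map_lift_nhds] at hq ⊢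
    have h1 : ∀ᶠ p' in 𝓝 q', ∀ᶠ p'' in 𝓝 p', B.lift p'' ∈ W := eventually_eventually_nhds.2 hq
    change ∀ᶠ p' in 𝓝 q', W ∈ nhdsFilter (B.lift p')
    filter_upwards [h1] with p' hp'
    rw [← B.map_lift_nhds]
    exact hp'
  · intro W hW
    obtain ⟨V, hVW, hVo, hpV⟩ := mem_nhds_iff.1 hW
    exact mem_of_superset (Divided.isOpen_iff.1 hVo p hpV) hVW

theorem ProdBox.map_nhds [T2Space X] (B : S.ProdBox) (p : B.T × Ioo B.patch.lo B.patch.hi) :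
    map B.lift (𝓝 p) = 𝓝 (B.lift p) := by
  rw [B.map_lift_nhds, Divided.nhds_eq]

theorem continuous_proj [T2Space X] : Continuous (proj : S.Divided → X) :=
  continuous_iff_continuousAt.2 fun p => by
    rw [ContinuousAt, Divided.nhds_eq]
    exact tendsto_comap.mono_left (nhdsFilter_le p)

end TranslationSurface

/-! ### The fractured surface is compact and Hausdorff -/

namespace TranslationSurface

variable {X : Type u} [TopologicalSpace X] {S : TranslationSurface X}

theorem notMem_sing_of_mem_critical {x : X} (h : x ∈ S.critical) : x ∉ S.sing := by
  rcases h with h | h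
  · exact FallsIntoSing.notMem h
  · exact FallsIntoSing.notMem h

theorem mem_fractured_iff {p : S.Divided} : p ∉ S.iota '' {x | x.1 ∈ S.critical} ↔
    (proj p ∈ S.critical → lane p ≠ 0) := by
  constructor
  · intro h h1 h2
    exact h ⟨⟨proj p, notMem_sing_of_mem_critical h1⟩, h1,
      Divided.ext_point (p := S.iota _) rfl h2.symm (notMem_sing_of_mem_critical h1)⟩
  · rintro h ⟨x, hx, rfl⟩
    exact h hx rfl

theorem Fractured.lane_ne_zero (p : S.Fractured) (h : proj p.1 ∈ S.critical) : lane p.1 ≠ 0 :=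
  mem_fractured_iff.1 p.2 h

theorem Fractured.lane_ne_zero_iff (p : S.Fractured) (h : proj p.1 ∉ S.sing) :
    lane p.1 ≠ 0 ↔ proj p.1 ∈ S.critical :=
  ⟨fun h1 => (lane_eq_zero_or_critical h).resolve_left h1, p.lane_ne_zero⟩

theorem neg_one_pow_congr {m m' : ℕ} (h : Even m ↔ Even m') : (-1 : ℝ) ^ m = (-1) ^ m' := by
  by_cases he : Even m
  · rw [he.neg_one_pow, (h.1 he).neg_one_pow]
  · rw [(Nat.not_even_iff_odd.1 he).neg_one_pow,
      (Nat.not_even_iff_odd.1 (fun h' => he (h.2 h'))).neg_one_pow]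

theorem neg_one_pow_of_not_iff {m m' : ℕ} (h : ¬(Even m ↔ Even m')) :
    (-1 : ℝ) ^ m = - (-1) ^ m' := by
  have h1 : Even m ↔ Even (m' + 1) := by rw [Nat.even_add_one]; tauto
  rw [neg_one_pow_congr h1, pow_succ]
  ring

/-- For equal parity the branches of the root tell half-discs apart. For opposite parity a common
point lies on a boundary line, where its lane determines the parity. Over `b` itself the last clause
of `sector` decides. -/
theorem sector_injective {b : S.sing} {m m' : Fin (2 * S.order b)} {q : S.Divided}
    (h : q ∈ sector b m) (h' : q ∈ sector b m') : m = m' := by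
  obtain ⟨h1, h2, h3, h4, h5⟩ := h
  obtain ⟨-, h2', h3', h4', h5'⟩ := h'
  by_cases hb : proj q = b
  · have := (h5 hb).symm.trans (h5' hb)
    injection this
  have hz : S.cone b (proj q) ^ S.order b ≠ 0 := fun h => hb (eq_of_cone_pow_eq_zero b h1 h)
  by_cases hp : Even (m : ℕ) ↔ Even (m' : ℕ)
  · exact sectorRoot_injective hp hz (h3.trans h3'.symm)
  · exfalso
    rw [neg_one_pow_of_not_iff hp] at h2
    have h0 : (-1) ^ (m' : ℕ) * (S.cone b (proj q) ^ S.order b).re = 0 := by linarith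
    have h0' := (mul_eq_zero.1 h0).resolve_left (pow_ne_zero _ (by norm_num))
    have := (h4 h0').symm.trans (h4' h0')
    exact hp (halfLane_eq_iff.1 this)

theorem nhds_fractured [T2Space X] (p : S.Fractured) : 𝓝 p = comap Subtype.val (nhdsFilter p.1) := by
  have h : 𝓝 p = comap Subtype.val (𝓝 p.1) := nhds_induced _ _
  rw [h, Divided.nhds_eq]

theorem continuous_proj_fractured [T2Space X] : Continuous fun p : S.Fractured => proj p.1 :=
  continuous_proj.comp continuous_subtype_val

/-- Different projections are separated in `X`. In a common fibre there remain the two lanes of a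
critical point or the lane points of different half-discs, and their sides are disjoint. The
medians, which meet both sides, have been removed. -/
theorem t2Space_fractured [T2Space X] : T2Space S.Fractured := by
  rw [t2Space_iff_disjoint_nhds]
  intro p q hpq
  by_cases hx : proj p.1 = proj q.1
  · have main : ∃ A B : Set S.Divided, A ∈ nhdsFilter p.1 ∧ B ∈ nhdsFilter q.1 ∧ Disjoint A B := by
      by_cases hs : proj p.1 ∈ S.sing
      · obtain ⟨p, hp⟩ := p
        obtain ⟨q, hq⟩ := q
        rcases p with ⟨x, l, hx', hl⟩ | ⟨b, m⟩
        · exact absurd hs hx'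
        rcases q with ⟨x, l, hx', hl⟩ | ⟨b', m'⟩
        · change (b : X) = x at hx
          exact absurd (hx ▸ b.2) hx'
        have hb : b = b' := Subtype.ext hx
        subst hb
        refine ⟨sector b m, sector b m', mem_inf_of_right (mem_principal_self _),
          mem_inf_of_right (mem_principal_self _), disjoint_left.2 fun r hr hr' => hpq ?_⟩
        rw [Subtype.mk.injEq, sector_injective hr hr']
      · have hs' : proj q.1 ∉ S.sing := hx ▸ hs
        obtain ⟨c, hc, hxc⟩ := S.atlas_cover _ hs
        have hg := isLocalCoord_chart hc hxc
        have hg' : S.IsLocalCoord c (proj q.1) := hx ▸ hg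
        have hl : lane p.1 ≠ lane q.1 := fun h => hpq (Subtype.ext (Divided.ext_point hx h hs))
        have h1 := p.lane_ne_zero_iff hs
        have h2 := q.lane_ne_zero_iff hs'
        rw [← hx, ← h1] at h2
        rw [nhdsFilter_eq hs hg, nhdsFilter_eq hs' hg']
        refine ⟨_, _, mem_inf_of_right (mem_principal_self _),
          mem_inf_of_right (mem_principal_self _), disjoint_left.2 fun r hr hr' => ?_⟩
        simp only [mem_ofPred_eq, ← hx, laneSide] at hr hr'
        have hn1 : lane p.1 ≠ 0 := fun h => hl (by rw [h, not_not.1 fun h' => (h2.1 h') h])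
        have hn2 : lane q.1 ≠ 0 := h2.2 hn1
        have hneg : lane q.1 = - lane p.1 := by
          revert hl hn1 hn2
          generalize lane p.1 = l
          generalize lane q.1 = l'
          revert l l'
          decide
        rw [hneg, SignType.coe_neg] at hr'
        replace hr := hr.resolve_left hn1
        replace hr' := hr'.resolve_left (by rw [← hneg]; exact hn2)
        rcases hr with h | ⟨h, h'⟩ <;> rcases hr' with k | ⟨k, k'⟩
        · linarith
        · rw [k] at h; simp at h
        · rw [h] at k; simp at k
        · exact hl (by rw [← h', k', ← hneg])
    obtain ⟨A, B, hA, hB, hAB⟩ := main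
    rw [nhds_fractured, nhds_fractured, Filter.disjoint_iff]
    exact ⟨_, preimage_mem_comap hA, _, preimage_mem_comap hB, hAB.preimage _⟩
  · exact (continuous_proj_fractured.tendsto p).disjoint (disjoint_nhds_nhds.2 hx)
      (continuous_proj_fractured.tendsto q)

/-- Near a critical point, the points in the same vertical line are critical. -/
theorem eventually_critical [T2Space X] {x : X} (hx : x ∈ S.critical) {g : X → ℂ}
    (hg : S.IsLocalCoord g x) : ∀ᶠ y in 𝓝 x, (g y).re = (g x).re → y ∈ S.critical := by
  obtain ⟨B, r, hr, hxB, -, hE, -⟩ :=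
    hg.exists_flowBox (notMem_sing_of_mem_critical hx) univ_mem
  filter_upwards [B.chart.open_source.mem_nhds hxB] with y hy h
  rw [← hE hy, ← hE hxB] at h
  have h1 := B.chart.map_source hxB
  have h2 := B.chart.map_source hy
  rw [B.target_eq] at h1 h2
  have h3 : (B.chart x).re ∈ B.cuts := by
    rw [B.mem_cuts_iff h1.1 h1.2]
    change B.chart.symm (B.chart x) ∈ _
    rwa [B.chart.left_inv hxB]
  rw [← h, B.mem_cuts_iff h2.1 h2.2] at h3
  change B.chart.symm (B.chart y) ∈ _ at h3
  rwa [B.chart.left_inv hy] at h3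

theorem exists_singLane {p : S.Divided} (h : proj p ∈ S.sing) :
    ∃ (b : S.sing) (m : Fin (2 * S.order b)), p = .singLane b m := by
  rcases p with ⟨x, l, hx, hl⟩ | ⟨b, m⟩
  · exact absurd h hx
  · exact ⟨b, m, rfl⟩

theorem eq_of_mem_cone_source {b : S.sing} {x : X} (h : x ∈ (S.cone b).source) (hx : x ∈ S.sing) :
    x = b := by
  have : x ∈ (S.cone b).source ∩ S.sing := ⟨h, hx⟩
  rwa [S.cone_source_inter] at this

/-- Around a singularity the half-discs cover the fractured surface. -/
theorem eventually_mem_sector (b : S.sing) : ∀ᶠ y in 𝓝 (b : X),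
    ∀ q : S.Fractured, proj q.1 = y → ∃ m, q.1 ∈ sector b m := by
  obtain ⟨r, hr, hfit⟩ := exists_halfBox_radius b univ_mem
  have hsrc := S.mem_cone_source b
  have h0 : ∀ᶠ y in 𝓝 (b : X), y ∈ (S.cone b).source := (S.cone b).open_source.mem_nhds hsrc
  have h1 : ∀ᶠ y in 𝓝 (b : X), (S.cone b y ^ S.order b).im ∈ Ioo (-r) r := by
    have hc := Complex.continuous_im.continuousAt.comp (continuousAt_cone_pow b hsrc)
    refine hc.eventually (Ioo_mem_nhds ?_ ?_) <;>
      simp [S.cone_self, zero_pow (S.order_pos b).ne', hr]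
  filter_upwards [h0, h1] with y hy hy' q hq
  subst hq
  by_cases hs : proj q.1 ∈ S.sing
  · have hb := eq_of_mem_cone_source hy hs
    obtain ⟨b', m, hm⟩ := exists_singLane hs
    have : b' = b := by
      rw [hm] at hb
      exact Subtype.ext hb
    subst this
    exact ⟨m, hm ▸ singLane_mem_sector _ m⟩
  have hbne : proj q.1 ≠ b := fun h => hs (h ▸ b.2)
  set z := S.cone b (proj q.1) ^ S.order b with hz
  -- The lines that bound the half-discs are critical. Points over them therefore carry a nonzero
  -- lane, which selects the half-disc.
  have crit : z.re = 0 → proj q.1 ∈ S.critical := by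
    intro hre
    obtain ⟨m, -, hm⟩ := exists_sectorRoot_eq (S.order_pos b) (e := 0) (by norm_num)
      (S.cone b (proj q.1))
    let B : S.HalfBox := ⟨b, m, r, fun z h1 h2 _ => (hfit m z h1 h2).1⟩
    have h3 : z.im ≠ 0 := fun h3 => hbne (eq_of_cone_pow_eq_zero b hy (Complex.ext hre h3))
    have h4 := B.edge_critical (h := z.im) hy' h3
    have h5 : (⟨0, z.im⟩ : ℂ) = z := Complex.ext hre.symm rfl
    rw [h5] at h4
    have h6 : B.map z = proj q.1 := by
      change (S.cone b).symm (sectorRoot _ m z) = _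
      rw [hm, (S.cone b).left_inv hy]
    rwa [h6] at h4
  have he : ∃ e < 2, 0 ≤ (-1) ^ e * z.re ∧ (z.re = 0 → lane q.1 = halfLane e) := by
    rcases lt_trichotomy z.re 0 with h | h | h
    · exact ⟨1, by norm_num, by rw [pow_one]; linarith, fun h' => absurd h' h.ne⟩
    · have h3 := q.lane_ne_zero (crit h)
      rcases h4 : lane q.1 with _ | _ | _
      · exact absurd h4 h3
      · exact ⟨1, by norm_num, by rw [h]; simp, fun _ => rfl⟩
      · exact ⟨0, by norm_num, by rw [h]; simp, fun _ => rfl⟩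
    · exact ⟨0, by norm_num, by rw [pow_zero]; linarith, fun h' => absurd h' h.ne'⟩
  obtain ⟨e, he2, he3, he4⟩ := he
  obtain ⟨m, hm, hm'⟩ := exists_sectorRoot_eq (S.order_pos b) he2 (S.cone b (proj q.1))
  refine ⟨m, hy, ?_, hm', fun h => ?_, fun h => absurd h hbne⟩
  · rw [neg_one_pow_congr hm]
    exact he3
  · rw [halfLane_eq_iff.2 hm]
    exact he4 h

/-- The projection of an ultrafilter converges to some `x`. Finitely many sides cover the fractured
surface near `x`: two at a critical point, `2 k` at a singularity. The ultrafilter contains one of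
them and converges to the corresponding point over `x`. -/
theorem compactSpace_fractured [T2Space X] [CompactSpace X] : CompactSpace S.Fractured := by
  refine ⟨isCompact_iff_ultrafilter_le_nhds.2 fun F _ => ?_⟩
  obtain ⟨x, -, hx⟩ := isCompact_univ.ultrafilter_le_nhds (F.map fun p : S.Fractured => proj p.1)
    (by simp)
  have hx' : Tendsto (fun p : S.Fractured => proj p.1) F (𝓝 x) := hx
  suffices ∃ p : S.Fractured, Tendsto Subtype.val (F : Filter S.Fractured) (nhdsFilter p.1) by
    obtain ⟨p, hp⟩ := this
    refine ⟨p, mem_univ _, ?_⟩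
    rw [nhds_fractured]
    exact hp.le_comap
  by_cases hs : x ∈ S.sing
  · have h1 := hx'.eventually (eventually_mem_sector ⟨x, hs⟩)
    have h2 : (⋃ m ∈ (univ : Set (Fin (2 * S.order ⟨x, hs⟩))),
        {q : S.Fractured | q.1 ∈ sector ⟨x, hs⟩ m}) ∈ F := by
      filter_upwards [h1] with q hq
      obtain ⟨m, hm⟩ := hq q rfl
      exact mem_biUnion (mem_univ m) hm
    rw [Ultrafilter.finite_biUnion_mem_iff finite_univ] at h2
    obtain ⟨m, -, hm⟩ := h2
    refine ⟨⟨.singLane ⟨x, hs⟩ m, mem_fractured_iff.2 fun h => ?_⟩, ?_⟩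
    · exact absurd hs (notMem_sing_of_mem_critical h)
    · exact tendsto_inf.2 ⟨tendsto_comap_iff.2 hx', tendsto_principal.2 hm⟩
  · obtain ⟨c, hc, hxc⟩ := S.atlas_cover _ hs
    have hg := isLocalCoord_chart hc hxc
    by_cases hcr : x ∈ S.critical
    · have h1 : ∀ᶠ q : S.Fractured in F, laneSide 1 (c x).re (c (proj q.1)).re (lane q.1) ∨
          laneSide (-1) (c x).re (c (proj q.1)).re (lane q.1) := by
        filter_upwards [hx'.eventually (eventually_critical hcr hg)] with q hq
        unfold laneSide
        rw [SignType.coe_neg, SignType.coe_one]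
        rcases lt_trichotomy (c (proj q.1)).re (c x).re with h | h | h
        · right; right; left; linarith
        · have h3 := q.lane_ne_zero (hq h)
          rcases h4 : lane q.1 with _ | _ | _
          · exact absurd h4 h3
          · right; right; right; exact ⟨h, rfl⟩
          · left; right; right; exact ⟨h, rfl⟩
        · left; right; left; linarith
      have h2 : ∃ l : SignType, l ≠ 0 ∧
          ∀ᶠ q : S.Fractured in F, laneSide l (c x).re (c (proj q.1)).re (lane q.1) := by
        rcases Ultrafilter.eventually_or.1 h1 with h | h
        · exact ⟨1, by decide, h⟩
        · exact ⟨-1, by decide, h⟩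
      obtain ⟨l, hl, h3⟩ := h2
      refine ⟨⟨.point x l hs (Or.inr hcr), mem_fractured_iff.2 fun _ => hl⟩, ?_⟩
      rw [nhdsFilter_eq hs hg]
      exact tendsto_inf.2 ⟨tendsto_comap_iff.2 hx', tendsto_principal.2 h3⟩
    · refine ⟨⟨.point x 0 hs (Or.inl rfl), mem_fractured_iff.2 fun h => absurd h hcr⟩, ?_⟩
      rw [nhdsFilter_eq hs hg]
      exact tendsto_inf.2 ⟨tendsto_comap_iff.2 hx',
        tendsto_principal.2 (Eventually.of_forall fun _ => Or.inl rfl)⟩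

theorem exists_fractured (x : X) : ∃ p : S.Fractured, proj p.1 = x := by
  by_cases hs : x ∈ S.sing
  · have := S.order_pos ⟨x, hs⟩
    exact ⟨⟨.singLane ⟨x, hs⟩ ⟨0, by omega⟩, mem_fractured_iff.2 fun h =>
      absurd hs (notMem_sing_of_mem_critical h)⟩, rfl⟩
  · by_cases hcr : x ∈ S.critical
    · exact ⟨⟨.point x 1 hs (Or.inr hcr), mem_fractured_iff.2 fun _ => one_ne_zero⟩, rfl⟩
    · exact ⟨⟨.point x 0 hs (Or.inl rfl), mem_fractured_iff.2 fun h => absurd h hcr⟩, rfl⟩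

end TranslationSurface

/-! ### Extension of a local flow -/

section LocalFlowExtension

variable {K : Type*} [TopologicalSpace K]

/-- A local flow which is defined for a uniform time extends to a flow. -/
theorem exists_flow_of_local {ε : ℝ} (hε : 0 < ε) (φ : ℝ → K → K) (h0 : ∀ p, φ 0 p = p)
    (hadd : ∀ s t p, |s| < ε → |t| < ε → |s + t| < ε → φ t (φ s p) = φ (s + t) p)
    (hc : ∀ t p, |t| < ε → ContinuousAt (Function.uncurry φ) (t, p)) :
    ∃ ψ : Flow ℝ K, ∀ t p, |t| < ε → ψ t p = φ t p := by
  obtain ⟨h, hh⟩ : ∃ h, h = ε / 2 := ⟨_, rfl⟩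
  have hpos : 0 < h := by rw [hh]; positivity
  have hlt : |h| < ε := by rw [abs_of_pos hpos, hh]; linarith
  have hlt' : |(-h)| < ε := by rwa [abs_neg]
  let e : Equiv.Perm K := ⟨φ h, φ (-h), fun p => by
      rw [hadd _ _ _ hlt hlt' (by simpa using hε), add_neg_cancel, h0], fun p => by
      rw [hadd _ _ _ hlt' hlt (by simpa using hε), neg_add_cancel, h0]⟩
  have he : ∀ p, e p = φ h p := fun p => rfl
  have hcomm : ∀ (n : ℤ) (r : ℝ) (p : K), 0 ≤ r → r < h → (e ^ n) (φ r p) = φ r ((e ^ n) p) := by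
    intro n r p hr hr'
    have h1 : |r| < ε := by rw [abs_of_nonneg hr]; linarith
    have h2 : |r + h| < ε := by rw [abs_of_nonneg (by linarith)]; linarith
    have hc1 : ∀ p, e (φ r p) = φ r (e p) := by
      intro p
      rw [he, he, hadd _ _ _ h1 hlt h2, hadd _ _ _ hlt h1 (by rwa [add_comm]), add_comm]
    have hc2 : ∀ p, e⁻¹ (φ r p) = φ r (e⁻¹ p) := by
      intro p
      rw [Equiv.Perm.inv_eq_iff_eq, hc1, ← Equiv.Perm.mul_apply, mul_inv_cancel, Equiv.Perm.one_apply]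
    induction n generalizing p with
    | zero => simp
    | succ n ih => rw [zpow_add_one, Equiv.Perm.mul_apply, hc1, ih, Equiv.Perm.mul_apply]
    | pred n ih => rw [zpow_sub_one, Equiv.Perm.mul_apply, hc2, ih, Equiv.Perm.mul_apply]
  have hstep : ∀ (n : ℤ) (r : ℝ) (p : K), |r| < ε → |r - h| < ε →
      φ (r - h) ((e ^ (n + 1)) p) = φ r ((e ^ n) p) := by
    intro n r p h1 h2
    rw [add_comm n 1, zpow_add, zpow_one, Equiv.Perm.mul_apply, he, hadd _ _ _ hlt h2 (by simpa using h1)]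
    simp
  -- Time `t = n * h + r` with `0 ≤ r < h` is run as `n` steps of length `h` and a remainder.
  let f : ℝ → K → K := fun t p => φ (t - ⌊t / h⌋ * h) ((e ^ ⌊t / h⌋) p)
  have hfl : ∀ t : ℝ, 0 ≤ t - ⌊t / h⌋ * h ∧ t - ⌊t / h⌋ * h < h := by
    intro t
    have h1 := Int.floor_le (t / h)
    have h2 := Int.lt_floor_add_one (t / h)
    rw [le_div_iff₀ hpos] at h1
    rw [div_lt_iff₀ hpos] at h2
    constructor <;> linarith
  -- Any decomposition with `|r| ≤ h` gives the same result: its `n` differs from the floor by at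
  -- most `1`, and `hstep` makes up for one step.
  have hW : ∀ (t r : ℝ) (n : ℤ) (p : K), |r| ≤ h → t = n * h + r → f t p = φ r ((e ^ n) p) := by
    intro t r n p hr ht
    obtain ⟨h1, h2⟩ := hfl t
    obtain ⟨h3, h4⟩ := abs_le.1 hr
    change φ (t - ⌊t / h⌋ * h) ((e ^ ⌊t / h⌋) p) = _
    generalize ⌊t / h⌋ = m at h1 h2
    subst ht
    have hr' : |r| < ε := by linarith
    have h5 : m < n + 2 := by
      have : (m : ℝ) * h < (n + 2 : ℤ) * h := by push_cast; linarith
      exact_mod_cast lt_of_mul_lt_mul_right this hpos.le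
    have h6 : n - 2 < m := by
      have : ((n - 2 : ℤ) : ℝ) * h < m * h := by push_cast; linarith
      exact_mod_cast lt_of_mul_lt_mul_right this hpos.le
    obtain h7 | h7 | h7 : m = n - 1 ∨ m = n ∨ m = n + 1 := by omega
    · subst h7
      push_cast at h1 h2 ⊢
      have e1 : n * h + r - (n - 1) * h = r + h := by ring
      have := hstep (n - 1) (r + h) p (by rw [abs_lt]; constructor <;> linarith)
        (by simpa using hr')
      rw [sub_add_cancel, add_sub_cancel_right] at this
      rw [e1, this]
    · subst h7
      simp
    · subst h7
      push_cast at h1 h2 ⊢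
      have e1 : n * h + r - (n + 1) * h = r - h := by ring
      rw [e1]
      exact hstep n r p hr' (by rw [abs_lt]; constructor <;> linarith)
  have hf0 : ∀ p, f 0 p = p := by
    intro p
    rw [hW 0 0 0 p (by simpa using hpos.le) (by simp)]
    simp [h0]
  have hfadd : ∀ t s p, f (t + s) p = f t (f s p) := by
    intro t s p
    obtain ⟨h1, h2⟩ := hfl t
    obtain ⟨h3, h4⟩ := hfl s
    have e1 : f t (f s p) = φ (t - ⌊t / h⌋ * h) ((e ^ ⌊t / h⌋) (φ (s - ⌊s / h⌋ * h)
      ((e ^ ⌊s / h⌋) p))) := rfl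
    rw [e1]
    obtain ⟨r, hr⟩ : ∃ r, r = t - ⌊t / h⌋ * h := ⟨_, rfl⟩
    obtain ⟨r', hr'⟩ : ∃ r', r' = s - ⌊s / h⌋ * h := ⟨_, rfl⟩
    rw [← hr] at h1 h2 ⊢
    rw [← hr'] at h3 h4 ⊢
    have ht : t = ⌊t / h⌋ * h + r := by rw [hr]; ring
    have hs : s = ⌊s / h⌋ * h + r' := by rw [hr']; ring
    generalize ⌊t / h⌋ = m at *
    generalize ⌊s / h⌋ = n at *
    have hrr : |r' + r| < ε := by rw [abs_lt]; constructor <;> linarith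
    rw [hcomm _ _ _ h3 h4, ← Equiv.Perm.mul_apply, ← zpow_add,
      hadd _ _ _ (by rw [abs_lt]; constructor <;> linarith)
        (by rw [abs_lt]; constructor <;> linarith) hrr]
    -- The two remainders may add up to more than `h`; then one step is carried over.
    rcases le_or_gt (r' + r) h with hle | hgt
    · exact hW _ _ _ _ (by rw [abs_le]; constructor <;> linarith) (by push_cast; linarith)
    · rw [← hstep (m + n) (r' + r) p hrr (by rw [abs_lt]; constructor <;> linarith)]
      exact hW _ _ _ _ (by rw [abs_le]; constructor <;> linarith) (by push_cast; linarith)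
  have hfφ : ∀ t p, |t| < ε → f t p = φ t p := by
    have hsmall : ∀ t p, |t| ≤ h → f t p = φ t p := fun t p ht => by
      rw [hW t t 0 p ht (by simp)]
      simp
    intro t p ht
    -- `hW` reaches only to `h = ε / 2`; the remaining times below `ε` are halved.
    have h2 : |t / 2| ≤ h := by rw [abs_div, abs_two]; linarith
    have h3 : |t / 2| < ε := by linarith
    have e2 : t / 2 + t / 2 = t := by ring
    rw [← e2, hfadd, hsmall _ _ h2, hsmall _ _ h2, hadd _ _ _ h3 h3 (by rwa [e2])]
  have hφc : ∀ t, |t| < ε → Continuous (φ t) := fun t ht =>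
    continuous_iff_continuousAt.2 fun p =>
      (hc t p ht).comp (f := fun p => (t, p)) (by fun_prop)
  have hec : ∀ n : ℤ, Continuous (e ^ n : Equiv.Perm K) := by
    intro n
    induction n with
    | zero => exact continuous_id
    | succ n ih =>
      rw [zpow_add_one]
      exact ih.comp (hφc h hlt)
    | pred n ih =>
      rw [zpow_sub_one]
      exact ih.comp (hφc (-h) hlt')
  have hfc : ∀ t, Continuous (f t) := fun t => by
    obtain ⟨h1, h2⟩ := hfl t
    exact (hφc _ (by rw [abs_lt]; constructor <;> linarith)).comp (hec _)
  refine ⟨⟨f, ?_, hfadd, hf0⟩, hfφ⟩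
  rw [continuous_iff_continuousAt]
  rintro ⟨t₀, p₀⟩
  -- Joint continuity at time `t₀` is reduced to time `0` by `f t = f t₀ ∘ φ (t - t₀)`.
  have h1 : ContinuousAt (fun x : ℝ × K => f t₀ (Function.uncurry φ (x.1 - t₀, x.2))) (t₀, p₀) := by
    refine (hfc t₀).continuousAt.comp (ContinuousAt.comp (f := fun x : ℝ × K => (x.1 - t₀, x.2))
      (hc _ _ ?_) (by fun_prop))
    simpa using hε
  refine h1.congr ?_
  have h2 : ∀ᶠ x : ℝ × K in 𝓝 (t₀, p₀), |x.1 - t₀| < ε := by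
    have : ContinuousAt (fun x : ℝ × K => |x.1 - t₀|) (t₀, p₀) := by fun_prop
    exact this.eventually (gt_mem_nhds (by simpa using hε))
  filter_upwards [h2] with x hx
  simp only [Function.uncurry]
  rw [← hfφ _ _ hx, ← hfadd]
  simp

end LocalFlowExtension

/-! ### Vertical lines in the fractured surface -/

namespace TranslationSurface

variable {X : Type u} [TopologicalSpace X] {S : TranslationSurface X}

theorem lane_ne_zero_of_mem_sing {p : S.Divided} (h : proj p ∈ S.sing) : lane p ≠ 0 := by
  obtain ⟨b, m, rfl⟩ := exists_singLane h
  exact halfLane_ne_zero _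

namespace ProdBox

variable (B : S.ProdBox)

/-- The vertical lines of a box do not leave the fractured surface. -/
theorem lift_mem_fractured [T2Space X] {s : B.T} (h h' : Ioo B.patch.lo B.patch.hi)
    (hp : B.lift (s, h) ∉ S.iota '' {x | x.1 ∈ S.critical}) :
    B.lift (s, h') ∉ S.iota '' {x | x.1 ∈ S.critical} := by
  rw [mem_fractured_iff, B.lane_lift] at hp ⊢
  intro h1 h2
  -- The lane is constant along the line and nonzero over singularities, so a line of medians meets
  -- none.
  have hn : ∀ x ∈ Ioo B.patch.lo B.patch.hi, B.patch.sec ⟨B.pos s, x⟩ ∉ S.sing := by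
    intro x hx hsing
    have h3 := B.proj_lift (s, ⟨x, hx⟩)
    simp only at h3
    rw [← h3] at hsing
    exact lane_ne_zero_of_mem_sing hsing (by rw [B.lane_lift]; exact h2)
  refine hp ?_ h2
  rw [B.proj_lift] at h1 ⊢
  exact (B.patch.critical_iff (B.pos_mem s) hn h.2 h'.2).2 h1

/-- A point of the height interval of a box, with a default value. -/
def clamp (h₀ : Ioo B.patch.lo B.patch.hi) (x : ℝ) : Ioo B.patch.lo B.patch.hi :=
  open Classical in if hx : x ∈ Ioo B.patch.lo B.patch.hi then ⟨x, hx⟩ else h₀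

theorem clamp_of_mem {h₀ : Ioo B.patch.lo B.patch.hi} {x : ℝ}
    (hx : x ∈ Ioo B.patch.lo B.patch.hi) : B.clamp h₀ x = ⟨x, hx⟩ := dif_pos hx

theorem continuousAt_clamp (h₀ : Ioo B.patch.lo B.patch.hi) {x : ℝ}
    (hx : x ∈ Ioo B.patch.lo B.patch.hi) : ContinuousAt (B.clamp h₀) x := by
  rw [ContinuousAt, tendsto_subtype_rng, B.clamp_of_mem hx]
  refine tendsto_id.congr' ?_
  filter_upwards [Ioo_mem_nhds hx.1 hx.2] with y hy
  rw [B.clamp_of_mem hy]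
  rfl

variable {B} {B' : S.ProdBox}

/-- Off the singularities the two coordinates differ by a translation and are injective. At a
singularity, where there is no chart, `sing_line` describes both lines by the same branch of the
root. -/
theorem line_eventually_eq [T2Space X] {s : B.T} {s' : B'.T} {h : Ioo B.patch.lo B.patch.hi}
    {h' : Ioo B'.patch.lo B'.patch.hi} (hE : B.lift (s, h) = B'.lift (s', h')) :
    ∀ᶠ δ in 𝓝 (0 : ℝ), B.lift (s, B.clamp h (h + δ)) = B'.lift (s', B'.clamp h' (h' + δ)) := by
  have hc : ∀ (B : S.ProdBox) (s : B.T) (h : Ioo B.patch.lo B.patch.hi),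
      Tendsto (fun δ : ℝ => B.lift (s, B.clamp h ((h : ℝ) + δ))) (𝓝 0) (𝓝 (B.lift (s, h))) ∧
      ∀ᶠ δ in 𝓝 (0 : ℝ), (h : ℝ) + δ ∈ Ioo B.patch.lo B.patch.hi := by
    intro B s h
    have h1 : Tendsto (fun δ : ℝ => (h : ℝ) + δ) (𝓝 0) (𝓝 h) := by
      have : Continuous fun δ : ℝ => (h : ℝ) + δ := by fun_prop
      simpa using this.tendsto 0
    refine ⟨?_, h1.eventually (Ioo_mem_nhds h.2.1 h.2.2)⟩
    have h2 := (B.continuousAt_clamp h h.2).tendsto.comp h1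
    rw [B.clamp_of_mem h.2] at h2
    exact (B.continuous_lift.tendsto (s, h)).comp (tendsto_const_nhds.prodMk_nhds h2)
  obtain ⟨t1, r1⟩ := hc B s h
  obtain ⟨t2, r2⟩ := hc B' s' h'
  have hlane : B.lane s = B'.lane s' := by
    have h1 := B.lane_lift (s, h)
    have h2 := B'.lane_lift (s', h')
    rw [hE] at h1
    exact h1.symm.trans h2
  by_cases hs : proj (B.lift (s, h)) ∈ S.sing
  · obtain ⟨b, m, hbm⟩ := exists_singLane hs
    obtain ⟨z1, l1⟩ := B.sing_line b m _ hbm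
    obtain ⟨z2, l2⟩ := B'.sing_line b m _ (hE ▸ hbm)
    filter_upwards [r1, r2] with δ k1 k2
    -- `ext_point` does not apply at the singularity itself.
    by_cases hδ : δ = 0
    · subst hδ
      have e1 : B.clamp h (h + 0) = h := by simp only [add_zero]; exact B.clamp_of_mem h.2
      have e2 : B'.clamp h' (h' + 0) = h' := by simp only [add_zero]; exact B'.clamp_of_mem h'.2
      rw [e1, e2, hE]
    · rw [B.clamp_of_mem k1, B'.clamp_of_mem k2]
      refine Divided.ext_point ?_ (by rw [B.lane_lift, B'.lane_lift]; exact hlane) fun hs' => hδ ?_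
      · rw [l1, l2]
        simp only at z1 z2 ⊢
        rw [z1, z2]
      · obtain ⟨b', m', hbm'⟩ := exists_singLane hs'
        have h0 := (B.sing_line b' m' _ hbm').1
        simp only at h0 z1
        linarith
  · have hs' : proj (B'.lift (s', h')) ∉ S.sing := hE ▸ hs
    have g1 := B.isLocalCoord hs
    have g2 : S.IsLocalCoord B'.patch.coord (proj (B.lift (s, h))) := by
      rw [hE]
      exact B'.isLocalCoord hs'
    obtain ⟨U, hU, hinj⟩ := g2.eventually_injective hs
    have p1 := (continuous_proj.tendsto _).comp t1
    have p2 := (continuous_proj.tendsto _).comp t2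
    rw [← hE] at p2
    filter_upwards [r1, r2, p1.eventually (g1.eventually_eq_add g2 hs), p1.eventually hU,
      p2.eventually hU, p1.eventually (isOpen_compl_sing.mem_nhds hs)] with δ k1 k2 k3 k4 k5 k6
    simp only [Function.comp] at k3 k4 k5 k6
    refine Divided.ext_point (hinj k4 k5 ?_) (by rw [B.lane_lift, B'.lane_lift]; exact hlane) k6
    rw [sub_eq_iff_eq_add] at k3
    rw [k3, hE, B'.coord_lift, B'.coord_lift, ← hE, B.coord_lift, B.coord_lift, B.clamp_of_mem k1,
      B'.clamp_of_mem k2]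
    apply Complex.ext
    · simp [plane]
    · simp only [plane, Complex.add_im, Complex.sub_im]
      ring

/-- Two vertical lines through the same point agree. -/
theorem line_eq [T2Space X] {s : B.T} {s' : B'.T} {h : Ioo B.patch.lo B.patch.hi}
    {h' : Ioo B'.patch.lo B'.patch.hi} (hE : B.lift (s, h) = B'.lift (s', h'))
    (hK : B.lift (s, h) ∉ S.iota '' {x | x.1 ∈ S.critical}) {t : ℝ}
    (ht : h + t ∈ Ioo B.patch.lo B.patch.hi) (ht' : h' + t ∈ Ioo B'.patch.lo B'.patch.hi) :
    B.lift (s, ⟨h + t, ht⟩) = B'.lift (s', ⟨h' + t, ht'⟩) := by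
  let J : Set ℝ := {t | (h : ℝ) + t ∈ Ioo B.patch.lo B.patch.hi ∧
    (h' : ℝ) + t ∈ Ioo B'.patch.lo B'.patch.hi}
  have hJ : J.OrdConnected :=
    ⟨fun x hx y hy z hz => ⟨⟨by linarith [hx.1.1, hz.1], by linarith [hy.1.2, hz.2]⟩,
      ⟨by linarith [hx.2.1, hz.1], by linarith [hy.2.2, hz.2]⟩⟩⟩
  have : PreconnectedSpace J := Subtype.preconnectedSpace hJ.isPreconnected
  -- The set of agreement is closed only in a Hausdorff target, hence the passage to the fractured
  -- surface.
  have : T2Space S.Fractured := t2Space_fractured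
  let f : J → S.Fractured := fun t => ⟨B.lift (s, ⟨h + t, t.2.1⟩), B.lift_mem_fractured h _ hK⟩
  let g : J → S.Fractured := fun t => ⟨B'.lift (s', ⟨h' + t, t.2.2⟩),
    B'.lift_mem_fractured h' _ (hE ▸ hK)⟩
  have hf : Continuous f := by
    refine Continuous.subtype_mk (B.continuous_lift.comp ?_) _
    exact continuous_const.prodMk (Continuous.subtype_mk (by fun_prop) _)
  have hg : Continuous g := by
    refine Continuous.subtype_mk (B'.continuous_lift.comp ?_) _
    exact continuous_const.prodMk (Continuous.subtype_mk (by fun_prop) _)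
  have key := eq_of_locally_eq hf hg (fun τ hτ => ?_) (y₀ := ⟨0, by simpa [J] using ⟨h.2, h'.2⟩⟩) (by
    apply Subtype.ext
    simp only [f, g, add_zero]
    exact hE) ⟨t, ht, ht'⟩
  · exact congrArg Subtype.val key
  · have h1 := line_eventually_eq (congrArg Subtype.val hτ)
    have h2 : Tendsto (fun τ' : J => (τ' : ℝ) - τ) (𝓝 τ) (𝓝 0) := by
      have : Continuous fun τ' : J => (τ' : ℝ) - τ := by fun_prop
      simpa using this.tendsto τ
    filter_upwards [h2.eventually h1] with τ' hτ'
    apply Subtype.ext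
    have e1 : (h : ℝ) + τ + (τ' - τ) = h + τ' := by ring
    have e2 : (h' : ℝ) + τ + (τ' - τ) = h' + τ' := by ring
    simp only [e1, e2] at hτ'
    rwa [B.clamp_of_mem τ'.2.1, B'.clamp_of_mem τ'.2.2] at hτ'

end ProdBox

end TranslationSurface

/-! ### Existence of the vertical flow -/

namespace TranslationSurface

variable {X : Type u} [TopologicalSpace X] {S : TranslationSurface X}

/-- The vertical line through `p` in some box extends by `ε` in both directions. -/
def HasMargin (ε : ℝ) (p : S.Divided) : Prop :=
  ∃ (B : S.ProdBox) (s : B.T) (h : Ioo B.patch.lo B.patch.hi),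
    B.lift (s, h) = p ∧ B.patch.lo ≤ h - ε ∧ h + ε ≤ B.patch.hi

theorem exists_hasMargin [T2Space X] [CompactSpace X] (S : TranslationSurface X) :
    ∃ ε > 0, ∀ p : S.Fractured, HasMargin ε p.1 := by
  have : CompactSpace S.Fractured := compactSpace_fractured
  have := isCompact_univ.induction_on (X := S.Fractured)
    (p := fun U => ∃ ε > 0, ∀ p ∈ U, HasMargin ε p.1) ⟨1, one_pos, by simp⟩
    (fun U V hUV ⟨ε, hε, h⟩ => ⟨ε, hε, fun p hp => h p (hUV hp)⟩)
    (fun U V ⟨ε, hε, h⟩ ⟨ε', hε', h'⟩ => by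
      refine ⟨min ε ε', lt_min hε hε', fun p hp => ?_⟩
      rcases hp with hp | hp
      · obtain ⟨B, s, y, e, h1, h2⟩ := h p hp
        exact ⟨B, s, y, e, by linarith [min_le_left ε ε'], by linarith [min_le_left ε ε']⟩
      · obtain ⟨B, s, y, e, h1, h2⟩ := h' p hp
        exact ⟨B, s, y, e, by linarith [min_le_right ε ε'], by linarith [min_le_right ε ε']⟩)
    (fun p _ => by
      obtain ⟨B, ⟨s, h⟩, hB⟩ := exists_prodBox p.1
      -- With half the distance to the ends as `ε`, all heights within `ε` of `h` still have margin
      -- `ε`.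
      obtain ⟨ε, hε⟩ : ∃ ε, ε = min (h - B.patch.lo) (B.patch.hi - h) / 2 := ⟨_, rfl⟩
      have hpos : 0 < min ((h : ℝ) - B.patch.lo) (B.patch.hi - h) :=
        lt_min (by linarith [h.2.1]) (by linarith [h.2.2])
      have h1 := min_le_left ((h : ℝ) - B.patch.lo) (B.patch.hi - h)
      have h2 := min_le_right ((h : ℝ) - B.patch.lo) (B.patch.hi - h)
      have hW : {q | HasMargin ε q} ∈ 𝓝 p.1 := by
        rw [← hB, ← B.map_nhds]
        have : ∀ᶠ q : B.T × Ioo B.patch.lo B.patch.hi in 𝓝 (s, h), |(q.2 : ℝ) - h| < ε := by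
          have hc : Continuous fun q : B.T × Ioo B.patch.lo B.patch.hi => |(q.2 : ℝ) - h| := by
            fun_prop
          exact (hc.tendsto (s, h)).eventually (gt_mem_nhds (by simp; linarith))
        change ∀ᶠ q in map B.lift _, _
        rw [eventually_map]
        filter_upwards [this] with q hq
        rw [abs_lt] at hq
        exact ⟨B, q.1, q.2, rfl, by linarith, by linarith⟩
      refine ⟨_, mem_nhdsWithin_of_mem_nhds
        (continuous_subtype_val.continuousAt.preimage_mem_nhds hW), ε, by linarith,
        fun q hq => hq⟩)
  obtain ⟨ε, hε, h⟩ := this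
  exact ⟨ε, hε, fun p => h p (mem_univ p)⟩

/-- For `|t| < ε` the flow is translation in a box with margin; `line_eq` makes this independent of
the box. The extended flow is translation in every box, however high, so it respects all
compositions of local flows. Conversely any time is a sum of steps shorter than `ε`. -/
theorem exists_verticalFlow [T2Space X] [CompactSpace X] (S : TranslationSurface X) :
    ∃ ψ : Flow ℝ S.Fractured, ∀ (t : ℝ) (p : S.Fractured) (q : S.Divided),
      (ψ t p : S.Divided) = q ↔ S.VerticalFlow t p q := by
  obtain ⟨ε, hε, hmar⟩ := exists_hasMargin S
  have : T2Space S.Fractured := t2Space_fractured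
  have hmem : ∀ {h ε' t lo hi : ℝ}, lo ≤ h - ε' → h + ε' ≤ hi → |t| < ε' → h + t ∈ Ioo lo hi := by
    intro h ε' t lo hi h1 h2 h3
    rw [abs_lt] at h3
    constructor <;> linarith
  have hex : ∀ (t : ℝ) (p : S.Fractured), ∃ q : S.Fractured, |t| < ε →
      ∀ (B : S.ProdBox) (s : B.T) (h : Ioo B.patch.lo B.patch.hi)
        (ht : h + t ∈ Ioo B.patch.lo B.patch.hi), B.lift (s, h) = p.1 →
        q.1 = B.lift (s, ⟨h + t, ht⟩) := by
    intro t p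
    by_cases ht : |t| < ε
    · obtain ⟨B, s, h, e, h1, h2⟩ := hmar p
      have hK : B.lift (s, h) ∉ S.iota '' {x | x.1 ∈ S.critical} := e ▸ p.2
      refine ⟨⟨B.lift (s, ⟨h + t, hmem h1 h2 ht⟩), B.lift_mem_fractured h _ hK⟩, fun _ B' s' h' ht' e' => ?_⟩
      exact ProdBox.line_eq (e.trans e'.symm) hK _ _
    -- A default value; times with `|t| ≥ ε` are never used.
    · exact ⟨p, fun h => absurd h ht⟩
  choose φ hφ using hex
  have h0 : ∀ p, φ 0 p = p := by
    intro p
    obtain ⟨B, s, h, e, h1, h2⟩ := hmar p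
    have := hφ 0 p (by simpa using hε) B s h (by rw [add_zero]; exact h.2) e
    apply Subtype.ext
    rw [this, ← e]
    simp
  have hadd : ∀ s t p, |s| < ε → |t| < ε → |s + t| < ε → φ t (φ s p) = φ (s + t) p := by
    intro s t p hs ht hst
    obtain ⟨B, σ, h, e, h1, h2⟩ := hmar p
    have m1 := hmem h1 h2 hs
    have m2 := hmem h1 h2 hst
    have m3 : h + s + t ∈ Ioo B.patch.lo B.patch.hi := by rwa [add_assoc]
    have e1 := hφ s p hs B σ h m1 e
    have e2 := hφ (s + t) p hst B σ h m2 e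
    have e3 := hφ t (φ s p) ht B σ ⟨h + s, m1⟩ m3 e1.symm
    apply Subtype.ext
    rw [e3, e2]
    simp only [add_assoc]
  have hc : ∀ t p, |t| < ε → ContinuousAt (Function.uncurry φ) (t, p) := by
    intro t₀ p₀ ht₀
    obtain ⟨B, s, h, e, h1, h2⟩ := hmar p₀
    have m0 := hmem h1 h2 ht₀
    have : Nonempty (B.T × Ioo B.patch.lo B.patch.hi) := ⟨(s, h)⟩
    -- `map_nhds` makes this inverse continuous at `p₀`, so continuity can be checked in the box.
    let inv := Function.invFun B.lift
    have hinv : Function.LeftInverse inv B.lift := Function.leftInverse_invFun B.injective_lift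
    have hmap := B.map_nhds (s, h)
    have hti : Tendsto inv (𝓝 p₀.1) (𝓝 (s, h)) := by
      rw [← e, ← hmap, Tendsto, Filter.map_map, hinv.comp_eq_id, Filter.map_id]
    have hli : ∀ᶠ p in 𝓝 p₀.1, B.lift (inv p) = p := by
      rw [← e, ← hmap, eventually_map]
      exact Eventually.of_forall fun q => by rw [hinv]
    have tv : Tendsto (fun x : ℝ × S.Fractured => x.2.1) (𝓝 (t₀, p₀)) (𝓝 p₀.1) :=
      (continuous_subtype_val.comp continuous_snd).tendsto (t₀, p₀)
    have tt : Tendsto (fun x : ℝ × S.Fractured => x.1) (𝓝 (t₀, p₀)) (𝓝 t₀) :=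
      continuous_fst.tendsto (t₀, p₀)
    have th : Tendsto (fun x : ℝ × S.Fractured => ((inv x.2.1).2 : ℝ) + x.1) (𝓝 (t₀, p₀))
        (𝓝 (h + t₀)) :=
      ((continuous_subtype_val.tendsto h).comp
        ((continuous_snd.tendsto (s, h)).comp (hti.comp tv))).add tt
    have ts : Tendsto (fun x : ℝ × S.Fractured => (inv x.2.1).1) (𝓝 (t₀, p₀)) (𝓝 s) :=
      (continuous_fst.tendsto (s, h)).comp (hti.comp tv)
    have tl : Tendsto (fun x : ℝ × S.Fractured =>
        B.lift ((inv x.2.1).1, B.clamp h (((inv x.2.1).2 : ℝ) + x.1))) (𝓝 (t₀, p₀))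
        (𝓝 (B.lift (s, ⟨h + t₀, m0⟩))) := by
      have := (B.continuousAt_clamp h m0).tendsto.comp th
      rw [B.clamp_of_mem m0] at this
      exact (B.continuous_lift.tendsto _).comp (ts.prodMk_nhds this)
    rw [ContinuousAt, tendsto_subtype_rng]
    change Tendsto _ _ (𝓝 (φ t₀ p₀).1)
    rw [hφ t₀ p₀ ht₀ B s h m0 e]
    refine tl.congr' ?_
    have ht : ∀ᶠ x : ℝ × S.Fractured in 𝓝 (t₀, p₀), |x.1| < ε :=
      tt.eventually ((continuous_abs.tendsto t₀).eventually (gt_mem_nhds ht₀))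
    filter_upwards [tv.eventually hli, th.eventually (Ioo_mem_nhds m0.1 m0.2), ht] with x k1 k2 k3
    rw [B.clamp_of_mem k2]
    exact (hφ x.1 x.2 k3 B _ _ k2 k1).symm
  obtain ⟨ψ, hψ⟩ := exists_flow_of_local hε φ h0 hadd hc
  -- A box may be higher than `ε`; uniqueness of continuation covers the whole line.
  have hline : ∀ (p : S.Fractured) (B : S.ProdBox) (s : B.T) (h : Ioo B.patch.lo B.patch.hi) (t : ℝ)
      (ht : h + t ∈ Ioo B.patch.lo B.patch.hi), B.lift (s, h) = p.1 →
      (ψ t p).1 = B.lift (s, ⟨h + t, ht⟩) := by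
    intro p B s h t ht e
    have hK : B.lift (s, h) ∉ S.iota '' {x | x.1 ∈ S.critical} := e ▸ p.2
    let J : Set ℝ := {t | (h : ℝ) + t ∈ Ioo B.patch.lo B.patch.hi}
    have hJ : J.OrdConnected :=
      ⟨fun x hx y hy z hz => ⟨by linarith [hx.1, hz.1], by linarith [hy.2, hz.2]⟩⟩
    have : PreconnectedSpace J := Subtype.preconnectedSpace hJ.isPreconnected
    let f : J → S.Fractured := fun t => ⟨B.lift (s, ⟨h + t, t.2⟩), B.lift_mem_fractured h _ hK⟩
    let g : J → S.Fractured := fun t => ψ t p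
    have hf : Continuous f := by
      refine Continuous.subtype_mk (B.continuous_lift.comp ?_) _
      exact continuous_const.prodMk (Continuous.subtype_mk (by fun_prop) _)
    have hg : Continuous g := by fun_prop
    have h0J : (0 : ℝ) ∈ J := by
      change (h : ℝ) + 0 ∈ Ioo B.patch.lo B.patch.hi
      rw [add_zero]
      exact h.2
    have h00 : f ⟨0, h0J⟩ = g ⟨0, h0J⟩ := by
      apply Subtype.ext
      simp only [f, g, add_zero, ψ.map_zero_apply]
      exact e
    have key := eq_of_locally_eq hf hg (fun τ hτ => ?_) h00 ⟨t, ht⟩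
    · exact (congrArg Subtype.val key).symm
    · have h2 : ∀ᶠ τ' : J in 𝓝 τ, |(τ' : ℝ) - τ| < ε := by
        have : Continuous fun τ' : J => |(τ' : ℝ) - τ| := by fun_prop
        exact (this.tendsto τ).eventually (gt_mem_nhds (by simpa using hε))
      filter_upwards [h2] with τ' hτ'
      have e1 : (τ' : ℝ) = (τ' - τ) + τ := by ring
      have e2 : (h : ℝ) + τ + (τ' - τ) = h + τ' := by ring
      have m : (h : ℝ) + τ + (τ' - τ) ∈ Ioo B.patch.lo B.patch.hi := by rw [e2]; exact τ'.2
      apply Subtype.ext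
      change _ = (ψ τ' p).1
      rw [e1, ψ.map_add, hψ _ _ hτ', hφ _ _ hτ' B s ⟨h + τ, τ.2⟩ m (congrArg Subtype.val hτ)]
      simp only [f, e2]
  have hflow : ∀ t (p q : S.Divided), S.VerticalFlow t p q → ∀ p' : S.Fractured, p'.1 = p →
      (ψ t p').1 = q := by
    intro t p q h
    induction h with
    | of_local h =>
      intro p' hp'
      obtain ⟨B, s, y, y', e, h1, h2⟩ := h.exists_prodBox
      rw [hline p' B s y _ (by rw [← e]; exact y'.2) (h1.trans hp'.symm), ← h2]
      simp only [← e]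
    | comp _ _ ih1 ih2 =>
      intro p' hp'
      rw [ψ.map_add]
      exact ih2 _ (ih1 p' hp')
  have hsmall : ∀ t (p : S.Fractured), |t| < ε → S.VerticalFlow t p (ψ t p).1 := by
    intro t p ht
    obtain ⟨B, s, h, e, h1, h2⟩ := hmar p
    have m := hmem h1 h2 ht
    rw [hline p B s h t m e, ← e]
    have := B.localFlow s h ⟨h + t, m⟩
    simp only [add_sub_cancel_left] at this
    exact .of_local this
  have hmul : ∀ (n : ℕ) t (p : S.Fractured), |t| < ε →
      S.VerticalFlow ((n + 1) * t) p (ψ ((n + 1) * t) p).1 := by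
    intro n t p ht
    induction n with
    | zero => simpa using hsmall t p ht
    | succ n ih =>
      have e : ((n + 1 : ℕ) + 1 : ℝ) * t = t + (n + 1) * t := by push_cast; ring
      rw [e, ψ.map_add]
      exact .comp ih (hsmall t _ ht)
  refine ⟨ψ, fun t p q => ⟨?_, fun h => hflow t _ _ h p rfl⟩⟩
  rintro rfl
  obtain ⟨n, hn⟩ := exists_nat_gt (|t| / ε)
  have hn1 : (0 : ℝ) < n + 1 := by positivity
  have h1 : |t / (n + 1)| < ε := by
    rw [abs_div, abs_of_pos hn1, div_lt_iff₀ hn1]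
    rw [div_lt_iff₀ hε] at hn
    linarith
  have h2 : ((n : ℝ) + 1) * (t / (n + 1)) = t := by field_simp
  have := hmul n _ p h1
  rwa [h2] at this

end TranslationSurface

/-! ### Orbits, singularities and the absence of periodic orbits -/

namespace TranslationSurface

variable {X : Type u} [TopologicalSpace X] {S : TranslationSurface X}

/-- The flow `ψ` on the fractured surface is the vertical flow. -/
def IsVerticalFlow (ψ : Flow ℝ S.Fractured) : Prop :=
  ∀ (t : ℝ) (p : S.Fractured) (q : S.Divided), (ψ t p : S.Divided) = q ↔ S.VerticalFlow t p q

theorem isClosed_sing : IsClosed S.sing := isOpen_compl_iff.1 isOpen_compl_sing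

theorem NoSaddleConnections.not_falls (hS : S.NoSaddleConnections) {σ : ℝ} (hσ : σ = 1 ∨ σ = -1)
    {x : X} (h : S.FallsIntoSing σ x) (h' : S.FallsIntoSing (-σ) x) : False := by
  have := disjoint_left.1 hS
  rcases hσ with rfl | rfl
  · exact this h h'
  · rw [neg_neg] at h'
    exact this h' h

variable {ψ : Flow ℝ S.Fractured}

theorem flow_sub_add (a b : ℝ) (p : S.Fractured) : ψ (a - b) (ψ b p) = ψ a p := by
  rw [← ψ.map_add, sub_add_cancel]

theorem continuous_path [T2Space X] (ψ : Flow ℝ S.Fractured) (σ : ℝ) (p : S.Fractured) :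
    Continuous fun t => proj (ψ (σ * t) p).1 :=
  continuous_proj_fractured.comp (by fun_prop)

namespace IsVerticalFlow

variable (hψ : IsVerticalFlow ψ)
include hψ

theorem apply_lift (B : S.ProdBox) {s : B.T} {h : Ioo B.patch.lo B.patch.hi} {p : S.Fractured}
    (hp : B.lift (s, h) = p.1) (h' : Ioo B.patch.lo B.patch.hi) :
    (ψ (h' - h) p).1 = B.lift (s, h') := by
  rw [hψ, ← hp]
  exact .of_local (B.localFlow s h h')

theorem eventually_apply_lift (B : S.ProdBox) {s : B.T} {h : Ioo B.patch.lo B.patch.hi}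
    {p : S.Fractured} (hp : B.lift (s, h) = p.1) :
    ∀ᶠ δ in 𝓝 (0 : ℝ), ∃ m : (h : ℝ) + δ ∈ Ioo B.patch.lo B.patch.hi,
      (ψ δ p).1 = B.lift (s, ⟨h + δ, m⟩) := by
  have h1 : Tendsto (fun δ : ℝ => (h : ℝ) + δ) (𝓝 0) (𝓝 h) := by
    have : Continuous fun δ : ℝ => (h : ℝ) + δ := by fun_prop
    simpa using this.tendsto 0
  filter_upwards [h1.eventually (Ioo_mem_nhds h.2.1 h.2.2)] with δ m
  refine ⟨m, ?_⟩
  have := hψ.apply_lift B hp ⟨h + δ, m⟩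
  simpa using this

variable [T2Space X]

theorem lane_eq (t : ℝ) (p : S.Fractured) : lane (ψ t p).1 = lane p.1 := by
  have h : IsLocallyConstant fun t => lane (ψ t p).1 := by
    rw [IsLocallyConstant.iff_eventually_eq]
    intro t
    obtain ⟨B, ⟨s, h⟩, hB⟩ := exists_prodBox (ψ t p).1
    have h2 : Tendsto (fun r : ℝ => r - t) (𝓝 t) (𝓝 0) := by
      have : Continuous fun r : ℝ => r - t := by fun_prop
      simpa using this.tendsto t
    filter_upwards [h2.eventually (hψ.eventually_apply_lift B hB)] with r hr
    obtain ⟨m, hr⟩ := hr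
    rw [flow_sub_add] at hr
    rw [hr, ← hB, B.lane_lift, B.lane_lift]
  have := h.apply_eq_of_preconnectedSpace t 0
  simpa using this

/-- In local coordinates the flow moves points vertically. -/
theorem eventually_coord {p : S.Fractured} (hp : proj p.1 ∉ S.sing) {g : X → ℂ}
    (hg : S.IsLocalCoord g (proj p.1)) :
    ∀ᶠ δ in 𝓝 (0 : ℝ), g (proj (ψ δ p).1) = g (proj p.1) + δ * Complex.I := by
  obtain ⟨B, ⟨s, h⟩, hB⟩ := exists_prodBox p.1
  have hg' : S.IsLocalCoord B.patch.coord (proj p.1) := by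
    rw [← hB] at hp ⊢
    exact B.isLocalCoord hp
  have hc : Tendsto (fun δ => proj (ψ δ p).1) (𝓝 0) (𝓝 (proj p.1)) := by
    have : Continuous fun δ => proj (ψ δ p).1 := continuous_proj_fractured.comp (by fun_prop)
    simpa using this.tendsto 0
  filter_upwards [hψ.eventually_apply_lift B hB,
    hc.eventually (hg'.eventually_eq_add hg hp)] with δ h1 h2
  obtain ⟨m, h1⟩ := h1
  rw [sub_eq_iff_eq_add] at h2
  rw [h2, h1, ← hB, B.coord_lift, B.coord_lift]
  apply Complex.ext
  · simp [ProdBox.plane]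
  · simp [ProdBox.plane]
    ring

theorem eventually_coord_path (σ t : ℝ) {p : S.Fractured} (hp : proj (ψ (σ * t) p).1 ∉ S.sing)
    {g : X → ℂ} (hg : S.IsLocalCoord g (proj (ψ (σ * t) p).1)) :
    ∀ᶠ r in 𝓝 t, g (proj (ψ (σ * r) p).1) =
      g (proj (ψ (σ * t) p).1) + (r - t : ℝ) * (σ * Complex.I) := by
  have h2 : Tendsto (fun r : ℝ => σ * r - σ * t) (𝓝 t) (𝓝 0) := by
    have : Continuous fun r : ℝ => σ * r - σ * t := by fun_prop
    simpa using this.tendsto t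
  filter_upwards [h2.eventually (hψ.eventually_coord hp hg)] with r hr
  rw [flow_sub_add] at hr
  rw [hr]
  push_cast
  ring

theorem isStraight_path (σ : ℝ) {p : S.Fractured} {J : Set ℝ}
    (hJ : ∀ t ∈ J, proj (ψ (σ * t) p).1 ∉ S.sing) :
    S.IsStraight (σ * Complex.I) J (fun t => proj (ψ (σ * t) p).1) :=
  ⟨(continuous_path ψ σ p).continuousOn, hJ, fun t ht _ hc hx =>
    (hψ.eventually_coord_path σ t (hJ t ht) (isLocalCoord_chart hc hx)).filter_mono
      nhdsWithin_le_nhds⟩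

/-- Vertical paths in the surface are projections of flow lines. -/
theorem eqOn_path {σ : ℝ} {J : Set ℝ} (hJ : J.OrdConnected) {γ : ℝ → X}
    (hγ : S.IsStraight (σ * Complex.I) J γ) {t₀ : ℝ} (ht₀ : t₀ ∈ J) {p : S.Fractured}
    (hp : γ t₀ = proj (ψ (σ * t₀) p).1) : EqOn γ (fun t => proj (ψ (σ * t) p).1) J := by
  refine eqOn_of_locally_eq hJ hγ.continuousOn (continuous_path ψ σ p).continuousOn
    (fun t ht hE => ?_) ht₀ hp
  have hs := hγ.notMem t ht
  have hs' := hs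
  rw [hE] at hs'
  obtain ⟨c, hc, hxc⟩ := S.atlas_cover _ hs
  have hg := isLocalCoord_chart hc hxc
  have hg' : S.IsLocalCoord c (proj (ψ (σ * t) p).1) := by
    rw [← hE]
    exact hg
  have hU := c.open_source.mem_nhds hxc
  filter_upwards [hγ.coord ht hg,
    (hψ.eventually_coord_path σ t hs' hg').filter_mono nhdsWithin_le_nhds,
    (hγ.continuousOn t ht).eventually hU,
    (((continuous_path ψ σ p).tendsto t).eventually (hE ▸ hU)).filter_mono nhdsWithin_le_nhds]
    with r h1 h2 h3 h4
  refine c.injOn h3 h4 ?_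
  rw [h1, h2, hE]

/-- The fall ends at the first hitting time, which exists because `S.sing` is closed; before it the
path is straight. -/
theorem fallsIntoSing_of_mem_sing {σ T : ℝ} (hT : 0 ≤ T) {p : S.Fractured}
    (hp : proj p.1 ∉ S.sing) (h : proj (ψ (σ * T) p).1 ∈ S.sing) :
    S.FallsIntoSing σ (proj p.1) := by
  have hcl : IsCompact (Icc 0 T ∩ {t | proj (ψ (σ * t) p).1 ∈ S.sing}) :=
    isCompact_Icc.inter_right (isClosed_sing.preimage (continuous_path ψ σ p))
  obtain ⟨T', ⟨hT', hT's⟩, hmin⟩ := hcl.exists_isLeast ⟨T, ⟨hT, le_rfl⟩, h⟩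
  have hpos : 0 < T' := by
    refine lt_of_le_of_ne hT'.1 fun h0 => hp ?_
    rw [← h0] at hT's
    simpa using hT's
  rw [fallsIntoSing_iff]
  refine ⟨T', hpos, fun t => proj (ψ (σ * t) p).1, by simp, hT's,
    (continuous_path ψ σ p).continuousOn, hψ.isStraight_path σ fun t ht hs => ?_⟩
  exact absurd (hmin ⟨⟨ht.1, ht.2.le.trans hT'.2⟩, hs⟩) (not_le.2 ht.2)

/-- The fall is a projected flow line up to its end point, by uniqueness and continuity. Orbits over
critical leaves thus pass through lane points over singularities. -/
theorem exists_mem_sing_of_falls {σ : ℝ} {p : S.Fractured} (h : S.FallsIntoSing σ (proj p.1)) :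
    ∃ T, proj (ψ (σ * T) p).1 ∈ S.sing := by
  obtain ⟨T, hT, γ, h0, h1, h2, h3⟩ := fallsIntoSing_iff.1 h
  have h4 := hψ.eqOn_path ordConnected_Ico h3 (t₀ := 0) ⟨le_rfl, hT⟩ (p := p) (by simp [h0])
  have h5 := h4.of_subset_closure h2 (continuous_path ψ σ p).continuousOn Ico_subset_Icc_self
    (closure_Ico hT.ne).ge
  refine ⟨T, ?_⟩
  have := h5 (x := T) ⟨hT.le, le_rfl⟩
  simp only at this
  rwa [← this]

theorem eventually_notMem_sing {p : S.Fractured} (hp : proj p.1 ∈ S.sing) :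
    ∀ᶠ δ in 𝓝 (0 : ℝ), δ ≠ 0 → proj (ψ δ p).1 ∉ S.sing := by
  obtain ⟨B, ⟨s, h⟩, hB⟩ := exists_prodBox p.1
  obtain ⟨b, m, hbm⟩ := exists_singLane hp
  have z1 := (B.sing_line b m _ (hB.trans hbm)).1
  filter_upwards [hψ.eventually_apply_lift B hB] with δ hδ h0 hs
  obtain ⟨m, hδ⟩ := hδ
  rw [hδ] at hs
  obtain ⟨b', m', hbm'⟩ := exists_singLane hs
  have z2 := (B.sing_line b' m' _ hbm').1
  simp only at z1 z2
  exact h0 (by linarith)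

/-- Without saddle connections, an orbit passes at most one singularity. -/
theorem notMem_sing_of_mem_sing (hS : S.NoSaddleConnections) {p : S.Fractured}
    (hp : proj p.1 ∈ S.sing) {t : ℝ} (ht : t ≠ 0) : proj (ψ t p).1 ∉ S.sing := by
  intro hs
  obtain ⟨σ, hσ, T, hT, rfl⟩ : ∃ σ : ℝ, (σ = 1 ∨ σ = -1) ∧ ∃ T > 0, t = σ * T := by
    rcases lt_or_gt_of_ne ht with h | h
    · exact ⟨-1, Or.inr rfl, -t, by linarith, by ring⟩
    · exact ⟨1, Or.inl rfl, t, h, by ring⟩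
  have hσ0 : σ ≠ 0 := by rcases hσ with rfl | rfl <;> norm_num
  have h2 : Tendsto (fun r : ℝ => σ * r) (𝓝[>] 0) (𝓝 0) := by
    have : Continuous fun r : ℝ => σ * r := by fun_prop
    simpa using (this.tendsto 0).mono_left nhdsWithin_le_nhds
  obtain ⟨δ, h3, h4, h5⟩ := ((h2.eventually (hψ.eventually_notMem_sing hp)).and
    (Ioo_mem_nhdsGT hT)).exists
  have h6 := h3 (mul_ne_zero hσ0 h4.ne')
  -- A point shortly after the first singularity falls into the second one ahead and into the first
  -- one behind.
  refine hS.not_falls hσ (x := proj (ψ (σ * δ) p).1) ?_ ?_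
  · refine hψ.fallsIntoSing_of_mem_sing (T := T - δ) (by linarith) h6 ?_
    rw [← ψ.map_add]
    convert hs using 5
    ring
  · refine hψ.fallsIntoSing_of_mem_sing (T := δ) h4.le h6 ?_
    rw [← ψ.map_add]
    simpa using hp

/-- The orbit would be singular at both times `t` and `t + T`. -/
theorem periodic_notMem_sing (hS : S.NoSaddleConnections) {p : S.Fractured} {T : ℝ} (hT : T ≠ 0)
    (hp : ψ T p = p) (t : ℝ) : proj (ψ t p).1 ∉ S.sing := by
  intro hs
  refine hψ.notMem_sing_of_mem_sing hS hs hT ?_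
  rw [← ψ.map_add, add_comm, ψ.map_add, hp]
  exact hs

theorem periodic_notMem_critical (hS : S.NoSaddleConnections) {p : S.Fractured} {T : ℝ}
    (hT : T ≠ 0) (hp : ψ T p = p) : proj p.1 ∉ S.critical := by
  rintro (h | h)
  · obtain ⟨t, ht⟩ := hψ.exists_mem_sing_of_falls h
    exact hψ.periodic_notMem_sing hS hT hp _ ht
  · obtain ⟨t, ht⟩ := hψ.exists_mem_sing_of_falls h
    exact hψ.periodic_notMem_sing hS hT hp _ ht

/-- The flow moves the points near a periodic point by local translations, hence they are periodic
as well. -/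
theorem eventually_periodic (hS : S.NoSaddleConnections) {p : S.Fractured} {T : ℝ} (hT : T ≠ 0)
    (hp : ψ T p = p) : ∀ᶠ q in 𝓝 p, ψ T q = q := by
  have hns := hψ.periodic_notMem_sing hS hT hp
  have hp0 : proj p.1 ∉ S.sing := by simpa using hns 0
  obtain ⟨c, hc, hxc⟩ := S.atlas_cover _ hp0
  have hg0 := isLocalCoord_chart hc hxc
  have tend : ∀ t, Tendsto (fun q => proj (ψ t q).1) (𝓝 p) (𝓝 (proj (ψ t p).1)) := fun t =>
    (continuous_proj_fractured.comp (by fun_prop : Continuous fun q => ψ t q)).tendsto p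
  -- `D g t`: the displacement of neighbours from the orbit of `p`, read in `g` at time `t`, is the
  -- initial one. Its validity is locally constant in `t`, since a box moves the orbit and its
  -- neighbours by the same vertical vector.
  let D : (X → ℂ) → ℝ → Prop := fun g t => ∀ᶠ q in 𝓝 p,
    g (proj (ψ t q).1) - g (proj (ψ t p).1) = c (proj q.1) - c (proj p.1)
  have hD : ∀ g g' t, S.IsLocalCoord g (proj (ψ t p).1) → S.IsLocalCoord g' (proj (ψ t p).1) →
      D g t → D g' t := by
    intro g g' t h h' hd
    filter_upwards [hd, (tend t).eventually (h.eventually_eq_add h' (hns t))] with q h1 h2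
    rw [h2, h1]
  let A : ℝ → Prop := fun t => ∃ g, S.IsLocalCoord g (proj (ψ t p).1) ∧ D g t
  have hA : IsLocallyConstant A := by
    rw [IsLocallyConstant.iff_eventually_eq]
    intro t
    obtain ⟨B, ⟨s, h⟩, hB⟩ := exists_prodBox (ψ t p).1
    have hloc : ∀ h' : Ioo B.patch.lo B.patch.hi, proj (B.lift (s, h')) ∉ S.sing →
        S.IsLocalCoord B.patch.coord (proj (B.lift (s, h'))) := fun h' => B.isLocalCoord
    have hg : S.IsLocalCoord B.patch.coord (proj (ψ t p).1) := by
      rw [← hB]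
      exact hloc h (by rw [hB]; exact hns t)
    have h2 : Tendsto (fun r : ℝ => r - t) (𝓝 t) (𝓝 0) := by
      have : Continuous fun r : ℝ => r - t := by fun_prop
      simpa using this.tendsto t
    filter_upwards [h2.eventually (hψ.eventually_apply_lift B hB)] with r hr
    obtain ⟨m, hr⟩ := hr
    rw [flow_sub_add] at hr
    have hg' : S.IsLocalCoord B.patch.coord (proj (ψ r p).1) := by
      rw [hr]
      exact hloc _ (by rw [← hr]; exact hns r)
    have key : ∀ᶠ q in 𝓝 p, B.patch.coord (proj (ψ r q).1) - B.patch.coord (proj (ψ r p).1) =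
        B.patch.coord (proj (ψ t q).1) - B.patch.coord (proj (ψ t p).1) := by
      have hq : Tendsto (fun q => (ψ t q).1) (𝓝 p) (map B.lift (𝓝 (s, h))) := by
        rw [B.map_nhds, hB]
        exact (continuous_subtype_val.comp (by fun_prop : Continuous fun q => ψ t q)).tendsto p
      have hm : ∀ᶠ y : B.T × Ioo B.patch.lo B.patch.hi in 𝓝 (s, h),
          (y.2 : ℝ) + (r - t) ∈ Ioo B.patch.lo B.patch.hi := by
        have : Continuous fun y : B.T × Ioo B.patch.lo B.patch.hi => (y.2 : ℝ) + (r - t) := by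
          fun_prop
        exact (this.tendsto (s, h)).eventually (Ioo_mem_nhds m.1 m.2)
      have hm' : ∀ᶠ q in map B.lift (𝓝 (s, h)), ∃ y : B.T × Ioo B.patch.lo B.patch.hi,
          B.lift y = q ∧ (y.2 : ℝ) + (r - t) ∈ Ioo B.patch.lo B.patch.hi := by
        rw [eventually_map]
        exact hm.mono fun y hy => ⟨y, rfl, hy⟩
      filter_upwards [hq.eventually hm'] with q hq
      obtain ⟨⟨s', h'⟩, e, m'⟩ := hq
      have h3 := hψ.apply_lift B e ⟨h' + (r - t), m'⟩
      simp only [add_sub_cancel_left] at h3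
      rw [flow_sub_add] at h3
      rw [h3, hr, ← hB, ← e, B.coord_lift, B.coord_lift, B.coord_lift, B.coord_lift]
      apply Complex.ext <;> simp [ProdBox.plane]
    apply propext
    constructor
    · rintro ⟨g, hgl, hd⟩
      refine ⟨_, hg, ?_⟩
      filter_upwards [key, hD g _ r hgl hg' hd] with q h1 h2
      rw [← h1, h2]
    · rintro ⟨g, hgl, hd⟩
      refine ⟨_, hg', ?_⟩
      filter_upwards [key, hD g _ t hgl hg hd] with q h1 h2
      rw [h1, h2]
  have hAT : A T := by
    have h0 : A 0 := ⟨c, by simpa using hg0, Eventually.of_forall fun q => by simp⟩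
    have := hA.apply_eq_of_preconnectedSpace T 0
    rw [this]
    exact h0
  obtain ⟨g, hgl, hd⟩ := hAT
  have hd' := hD g c T hgl (by rw [hp]; exact hg0) hd
  have t1 := tend T
  have t0 := tend 0
  simp only [ψ.map_zero_apply] at t0
  rw [hp] at t1
  have hU := c.open_source.mem_nhds hxc
  filter_upwards [hd', t1.eventually hU, t0.eventually hU, t0.eventually (isOpen_compl_sing.mem_nhds hp0)]
    with q h1 h2 h3 h4
  rw [hp] at h1
  have h5 := c.injOn h2 h3 (sub_left_injective h1)
  apply Subtype.ext
  exact (Divided.ext_point h5.symm (hψ.lane_eq T q).symm h4).symm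

/-- Without saddle connections there are no periodic orbits. -/
theorem not_periodic [CompactSpace X] [ConnectedSpace X] (hS : S.NoSaddleConnections)
    (hsing : S.sing.Nonempty) (p : S.Fractured) {T : ℝ} (hT : T ≠ 0) : ψ T p ≠ p := by
  intro hp
  have : T2Space S.Fractured := t2Space_fractured
  have : CompactSpace S.Fractured := compactSpace_fractured
  -- The projection of the points of period `T` turns out to be clopen, so it would contain the
  -- singularities.
  let P : Set S.Fractured := {q | ψ T q = q}
  have hPc : IsClosed P := isClosed_eq (by fun_prop) continuous_id
  let N : Set X := (fun q : S.Fractured => proj q.1) '' P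
  have hNc : IsClosed N := (hPc.isCompact.image continuous_proj_fractured).isClosed
  have hNo : IsOpen N := by
    rw [isOpen_iff_mem_nhds]
    rintro _ ⟨q, hq, rfl⟩
    have h1 : P ∈ 𝓝 q := hψ.eventually_periodic hS hT hq
    have hs : proj q.1 ∉ S.sing := by simpa using hψ.periodic_notMem_sing hS hT hq 0
    -- Periodic points have no side condition, so a neighbourhood in the fractured surface is a full
    -- preimage from `X`.
    have hl : lane q.1 = 0 := by
      by_contra h
      exact hψ.periodic_notMem_critical hS hT hq ((q.lane_ne_zero_iff hs).1 h)
    obtain ⟨c, hc, hxc⟩ := S.atlas_cover _ hs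
    have h2 : nhdsFilter q.1 = comap proj (𝓝 (proj q.1)) := by
      rw [nhdsFilter_eq hs (isLocalCoord_chart hc hxc), hl]
      refine inf_eq_left.2 ?_
      rw [le_principal_iff]
      exact univ_mem' fun _ => Or.inl rfl
    rw [nhds_fractured, h2, comap_comap] at h1
    obtain ⟨V, hV, hVP⟩ := h1
    refine mem_of_superset hV fun y hy => ?_
    obtain ⟨r, rfl⟩ := exists_fractured (S := S) y
    exact ⟨r, hVP hy, rfl⟩
  obtain ⟨b, hb⟩ := hsing
  have hN : N = univ := IsClopen.eq_univ ⟨hNc, hNo⟩ ⟨_, p, hp, rfl⟩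
  obtain ⟨q, hq, hqb⟩ : b ∈ N := hN ▸ mem_univ b
  refine hψ.periodic_notMem_sing hS hT hq 0 ?_
  simp only at hqb
  simpa [hqb] using hb

end IsVerticalFlow

end TranslationSurface

/-! ### Horizontal gaps and charts adapted to them -/

namespace TranslationSurface

variable {X : Type u} [TopologicalSpace X] {S : TranslationSurface X}

/-- Singularities on the segment of the patch need not be excluded in advance: where the two paths
agree, `η` is nonsingular. -/
theorem IsStraight.eqOn_horizontal [T2Space X] {τ s h : ℝ} {J : Set ℝ} {η : ℝ → X}
    (hη : S.IsStraight τ J η) (hJ : J.OrdConnected) (P : S.Patch) (hh : h ∈ Ioo P.lo P.hi)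
    (hdom : ∀ u ∈ J, s + τ * u ∈ P.J) {u₀ : ℝ} (hu₀ : u₀ ∈ J)
    (h0 : η u₀ = P.sec ⟨s + τ * u₀, h⟩) : EqOn η (fun u => P.sec ⟨s + τ * u, h⟩) J := by
  have hpt : ∀ u : ℝ, (⟨s + τ * u, h⟩ : ℂ) = ⟨s, h⟩ + u * τ := fun u => by
    apply Complex.ext
    · simp [mul_comm]
    · simp
  have hcont : ContinuousOn (fun u : ℝ => P.sec ⟨s + τ * u, h⟩) J := by
    refine P.continuousOn.comp (f := fun u : ℝ => (⟨s + τ * u, h⟩ : ℂ)) ?_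
      fun u hu => ⟨hdom u hu, hh⟩
    simp only [hpt]
    fun_prop
  refine eqOn_of_locally_eq hJ hη.continuousOn hcont (fun u hu hE => ?_) hu₀ h0
  have hs := hη.notMem u hu
  have hg : S.IsLocalCoord P.coord (η u) := by
    rw [hE] at hs ⊢
    exact P.isLocalCoord _ ⟨hdom u hu, hh⟩ hs
  obtain ⟨U, hU, hinj⟩ := hg.eventually_injective hs
  filter_upwards [hη.coord hu hg, (hη.continuousOn u hu).eventually hU,
    (hcont u hu).eventually (hE ▸ hU), self_mem_nhdsWithin] with r h1 h2 h3 h4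
  refine hinj h2 h3 ?_
  rw [h1, hE, P.coord_sec _ ⟨hdom u hu, hh⟩, P.coord_sec _ ⟨hdom r h4, hh⟩, hpt, hpt]
  push_cast
  ring

/-- From `x` there starts a horizontal path of length `c` with velocity `τ` which avoids `N` after
its start. -/
def HasGap (S : TranslationSurface X) (N : Set X) (τ c : ℝ) (x : X) : Prop :=
  ∃ η : ℝ → X, η 0 = x ∧ S.IsStraight τ (Ico 0 c) η ∧ ∀ u ∈ Ioo 0 c, η u ∉ N

theorem HasGap.mono {N : Set X} {τ c c' : ℝ} {x : X} (h : HasGap S N τ c x) (hc : c' ≤ c) :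
    HasGap S N τ c' x := by
  obtain ⟨η, h0, h1, h2⟩ := h
  exact ⟨η, h0, h1.mono (Ico_subset_Ico_right hc), fun u hu => h2 u ⟨hu.1, hu.2.trans_le hc⟩⟩

theorem hasGap_iff [T2Space X] (P : S.Patch) {N : Set X} {τ c s h : ℝ} (hc : 0 < c)
    (hh : h ∈ Ioo P.lo P.hi) (hdom : ∀ u ∈ Ico 0 c, s + τ * u ∈ P.J)
    (hns : ∀ u ∈ Ico 0 c, P.sec ⟨s + τ * u, h⟩ ∉ S.sing) :
    HasGap S N τ c (P.sec ⟨s, h⟩) ↔ ∀ u ∈ Ioo 0 c, P.sec ⟨s + τ * u, h⟩ ∉ N := by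
  constructor
  · rintro ⟨η, h0, h1, h2⟩ u hu
    have := h1.eqOn_horizontal ordConnected_Ico P hh hdom (u₀ := 0) ⟨le_rfl, hc⟩ (by simpa using h0)
    have h3 := this (x := u) ⟨hu.1.le, hu.2⟩
    simp only at h3
    rw [← h3]
    exact h2 u hu
  · intro H
    refine ⟨fun u => P.sec ⟨s + τ * u, h⟩, by simp, ?_, H⟩
    have hpt : ∀ u : ℝ, (⟨s + τ * u, h⟩ : ℂ) = ⟨s, h⟩ + u * τ := fun u => by
      apply Complex.ext
      · simp [mul_comm]
      · simp
    simp only [hpt] at hns ⊢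
    exact P.isStraight (fun u hu => by rw [← hpt]; exact ⟨hdom u hu, hh⟩) hns

variable {ψ : Flow ℝ S.Fractured}

namespace IsVerticalFlow

variable (hψ : IsVerticalFlow ψ) {M : Set S.Fractured} (hM : IsInvariant ψ M)
include hψ hM

theorem image_along [T2Space X] {J : Set ℝ} (hJ : J.OrdConnected) {γ : ℝ → X}
    (hγ : S.IsStraight Complex.I J γ) {t t' : ℝ} (ht : t ∈ J) (ht' : t' ∈ J) :
    γ t ∈ (fun p : S.Fractured => proj p.1) '' M ↔
      γ t' ∈ (fun p : S.Fractured => proj p.1) '' M := by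
  have key : ∀ {t t'}, t ∈ J → t' ∈ J → γ t ∈ (fun p : S.Fractured => proj p.1) '' M →
      γ t' ∈ (fun p : S.Fractured => proj p.1) '' M := by
    rintro t t' ht ht' ⟨p, hp, hpt⟩
    have h1 := hψ.eqOn_path (σ := 1) hJ (by simpa using hγ) ht (p := ψ (-t) p) (by
      rw [← ψ.map_add]
      simpa using hpt.symm)
    exact ⟨_, hM _ (hM _ hp), (h1 ht').symm⟩
  exact ⟨key ht ht', key ht' ht⟩

theorem image_patch [T2Space X] (P : S.Patch) {s h h' : ℝ} (hs : s ∈ P.J)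
    (hn : ∀ h ∈ Ioo P.lo P.hi, P.sec ⟨s, h⟩ ∉ S.sing) (hh : h ∈ Ioo P.lo P.hi)
    (hh' : h' ∈ Ioo P.lo P.hi) : P.sec ⟨s, h⟩ ∈ (fun p : S.Fractured => proj p.1) '' M ↔
      P.sec ⟨s, h'⟩ ∈ (fun p : S.Fractured => proj p.1) '' M :=
  hψ.image_along hM ordConnected_Ioo (P.isStraight_vertical hs hn) hh hh'

theorem hasGap_line_iff [T2Space X] (P : S.Patch) {τ c s h h' : ℝ} (hc : 0 < c)
    (hh : h ∈ Ioo P.lo P.hi) (hh' : h' ∈ Ioo P.lo P.hi) (hdom : ∀ u ∈ Ico 0 c, s + τ * u ∈ P.J)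
    (hns : ∀ u ∈ Ioo 0 c, ∀ h ∈ Ioo P.lo P.hi, P.sec ⟨s + τ * u, h⟩ ∉ S.sing)
    (h0 : P.sec ⟨s, h⟩ ∉ S.sing) (h0' : P.sec ⟨s, h'⟩ ∉ S.sing) :
    HasGap S ((fun p : S.Fractured => proj p.1) '' M) τ c (P.sec ⟨s, h⟩) ↔
      HasGap S ((fun p : S.Fractured => proj p.1) '' M) τ c (P.sec ⟨s, h'⟩) := by
  have hns' : ∀ h ∈ Ioo P.lo P.hi, P.sec ⟨s, h⟩ ∉ S.sing →
      ∀ u ∈ Ico 0 c, P.sec ⟨s + τ * u, h⟩ ∉ S.sing := by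
    intro h hh h0 u hu
    rcases hu.1.eq_or_lt with hu0 | hu0
    · rw [← hu0]
      simpa using h0
    · exact hns u ⟨hu0, hu.2⟩ h hh
  rw [hasGap_iff P hc hh hdom (hns' h hh h0), hasGap_iff P hc hh' hdom (hns' h' hh' h0')]
  refine forall₂_congr fun u hu => not_congr ?_
  exact hψ.image_patch hM P (hdom u ⟨hu.1.le, hu.2⟩) (hns u hu) hh hh'

/-- On the left of the center leaf, say, a gap towards the right cannot reach beyond the center
leaf if the half-disc meets `M`. -/
theorem not_hasGap_halfBox [T2Space X] (H : S.HalfBox) {τ c s h : ℝ}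
    (hτ : (-1) ^ (H.m : ℕ) = -τ) (hs : s ∈ H.patch.J) (hh : h ∈ Ioo (-H.r) H.r)
    (hs0 : 0 < (-1) ^ (H.m : ℕ) * s) (hsc : (-1) ^ (H.m : ℕ) * s < c)
    (hHM : (∃ p ∈ M, p.1 = .singLane H.b H.m) ∨ ∀ p ∈ M, p.1 ∉ range H.lift)
    {q : S.Fractured} (hq : q ∈ M) (hqx : proj q.1 = H.map ⟨s, h⟩) :
    ¬ HasGap S ((fun p : S.Fractured => proj p.1) '' M) τ c (H.map ⟨s, h⟩) := by
  rintro ⟨η, h0, h1, h2⟩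
  have hτ2 : τ * τ = 1 := by
    have h3 : ((-1 : ℝ) ^ (H.m : ℕ)) * (-1) ^ (H.m : ℕ) = 1 := by rw [← mul_pow]; simp
    rw [hτ] at h3
    linarith
  have hs1 : s ≠ 0 := fun h => by rw [h, mul_zero] at hs0; exact lt_irrefl _ hs0
  have hz0 : (⟨s, h⟩ : ℂ) ≠ 0 := fun h' => hs1 (congrArg Complex.re h')
  have hns : H.map ⟨s, h⟩ ∉ S.sing := H.map_notMem_sing hs.1 hh hs.2 hz0
  have hr : (0 : ℝ) ∈ Ioo (-H.r) H.r := ⟨by linarith [hh.1, hh.2], by linarith [hh.1, hh.2]⟩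
  have hcone : S.cone H.b (H.map ⟨s, h⟩) = sectorRoot (S.order H.b) H.m ⟨s, h⟩ := by
    rw [HalfBox.map, (S.cone H.b).right_inv]
    exact H.fits ⟨s, h⟩ hs.1 hh hs.2
  have hpow := H.cone_map_pow (z := ⟨s, h⟩) hs.1 hh hs.2
  have hqr : q.1 ∈ range H.lift := by
    refine H.mem_range_lift ⟨?_, ?_, ?_, ?_, ?_⟩ ?_ ?_ <;> rw [hqx]
    · exact H.map_mem_source (z := ⟨s, h⟩) hs.1 hh hs.2
    · rw [hpow]; exact hs.2
    · rw [hpow, hcone]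
    · rw [hpow]; exact fun h => absurd h hs1
    · exact fun h => absurd (h ▸ H.b.2) hns
    · rw [hpow]; exact hs.1
    · rw [hpow]; exact hh
  -- The half-disc meets `M` in `q`, so `M` contains its lane point over the singularity, hence the
  -- orbit along the edge.
  obtain ⟨p₀, hp₀, hp₀'⟩ := hHM.resolve_right fun h => h q hq hqr
  have hc0 : S.cone H.b (proj p₀.1) ^ S.order H.b = 0 := by
    rw [hp₀']
    simp only [proj, S.cone_self, zero_pow (S.order_pos _).ne']
  obtain ⟨⟨σ₀, y₀⟩, hσ⟩ := H.mem_range_lift (q := p₀.1) (by rw [hp₀']; exact singLane_mem_sector _ _)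
    (by rw [hc0]; exact hr) (by rw [hc0]; exact hr)
  have hz := H.cone_proj_lift_pow (σ₀, y₀)
  rw [hσ, hc0] at hz
  have hpos : σ₀.1.pos = 0 := (congrArg Complex.re hz).symm
  have h3 := hψ.apply_lift H.prodBox hσ ⟨h, hh⟩
  have h4 : H.map ⟨0, h⟩ ∈ (fun p : S.Fractured => proj p.1) '' M := by
    refine ⟨_, hM (h - y₀) hp₀, ?_⟩
    simp only
    rw [h3]
    change proj (H.lift (σ₀, ⟨h, hh⟩)) = _
    rw [H.proj_lift]
    change H.map ⟨σ₀.1.pos, h⟩ = _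
    rw [hpos]
  -- The distance to the center leaf: `η` meets the edge, and thus the image of `M`, at time `d <
  -- c`.
  set d := (-1) ^ (H.m : ℕ) * s with hd
  have hsd : s + τ * d = 0 := by
    rw [hd, hτ]
    linear_combination s * (-hτ2)
  have hdom : ∀ u ∈ Icc 0 d, s + τ * u ∈ H.patch.J := by
    intro u hu
    refine H.patch.ordConnected.uIcc_subset hs (y := 0) ⟨hr, by simp⟩ ?_
    have e1 : s + τ * u = s - s * (u / d) := by
      have : τ = - (s / d) := by
        rw [eq_neg_iff_add_eq_zero, add_comm, ← mul_eq_zero_iff_right hs0.ne', add_mul,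
          div_mul_cancel₀ _ hs0.ne']
        exact hsd
      rw [this]
      ring
    have h5 : 0 ≤ u / d := div_nonneg hu.1 hs0.le
    have h6 : u / d ≤ 1 := (div_le_one hs0).2 hu.2
    rw [e1, mem_uIcc]
    rcases le_total 0 s with h | h
    · right; constructor <;> nlinarith
    · left; constructor <;> nlinarith
  have h5 := (h1.mono (J' := Icc 0 d) fun u hu => ⟨hu.1, hu.2.trans_lt hsc⟩).eqOn_horizontal
    ordConnected_Icc H.patch hh hdom (u₀ := 0) ⟨le_rfl, hs0.le⟩ (by
      simp only [mul_zero, add_zero]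
      exact h0)
  have h6 := h5 (x := d) ⟨hs0.le, le_rfl⟩
  simp only [hsd] at h6
  exact h2 d ⟨hs0, hsc⟩ (h6 ▸ h4)

omit hM in
theorem eventually_sec [T2Space X] (P : S.Patch) {s h : ℝ} (hs : s ∈ P.J) (hh : h ∈ Ioo P.lo P.hi)
    {q : S.Fractured} (hq : proj q.1 = P.sec ⟨s, h⟩) (hns : proj q.1 ∉ S.sing) :
    ∀ᶠ δ in 𝓝 (0 : ℝ), h + δ ∈ Ioo P.lo P.hi ∧ proj (ψ δ q).1 = P.sec ⟨s, h + δ⟩ := by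
  have hg : S.IsLocalCoord P.coord (proj q.1) := by
    rw [hq] at hns ⊢
    exact P.isLocalCoord _ ⟨hs, hh⟩ hns
  obtain ⟨U, hU, hinj⟩ := hg.eventually_injective hns
  have h1 : Tendsto (fun δ : ℝ => h + δ) (𝓝 0) (𝓝 h) := by
    have : Continuous fun δ : ℝ => h + δ := by fun_prop
    simpa using this.tendsto 0
  have h2 : ∀ᶠ δ : ℝ in 𝓝 0, h + δ ∈ Ioo P.lo P.hi := h1.eventually (Ioo_mem_nhds hh.1 hh.2)
  have hpt : ∀ δ : ℝ, (⟨s, h + δ⟩ : ℂ) = ⟨s, h⟩ + δ * Complex.I := fun δ => by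
    apply Complex.ext <;> simp
  have h3 : Tendsto (fun δ : ℝ => P.sec ⟨s, h + δ⟩) (𝓝 0) (𝓝 (proj q.1)) := by
    rw [hq]
    refine (P.continuousOn ⟨s, h⟩ ⟨hs, hh⟩).tendsto.comp (tendsto_nhdsWithin_iff.2 ⟨?_, ?_⟩)
    · simp only [hpt]
      have : Continuous fun δ : ℝ => (⟨s, h⟩ : ℂ) + δ * Complex.I := by fun_prop
      simpa using this.tendsto 0
    · exact h2.mono fun δ hδ => ⟨hs, hδ⟩
  have h4 : Tendsto (fun δ => proj (ψ δ q).1) (𝓝 0) (𝓝 (proj q.1)) := by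
    have := (continuous_path ψ 1 q).tendsto 0
    simpa using this
  filter_upwards [h2, hψ.eventually_coord hns hg, h3.eventually hU, h4.eventually hU]
    with δ k1 k2 k3 k4
  refine ⟨k1, hinj k4 k3 ?_⟩
  rw [k2, P.coord_sec _ ⟨hs, k1⟩, hq, P.coord_sec _ ⟨hs, hh⟩, hpt]

end IsVerticalFlow

/-- Around `x` there is a rectangle or half-open box, which shows that gaps of length `c` at `x`
persist under the vertical flow. -/
def GapChart (S : TranslationSurface X) (M : Set S.Fractured) (τ c : ℝ) (x : X) : Prop :=
  (∃ (P : S.Patch) (s h : ℝ), x = P.sec ⟨s, h⟩ ∧ h ∈ Ioo P.lo P.hi ∧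
    (∀ u ∈ Ico 0 c, s + τ * u ∈ P.J) ∧
    ∀ u ∈ Ioo 0 c, ∀ h ∈ Ioo P.lo P.hi, P.sec ⟨s + τ * u, h⟩ ∉ S.sing) ∨
  ∃ (H : S.HalfBox) (s h : ℝ), x = H.map ⟨s, h⟩ ∧ s ∈ H.patch.J ∧ h ∈ Ioo (-H.r) H.r ∧
    (-1) ^ (H.m : ℕ) = -τ ∧ 0 < (-1) ^ (H.m : ℕ) * s ∧ (-1) ^ (H.m : ℕ) * s < c ∧
    ((∃ p ∈ M, p.1 = .singLane H.b H.m) ∨ ∀ p ∈ M, p.1 ∉ range H.lift)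

/-- In a rectangle the image of `M` consists of full vertical lines off the singularities, so the
gap is the same at all heights. In the half-open box there is no gap at any height. -/
theorem IsVerticalFlow.eventually_hasGap_iff [T2Space X] (hψ : IsVerticalFlow ψ)
    {M : Set S.Fractured} (hM : IsInvariant ψ M) {τ c : ℝ} (hc : 0 < c) {q : S.Fractured}
    (hq : q ∈ M) (hns : proj q.1 ∉ S.sing) (hG : GapChart S M τ c (proj q.1)) :
    ∀ᶠ δ in 𝓝 (0 : ℝ), (HasGap S ((fun p : S.Fractured => proj p.1) '' M) τ c (proj (ψ δ q).1) ↔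
      HasGap S ((fun p : S.Fractured => proj p.1) '' M) τ c (proj q.1)) := by
  have h4 : Tendsto (fun δ => proj (ψ δ q).1) (𝓝 0) (𝓝 (proj q.1)) := by
    have := (continuous_path ψ 1 q).tendsto 0
    simpa using this
  rcases hG with ⟨P, s, h, hx, hh, hdom, hn⟩ | ⟨H, s, h, hx, hs, hh, hτ, h1, h2, h3⟩
  · have hs : s ∈ P.J := by simpa using hdom 0 ⟨le_rfl, hc⟩
    filter_upwards [hψ.eventually_sec P hs hh hx hns,
      h4.eventually (isOpen_compl_sing.mem_nhds hns)] with δ k1 k2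
    rw [hx] at hns ⊢
    rw [k1.2] at k2 ⊢
    exact hψ.hasGap_line_iff hM P hc k1.1 hh hdom hn k2 hns
  · filter_upwards [hψ.eventually_sec H.patch hs hh hx hns] with δ k1
    refine iff_of_false ?_ ?_
    · rw [k1.2]
      exact hψ.not_hasGap_halfBox hM H hτ hs k1.1 h1 h2 h3 (hM δ hq) k1.2
    · rw [hx]
      exact hψ.not_hasGap_halfBox hM H hτ hs hh h1 h2 h3 hq hx

end TranslationSurface

namespace TranslationSurface

variable {X : Type u} [TopologicalSpace X] {S : TranslationSurface X}

/-! ### Gaps persist along orbits -/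

theorem exists_gapChart_of_notMem_sing {M : Set S.Fractured} {τ : ℝ} (hτ : τ = 1 ∨ τ = -1)
    {y : X} (hy : y ∉ S.sing) : ∃ U ∈ 𝓝 y, ∃ c₀ > 0, ∀ c, 0 < c → c ≤ c₀ →
      ∀ x ∈ U, GapChart S M τ c x := by
  obtain ⟨g, hg, hyg⟩ := S.atlas_cover y hy
  obtain ⟨B, r, hr, hyB, -, hE, ha, hb, -⟩ :=
    (isLocalCoord_chart hg hyg).exists_flowBox hy univ_mem
  rw [← hE hyB] at ha hb
  have hre : ∀ᶠ x in 𝓝 y, (B.chart x).re ∈ Ioo ((B.chart y).re - r / 2) ((B.chart y).re + r / 2) :=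
    (Complex.continuous_re.continuousAt.comp (B.chart.continuousAt hyB)).eventually
      (Ioo_mem_nhds (by simp [hr]) (by simp [hr]))
  -- From the inner half of the box a path of length `r / 2` stays in the box.
  refine ⟨_, inter_mem (B.chart.open_source.mem_nhds hyB) hre, r / 2, by positivity,
    fun c _ hcr x hx => Or.inl ⟨B.patch, (B.chart x).re, (B.chart x).im,
      (B.chart.left_inv hx.1).symm, ?_, ?_⟩⟩
  · have := B.chart.map_source hx.1
    rw [B.target_eq] at this
    exact this.2
  have hdom : ∀ u ∈ Ico 0 c, (B.chart x).re + τ * u ∈ Ioo B.a B.b := by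
    intro u hu
    have h1 := hx.2.1
    have h2 := hx.2.2
    have h3 := hu.1
    have h4 := hu.2
    rw [ha, hb]
    rcases hτ with rfl | rfl <;> constructor <;> linarith
  exact ⟨hdom, fun u hu h hh => B.symm_notMem (z := ⟨_, _⟩) (hdom u ⟨hu.1.le, hu.2⟩) hh⟩

/-- If a lane point over `b` is not in the closed set `M`, a neighbourhood of it, which is a piece
of its sector, misses `M`. -/
theorem eventually_sector_notMem [T2Space X] {M : Set S.Fractured} (hM : IsClosed M) (b : S.sing) :
    ∀ᶠ y in 𝓝 (b : X), ∀ m, (∃ p ∈ M, p.1 = .singLane b m) ∨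
      ∀ q : S.Fractured, proj q.1 = y → q.1 ∈ sector b m → q ∉ M := by
  refine eventually_all.2 fun m => ?_
  by_cases h : ∃ p ∈ M, p.1 = .singLane b m
  · exact Eventually.of_forall fun _ => Or.inl h
  let p : S.Fractured := ⟨.singLane b m, mem_fractured_iff.2 fun h =>
    absurd b.2 (notMem_sing_of_mem_critical h)⟩
  have h1 : Mᶜ ∈ 𝓝 p := hM.isOpen_compl.mem_nhds fun hp => h ⟨p, hp, rfl⟩
  rw [nhds_fractured] at h1
  obtain ⟨A, hA, hAM⟩ := h1
  obtain ⟨V, hV, hVA⟩ := mem_comap.1 (mem_inf_principal.1 hA)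
  filter_upwards [hV] with y hy
  refine Or.inr fun q hq hqs => hAM (hVA (a := q.1) ?_ hqs)
  rw [mem_preimage, hq]
  exact hy

/-- A path in direction `τ` either remains in its half-disc for the time `c`, which gives a
rectangle, or runs across the center leaf. Rectangles do not extend across it, since heights of
different sign continue into different half-discs; this is the second kind of chart. -/
theorem exists_gapChart_of_mem_sing [T2Space X] {M : Set S.Fractured} (hM : IsClosed M) {τ : ℝ}
    (hτ : τ = 1 ∨ τ = -1) (b : S.sing) : ∃ U ∈ 𝓝 (b : X), ∃ c₀ > 0, ∀ c, 0 < c → c ≤ c₀ →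
      ∀ x ∈ U, x ∉ S.sing → GapChart S M τ c x := by
  obtain ⟨r, hr, hfit⟩ := exists_halfBox_radius b (eventually_sector_notMem hM b)
  have hsrc := S.mem_cone_source b
  have h0 : S.cone b b ^ S.order b = 0 := by rw [S.cone_self, zero_pow (S.order_pos b).ne']
  have hre : ∀ᶠ y in 𝓝 (b : X), (S.cone b y ^ S.order b).re ∈ Ioo (-(r / 2)) (r / 2) :=
    (Complex.continuous_re.continuousAt.comp (continuousAt_cone_pow b hsrc)).eventually
      (Ioo_mem_nhds (by simp [h0, hr]) (by simp [h0, hr]))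
  have him : ∀ᶠ y in 𝓝 (b : X), (S.cone b y ^ S.order b).im ∈ Ioo (-r) r :=
    (Complex.continuous_im.continuousAt.comp (continuousAt_cone_pow b hsrc)).eventually
      (Ioo_mem_nhds (by simp [h0, hr]) (by simp [h0, hr]))
  refine ⟨_, inter_mem ((S.cone b).open_source.mem_nhds hsrc) (inter_mem hre him), r / 2,
    by positivity, fun c hc hcr x hx hxs => ?_⟩
  obtain ⟨hx1, hx2, hx3⟩ := hx
  change _ ∈ Ioo _ _ at hx2 hx3
  set z := S.cone b x ^ S.order b with hz
  -- On the center line the parity is that of the half-disc into which `τ` points.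
  obtain ⟨e, he2, he⟩ : ∃ e < 2, 0 < (-1) ^ e * z.re ∨ z.re = 0 ∧ (-1 : ℝ) ^ e = τ := by
    rcases lt_trichotomy z.re 0 with h | h | h
    · exact ⟨1, by norm_num, Or.inl (by linarith)⟩
    · rcases hτ with rfl | rfl
      · exact ⟨0, by norm_num, Or.inr ⟨h, by norm_num⟩⟩
      · exact ⟨1, by norm_num, Or.inr ⟨h, by norm_num⟩⟩
    · exact ⟨0, by norm_num, Or.inl (by linarith)⟩
  obtain ⟨m, hm, hmz⟩ := exists_sectorRoot_eq (S.order_pos b) he2 (S.cone b x)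
  rw [← neg_one_pow_congr hm] at he
  let H : S.HalfBox := ⟨b, m, r, fun z h1 h2 _ => (hfit m z h1 h2).1⟩
  have hmap : x = H.map ⟨z.re, z.im⟩ := by
    change x = (S.cone b).symm (sectorRoot _ m z)
    rw [hmz, (S.cone b).left_inv hx1]
  have hrr : z.re ∈ Ioo (-r) r := ⟨by linarith [hx2.1], by linarith [hx2.2]⟩
  have hnn : 0 ≤ (-1) ^ (m : ℕ) * z.re := by
    rcases he with h | h
    · exact h.le
    · rw [h.1, mul_zero]
  have hcase : (∀ u ∈ Ico 0 c, 0 ≤ (-1) ^ (m : ℕ) * (z.re + τ * u)) →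
      (∀ u ∈ Ioo 0 c, 0 < (-1) ^ (m : ℕ) * (z.re + τ * u)) → GapChart S M τ c x := by
    intro h1 h2
    have hdom : ∀ u ∈ Ico 0 c, z.re + τ * u ∈ H.patch.J := by
      refine fun u hu => ⟨?_, h1 u hu⟩
      have h3 := hu.1
      have h4 := hu.2
      have h5 := hx2.1
      have h6 := hx2.2
      change _ ∈ Ioo (-r) r
      rcases hτ with rfl | rfl <;> constructor <;> linarith
    refine Or.inl ⟨H.patch, z.re, z.im, hmap, hx3, hdom, fun u hu h hh => ?_⟩
    have h3 := hdom u ⟨hu.1.le, hu.2⟩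
    refine H.map_notMem_sing h3.1 hh h3.2 fun h0 => ?_
    have h4 := h2 u hu
    rw [show z.re + τ * u = 0 from congrArg Complex.re h0, mul_zero] at h4
    exact lt_irrefl _ h4
  have hττ : τ * τ = 1 := by rcases hτ with rfl | rfl <;> norm_num
  have hmτ : (-1) ^ (m : ℕ) = τ ∨ (-1) ^ (m : ℕ) = -τ := by
    rcases neg_one_pow_eq_or ℝ (m : ℕ) with h | h <;> rcases hτ with rfl | rfl <;> rw [h] <;> simp
  rcases hmτ with h | h
  · have key : ∀ u, (-1) ^ (m : ℕ) * (z.re + τ * u) = (-1) ^ (m : ℕ) * z.re + u := by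
      intro u
      rw [mul_add, h]
      linear_combination u * hττ
    refine hcase (fun u hu => ?_) fun u hu => ?_
    · rw [key]
      linarith [hu.1]
    · rw [key]
      linarith [hu.1]
  · have key : ∀ u, (-1) ^ (m : ℕ) * (z.re + τ * u) = (-1) ^ (m : ℕ) * z.re - u := by
      intro u
      rw [mul_add, h]
      linear_combination -u * hττ
    have hpos : 0 < (-1) ^ (m : ℕ) * z.re := by
      rcases he with h' | h'
      · exact h'
      · rw [h'.2] at h
        have : τ = 0 := by linarith
        rw [this] at hττ
        norm_num at hττ
    rcases le_or_gt c ((-1) ^ (m : ℕ) * z.re) with hle | hgt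
    · refine hcase (fun u hu => ?_) fun u hu => ?_
      · rw [key]
        linarith [hu.2]
      · rw [key]
        linarith [hu.2]
    -- The path crosses the center leaf. The radius `r` was chosen so that the dichotomy of
    -- `eventually_sector_notMem` holds throughout the box.
    · refine Or.inr ⟨H, z.re, z.im, hmap, ⟨hrr, hnn⟩, hx3, h, hpos, hgt, ?_⟩
      by_cases hp : ∃ p ∈ M, p.1 = .singLane b m
      · exact Or.inl hp
      · refine Or.inr fun p hp' hpr => ?_
        obtain ⟨y, hy⟩ := hpr
        have h1 : proj p.1 = H.map ⟨y.1.1.pos, y.2⟩ := by rw [← hy, H.proj_lift]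
        have h2 := (hfit m ⟨y.1.1.pos, y.2⟩ y.1.1.2.1 y.2.2).2 m
        exact (h2.resolve_left hp) p h1 (hy ▸ H.lift_mem_sector y) hp'

theorem exists_gapChart [T2Space X] [CompactSpace X] {M : Set S.Fractured} (hM : IsClosed M)
    {τ : ℝ} (hτ : τ = 1 ∨ τ = -1) : ∃ c₀ > 0, ∀ c, 0 < c → c ≤ c₀ →
      ∀ x ∉ S.sing, GapChart S M τ c x := by
  have := isCompact_univ.induction_on (p := fun U : Set X => ∃ c₀ > 0, ∀ c, 0 < c → c ≤ c₀ →
      ∀ x ∈ U, x ∉ S.sing → GapChart S M τ c x) ⟨1, one_pos, fun _ _ _ _ h => h.elim⟩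
    (fun U V hUV ⟨c₀, h0, h⟩ => ⟨c₀, h0, fun c h1 h2 x hx => h c h1 h2 x (hUV hx)⟩)
    (fun U V ⟨c₀, h0, h⟩ ⟨c₁, h0', h'⟩ => ⟨min c₀ c₁, lt_min h0 h0', fun c h1 h2 x hx =>
      hx.elim (h c h1 (h2.trans (min_le_left _ _)) x)
        (h' c h1 (h2.trans (min_le_right _ _)) x)⟩)
    (fun y _ => by
      by_cases hy : y ∈ S.sing
      · obtain ⟨U, hU, h⟩ := exists_gapChart_of_mem_sing hM hτ ⟨y, hy⟩
        exact ⟨U, mem_nhdsWithin_of_mem_nhds hU, h⟩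
      · obtain ⟨U, hU, c₀, h0, h⟩ := exists_gapChart_of_notMem_sing (M := M) hτ hy
        exact ⟨U, mem_nhdsWithin_of_mem_nhds hU, c₀, h0, fun c h1 h2 x hx _ => h c h1 h2 x hx⟩)
  obtain ⟨c₀, h0, h⟩ := this
  exact ⟨c₀, h0, fun c h1 h2 x hx => h c h1 h2 x (mem_univ x) hx⟩

variable {ψ : Flow ℝ S.Fractured}

/-- Along the nonsingular half-orbit the existence of a gap of fixed length `c` is locally constant
in time. -/
theorem IsVerticalFlow.hasGap_orbit [T2Space X] (hψ : IsVerticalFlow ψ)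
    {M : Set S.Fractured} (hM : IsInvariant ψ M) {τ c σ : ℝ} (hc : 0 < c)
    (hG : ∀ x ∉ S.sing, GapChart S M τ c x) {p : S.Fractured} (hp : p ∈ M)
    (hns : ∀ t ≥ 0, proj (ψ (σ * t) p).1 ∉ S.sing)
    (h : HasGap S ((fun p : S.Fractured => proj p.1) '' M) τ c (proj p.1)) {t : ℝ} (ht : 0 ≤ t) :
    HasGap S ((fun p : S.Fractured => proj p.1) '' M) τ c (proj (ψ (σ * t) p).1) := by
  let f : Ici (0 : ℝ) → Prop := fun t =>
    HasGap S ((fun p : S.Fractured => proj p.1) '' M) τ c (proj (ψ (σ * t) p).1)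
  have hf : IsLocallyConstant f := by
    rw [IsLocallyConstant.iff_eventually_eq]
    intro t
    have h2 : Tendsto (fun r : Ici (0 : ℝ) => σ * r - σ * t) (𝓝 t) (𝓝 0) := by
      have : Continuous fun r : Ici (0 : ℝ) => σ * r - σ * t := by fun_prop
      simpa using this.tendsto t
    filter_upwards [h2.eventually (hψ.eventually_hasGap_iff hM hc (hM (σ * t) hp) (hns t t.2)
      (hG _ (hns t t.2)))] with r hr
    rw [flow_sub_add] at hr
    exact propext hr
  have : PreconnectedSpace (Ici (0 : ℝ)) := Subtype.preconnectedSpace isPreconnected_Ici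
  have h3 := hf.apply_eq_of_preconnectedSpace ⟨t, ht⟩ ⟨0, self_mem_Ici⟩
  change f ⟨t, ht⟩
  rw [h3]
  simpa [f] using h

end TranslationSurface

namespace TranslationSurface

variable {X : Type u} [TopologicalSpace X] {S : TranslationSurface X}

/-! ### Closed invariant sets -/

variable {ψ : Flow ℝ S.Fractured}

namespace IsVerticalFlow

/-- A gap does not contain points of an invariant set that lie in the same box. -/
theorem not_hasGap_prodBox [T2Space X] (hψ : IsVerticalFlow ψ) {M : Set S.Fractured}
    (hM : IsInvariant ψ M) (B : S.ProdBox) {s s' : B.T} {h h' : Ioo B.patch.lo B.patch.hi}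
    {q q' : S.Fractured} (hq : B.lift (s, h) = q.1) (hq' : B.lift (s', h') = q'.1) (hqM : q' ∈ M)
    {τ c : ℝ} (hτ : τ * τ = 1) (h1 : 0 < τ * (B.pos s' - B.pos s))
    (h2 : τ * (B.pos s' - B.pos s) < c) :
    ¬ HasGap S ((fun p : S.Fractured => proj p.1) '' M) τ c (proj q.1) := by
  rintro ⟨η, h3, h4, h5⟩
  set d := τ * (B.pos s' - B.pos s) with hd
  have hsd : B.pos s + τ * d = B.pos s' := by
    rw [hd]
    linear_combination (B.pos s' - B.pos s) * hτ
  have hdom : ∀ u ∈ Icc 0 d, B.pos s + τ * u ∈ B.patch.J := by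
    intro u hu
    refine B.patch.ordConnected.uIcc_subset (B.pos_mem s) (B.pos_mem s') ?_
    have e : B.pos s' = B.pos s + τ * d := hsd.symm
    rw [e, mem_uIcc]
    rcases le_total 0 τ with h | h
    · left; constructor <;> nlinarith [hu.1, hu.2]
    · right; constructor <;> nlinarith [hu.1, hu.2]
  have h6 := (h4.mono (J' := Icc 0 d) fun u hu => ⟨hu.1, hu.2.trans_lt h2⟩).eqOn_horizontal
    ordConnected_Icc B.patch h.2 hdom (u₀ := 0) ⟨le_rfl, h1.le⟩ (by
      rw [h3, ← hq, B.proj_lift]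
      simp)
  have h7 := h6 (x := d) ⟨h1.le, le_rfl⟩
  simp only [hsd] at h7
  refine h5 d ⟨h1, h2⟩ ⟨ψ (h - h') q', hM _ hqM, ?_⟩
  simp only
  rw [hψ.apply_lift B hq' h, B.proj_lift, h7]

/-- The orbit is followed in a time direction without singularities, along which gaps of length `c'`
persist. Two late visits to one box at positions closer than `c'` put one point into the gap of the
other, or lie on one vertical line and close up the orbit. -/
theorem not_hasGap [T2Space X] [CompactSpace X] [ConnectedSpace X] (hψ : IsVerticalFlow ψ)
    (hS : S.NoSaddleConnections) (hsing : S.sing.Nonempty) {M : Set S.Fractured}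
    (hM : IsInvariant ψ M) (hMc : IsClosed M) {p : S.Fractured} (hp : p ∈ M)
    (hns : proj p.1 ∉ S.sing) {τ c : ℝ} (hτ : τ = 1 ∨ τ = -1) (hc : 0 < c) :
    ¬ HasGap S ((fun p : S.Fractured => proj p.1) '' M) τ c (proj p.1) := by
  intro hgap
  obtain ⟨σ, hσ, hσns⟩ : ∃ σ : ℝ, (σ = 1 ∨ σ = -1) ∧ ∀ t ≥ 0, proj (ψ (σ * t) p).1 ∉ S.sing := by
    by_cases hf : S.FallsIntoSing 1 (proj p.1)
    · exact ⟨-1, Or.inr rfl, fun t ht h =>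
        hS.not_falls (Or.inl rfl) hf (hψ.fallsIntoSing_of_mem_sing ht hns h)⟩
    · exact ⟨1, Or.inl rfl, fun t ht h => hf (hψ.fallsIntoSing_of_mem_sing ht hns h)⟩
  have hττ : τ * τ = 1 := by rcases hτ with rfl | rfl <;> norm_num
  obtain ⟨c₀, h0, hG⟩ := exists_gapChart hMc hτ
  set c' := min c c₀ with hc'
  have hc'0 : 0 < c' := lt_min hc h0
  have hgaps : ∀ t ≥ 0, HasGap S ((fun p : S.Fractured => proj p.1) '' M) τ c'
      (proj (ψ (σ * t) p).1) := fun t ht =>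
    hψ.hasGap_orbit hM hc'0 (hG c' hc'0 (min_le_right _ _)) hp hσns
      (hgap.mono (min_le_left _ _)) ht
  have : CompactSpace S.Fractured := compactSpace_fractured
  let F : Ultrafilter ℝ := Ultrafilter.of atTop
  have hF : (F : Filter ℝ) ≤ atTop := Ultrafilter.of_le _
  obtain ⟨q, -, hq⟩ := isCompact_univ.ultrafilter_le_nhds (F.map fun t => ψ (σ * t) p) (by simp)
  have hq' : Tendsto (fun t => ψ (σ * t) p) F (𝓝 q) := hq
  obtain ⟨B, ⟨s₀, h₀⟩, hB⟩ := exists_prodBox q.1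
  have h3 : Tendsto (fun t => (ψ (σ * t) p).1) F (map B.lift (𝓝 (s₀, h₀))) := by
    rw [B.map_nhds, hB]
    exact (continuous_subtype_val.tendsto q).comp hq'
  have h4 : ∀ᶠ y : B.T × Ioo B.patch.lo B.patch.hi in 𝓝 (s₀, h₀),
      |B.pos y.1 - B.pos s₀| < c' / 2 ∧ |(y.2 : ℝ) - h₀| < 1 / 2 := by
    have k1 : Continuous fun y : B.T × Ioo B.patch.lo B.patch.hi => |B.pos y.1 - B.pos s₀| :=
      ((B.continuous_pos.comp continuous_fst).sub continuous_const).abs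
    have k2 : Continuous fun y : B.T × Ioo B.patch.lo B.patch.hi => |(y.2 : ℝ) - h₀| := by
      fun_prop
    exact ((k1.tendsto (s₀, h₀)).eventually (gt_mem_nhds (by simpa using hc'0))).and
      ((k2.tendsto (s₀, h₀)).eventually (gt_mem_nhds (by simp)))
  have h5 : ∀ᶠ t in (F : Filter ℝ), ∃ y : B.T × Ioo B.patch.lo B.patch.hi,
      B.lift y = (ψ (σ * t) p).1 ∧ |B.pos y.1 - B.pos s₀| < c' / 2 ∧ |(y.2 : ℝ) - h₀| < 1 / 2 := by
    exact h3.eventually (p := fun r => ∃ y, B.lift y = r ∧ |B.pos y.1 - B.pos s₀| < c' / 2 ∧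
      |(y.2 : ℝ) - h₀| < 1 / 2) (eventually_map.2 (h4.mono fun y hy => ⟨y, rfl, hy⟩))
  obtain ⟨t₁, ⟨⟨s₁, y₁⟩, e₁, a₁, b₁⟩, g₁⟩ := (h5.and (hF (eventually_ge_atTop 0))).exists
  -- The heights differ by less than `1` and the times by at least `2`, so coinciding lines yield a
  -- nonzero period.
  obtain ⟨t₂, ⟨⟨s₂, y₂⟩, e₂, a₂, b₂⟩, g₂⟩ := (h5.and (hF (eventually_ge_atTop (t₁ + 2)))).exists
  simp only at a₁ b₁ a₂ b₂
  rw [abs_lt] at a₁ b₁ a₂ b₂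
  rcases lt_trichotomy 0 (τ * (B.pos s₂ - B.pos s₁)) with h | h | h
  · refine hψ.not_hasGap_prodBox hM B e₁ e₂ (hM _ hp) hττ h ?_ (hgaps t₁ g₁)
    rcases hτ with rfl | rfl <;> linarith
  · have hpos : B.pos s₁ = B.pos s₂ := by
      rcases hτ with rfl | rfl <;> linarith
    have hlane : B.lane s₁ = B.lane s₂ := by
      rw [← B.lane_lift (s₁, y₁), ← B.lane_lift (s₂, y₂), e₁, e₂, hψ.lane_eq, hψ.lane_eq]
    have hs := B.ext _ _ hpos hlane
    subst hs
    have k1 := hψ.apply_lift B e₁ y₂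
    rw [e₂] at k1
    have k2 : ψ (σ * t₂ + -(y₂ - y₁)) p = ψ (σ * t₁) p := by
      rw [add_comm, ψ.map_add, ← Subtype.ext k1, ← ψ.map_add]
      simp
    rw [← flow_sub_add _ (σ * t₁)] at k2
    refine hψ.not_periodic hS hsing _ ?_ k2
    rcases hσ with rfl | rfl
    · have : 0 < (1 : ℝ) * t₂ + -((y₂ : ℝ) - y₁) - 1 * t₁ := by linarith
      exact this.ne'
    · have : (-1 : ℝ) * t₂ + -((y₂ : ℝ) - y₁) - -1 * t₁ < 0 := by linarith
      exact this.ne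
  · refine hψ.not_hasGap_prodBox hM B e₂ e₁ (hM _ hp) hττ ?_ ?_ (hgaps t₂ (by linarith))
    · linarith
    · rcases hτ with rfl | rfl <;> linarith

/-- An invariant closed set without gaps has an open projection away from the singularities. -/
theorem image_mem_nhds [T2Space X] [CompactSpace X] (hψ : IsVerticalFlow ψ)
    {M : Set S.Fractured} (hM : IsInvariant ψ M) (hMc : IsClosed M)
    (hgap : ∀ q ∈ M, proj q.1 ∉ S.sing → ∀ τ : ℝ, τ = 1 ∨ τ = -1 → ∀ c > 0,
      ¬ HasGap S ((fun p : S.Fractured => proj p.1) '' M) τ c (proj q.1))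
    {x : X} (hx : x ∈ (fun p : S.Fractured => proj p.1) '' M) (hns : x ∉ S.sing) :
    (fun p : S.Fractured => proj p.1) '' M ∈ 𝓝 x := by
  set N := (fun p : S.Fractured => proj p.1) '' M with hN
  have : CompactSpace S.Fractured := compactSpace_fractured
  have hNc : IsClosed N := (hMc.isCompact.image continuous_proj_fractured).isClosed
  obtain ⟨g, hg, hxg⟩ := S.atlas_cover x hns
  obtain ⟨B, r, hr, hxB, -, hE, ha, hb, hc, hd⟩ :=
    (isLocalCoord_chart hg hxg).exists_flowBox hns univ_mem
  rw [← hE hxB] at ha hb hc hd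
  set z := B.chart x with hz
  have hzim : z.im ∈ Ioo B.c B.d := by rw [hc, hd]; constructor <;> linarith
  have hsecx : B.chart.symm ⟨z.re, z.im⟩ = x := B.chart.left_inv hxB
  have hline : ∀ τ : ℝ, τ = 1 ∨ τ = -1 → ∀ d ≥ 0, d < r →
      B.chart.symm ⟨z.re + τ * d, z.im⟩ ∈ N := by
    intro τ hτ d hd0 hdr
    by_contra hnd
    have hdom : ∀ u ∈ Icc 0 d, z.re + τ * u ∈ Ioo B.a B.b := by
      intro u hu
      have h3 := hu.1
      have h4 := hu.2
      rw [ha, hb]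
      rcases hτ with rfl | rfl <;> constructor <;> linarith
    have hcont : ContinuousOn (fun u : ℝ => B.chart.symm ⟨z.re + τ * u, z.im⟩) (Icc 0 d) := by
      refine B.patch.continuousOn.comp (f := fun u : ℝ => (⟨z.re + τ * u, z.im⟩ : ℂ)) ?_
        fun u hu => ⟨hdom u hu, hzim⟩
      have : (fun u : ℝ => (⟨z.re + τ * u, z.im⟩ : ℂ)) = fun u : ℝ => z + ((τ * u : ℝ) : ℂ) := by
        funext u
        apply Complex.ext <;> simp
      rw [this]
      fun_prop
    have hA : IsCompact (Icc 0 d ∩ (fun u : ℝ => B.chart.symm ⟨z.re + τ * u, z.im⟩) ⁻¹' N) :=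
      isCompact_Icc.of_isClosed_subset (hcont.preimage_isClosed_of_isClosed isClosed_Icc hNc)
        inter_subset_left
    -- From the last point of `N` on the segment there would start a gap. So `N` contains the whole
    -- horizontal segment, and by invariance the whole box.
    obtain ⟨u₀, ⟨hu₀, hu₀N⟩, hmax⟩ := hA.exists_isGreatest ⟨0, ⟨le_rfl, hd0⟩, by
      simpa [hsecx] using hx⟩
    have hlt : u₀ < d := lt_of_le_of_ne hu₀.2 fun h => hnd (h ▸ hu₀N)
    obtain ⟨q, hq, hqx⟩ := hu₀N
    simp only at hqx
    have hgap' := hgap q hq (by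
      rw [hqx]
      exact B.symm_notMem (z := ⟨_, _⟩) (hdom u₀ hu₀) hzim) τ hτ (d - u₀) (by linarith)
    rw [hqx] at hgap'
    have hdom' : ∀ u ∈ Ico 0 (d - u₀), z.re + τ * u₀ + τ * u ∈ Ioo B.a B.b := by
      intro u hu
      rw [add_assoc, ← mul_add]
      exact hdom _ ⟨by linarith [hu.1, hu₀.1], by linarith [hu.2]⟩
    refine hgap' ((hasGap_iff B.patch (sub_pos.2 hlt) hzim hdom' fun u hu =>
      B.symm_notMem (z := ⟨_, _⟩) (hdom' u hu) hzim).2 fun u hu hmem => ?_)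
    rw [add_assoc, ← mul_add] at hmem
    have := hmax ⟨⟨by linarith [hu.1, hu₀.1], by linarith [hu.2]⟩, hmem⟩
    linarith [hu.1]
  refine mem_of_superset (B.chart.open_source.mem_nhds hxB) fun y hy => ?_
  have h1 := B.chart.map_source hy
  rw [B.target_eq] at h1
  have h2 : B.chart.symm ⟨(B.chart y).re, z.im⟩ ∈ N := by
    have h3 := h1.1
    rw [mem_preimage, ha, hb] at h3
    rcases le_total z.re (B.chart y).re with h | h
    · have := hline 1 (Or.inl rfl) ((B.chart y).re - z.re) (by linarith) (by linarith [h3.2])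
      rwa [one_mul, add_sub_cancel] at this
    · have := hline (-1) (Or.inr rfl) (z.re - (B.chart y).re) (by linarith) (by linarith [h3.1])
      rwa [show z.re + -1 * (z.re - (B.chart y).re) = (B.chart y).re by ring] at this
  have h3 := (hψ.image_patch hM B.patch (s := (B.chart y).re) h1.1
    (fun h hh => B.symm_notMem (z := ⟨_, _⟩) h1.1 hh) hzim h1.2).1 h2
  have h4 : B.patch.sec ⟨(B.chart y).re, (B.chart y).im⟩ = y := B.chart.left_inv hy
  rwa [h4] at h3

end IsVerticalFlow

/-- A punctured disc is the image of a half-plane under the exponential map. -/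
theorem isPreconnected_ball_diff_zero (ε : ℝ) :
    IsPreconnected (Metric.ball (0 : ℂ) ε \ {0}) := by
  rcases le_or_gt ε 0 with h | h
  · rw [Metric.ball_eq_empty.2 h, empty_sdiff]
    exact isPreconnected_empty
  have : Metric.ball (0 : ℂ) ε \ {0} = Complex.exp '' {z | z.re < Real.log ε} := by
    ext z
    simp only [Set.mem_sdiff, mem_ball_zero_iff, mem_singleton_iff, mem_image]
    constructor
    · rintro ⟨h1, h2⟩
      refine ⟨Complex.log z, ?_, Complex.exp_log h2⟩
      change (Complex.log z).re < _
      rw [Complex.log_re]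
      exact Real.log_lt_log (norm_pos_iff.2 h2) h1
    · rintro ⟨w, hw, rfl⟩
      refine ⟨?_, Complex.exp_ne_zero w⟩
      rw [Complex.norm_exp]
      exact (Real.lt_log_iff_exp_lt h).1 hw
  rw [this]
  exact (convex_halfSpace_re_lt _).isPreconnected.image _ Complex.continuous_exp.continuousOn

namespace IsVerticalFlow

/-- At a singularity in `N`, the orbit through the lane point enters the punctured disc. There `N`
is closed and open, hence all of it. -/
theorem image_eq_univ [T2Space X] [CompactSpace X] [ConnectedSpace X] (hψ : IsVerticalFlow ψ)
    (hS : S.NoSaddleConnections) (hsing : S.sing.Nonempty) {M : Set S.Fractured}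
    (hM : IsInvariant ψ M) (hMc : IsClosed M) (hMn : M.Nonempty) :
    (fun p : S.Fractured => proj p.1) '' M = univ := by
  have hint : ∀ {x}, x ∈ (fun p : S.Fractured => proj p.1) '' M → x ∉ S.sing →
      (fun p : S.Fractured => proj p.1) '' M ∈ 𝓝 x :=
    hψ.image_mem_nhds hM hMc fun q hq hns τ hτ c hc =>
      hψ.not_hasGap hS hsing hM hMc hq hns hτ hc
  set N := (fun p : S.Fractured => proj p.1) '' M with hN
  have : CompactSpace S.Fractured := compactSpace_fractured
  have hNc : IsClosed N := (hMc.isCompact.image continuous_proj_fractured).isClosed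
  refine IsClopen.eq_univ ⟨hNc, isOpen_iff_mem_nhds.2 fun x hx => ?_⟩ (hMn.image _)
  by_cases hs : x ∈ S.sing
  swap
  · exact hint hx hs
  obtain ⟨q, hq, rfl⟩ := hx
  simp only at hs ⊢
  set b : S.sing := ⟨proj q.1, hs⟩ with hb
  have hsrc := S.mem_cone_source b
  have ht : (S.cone b).target ∈ 𝓝 (0 : ℂ) := by
    rw [← S.cone_self b]
    exact (S.cone b).open_target.mem_nhds ((S.cone b).map_source hsrc)
  obtain ⟨ε, hε, hball⟩ := Metric.mem_nhds_iff.1 ht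
  have hD : IsPreconnected ((S.cone b).symm '' (Metric.ball 0 ε \ {0})) :=
    (isPreconnected_ball_diff_zero ε).image _
      ((S.cone b).continuousOn_symm.mono (sdiff_subset.trans hball))
  have hDns : ∀ y ∈ (S.cone b).symm '' (Metric.ball 0 ε \ {0}), y ∉ S.sing := by
    rintro _ ⟨w, hw, rfl⟩ hy
    have h1 := eq_of_mem_cone_source ((S.cone b).map_target (hball hw.1)) hy
    have h2 := (S.cone b).right_inv (hball hw.1)
    rw [h1, S.cone_self] at h2
    exact hw.2 h2.symm
  have hU : ∀ᶠ y in 𝓝 (proj q.1), y ∈ (S.cone b).source ∧ S.cone b y ∈ Metric.ball (0 : ℂ) ε := by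
    refine Eventually.and ((S.cone b).open_source.mem_nhds hsrc) ?_
    have := (S.cone b).continuousAt hsrc
    rw [ContinuousAt, S.cone_self] at this
    exact this.eventually (Metric.ball_mem_nhds 0 hε)
  have hUD : ∀ y, y ∉ S.sing → y ∈ (S.cone b).source ∧ S.cone b y ∈ Metric.ball (0 : ℂ) ε →
      y ∈ (S.cone b).symm '' (Metric.ball 0 ε \ {0}) := by
    refine fun y hy h => ⟨S.cone b y, ⟨h.2, fun h0 => hy ?_⟩, (S.cone b).left_inv h.1⟩
    have h0' : S.cone b y = 0 := h0
    rw [← S.cone_self b] at h0'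
    rw [(S.cone b).injOn h.1 hsrc h0']
    exact b.2
  have hsub : (S.cone b).symm '' (Metric.ball 0 ε \ {0}) ⊆ interior N := by
    refine hD.subset_left_of_subset_union isOpen_interior hNc.isOpen_compl
      (disjoint_compl_right.mono_left interior_subset) (fun y hy => ?_) ?_
    · by_cases hyN : y ∈ N
      · exact Or.inl (mem_interior_iff_mem_nhds.2 (hint hyN (hDns y hy)))
      · exact Or.inr hyN
    · have h1 : Tendsto (fun δ => proj (ψ δ q).1) (𝓝 0) (𝓝 (proj q.1)) := by
        have := (continuous_path ψ 1 q).tendsto 0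
        simpa using this
      have h2 := ((h1.eventually hU).and (hψ.eventually_notMem_sing hs)).filter_mono
        (nhdsWithin_le_nhds (s := {0}ᶜ))
      obtain ⟨δ, ⟨h3, h4⟩, h5⟩ := (h2.and self_mem_nhdsWithin).exists
      have h6 := h4 h5
      have h7 : proj (ψ δ q).1 ∈ N := ⟨_, hM δ hq, rfl⟩
      exact ⟨_, hUD _ h6 h3, mem_interior_iff_mem_nhds.2 (hint h7 h6)⟩
  filter_upwards [hU] with y hy
  by_cases hys : y ∈ S.sing
  · rw [eq_of_mem_cone_source hy.1 hys]
    exact ⟨q, hq, rfl⟩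
  · exact interior_subset (hsub (hUD y hys hy))

end IsVerticalFlow

end TranslationSurface

/-! ### Minimality -/

namespace TranslationSurface

variable {X : Type u} [TopologicalSpace X] {S : TranslationSurface X}

/-- Open sets of the fractured surface contain whole fibers over nonsingular points. -/
theorem exists_fiber_subset [T2Space X] {p : S.Fractured} (hp : proj p.1 ∉ S.sing)
    {O : Set S.Fractured} (hO : O ∈ 𝓝 p) : ∃ x : X, ∀ q : S.Fractured, proj q.1 = x → q ∈ O := by
  obtain ⟨c, hc, hxc⟩ := S.atlas_cover _ hp
  rw [nhds_fractured, nhdsFilter_eq hp (isLocalCoord_chart hc hxc)] at hO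
  obtain ⟨A, hA, hAO⟩ := hO
  obtain ⟨V, hV, hVA⟩ := mem_comap.1 (mem_inf_principal.1 hA)
  set l : ℝ := (lane p.1 : ℝ) with hl
  have h1 : Tendsto (fun δ : ℝ => c.symm (c (proj p.1) + ((l * δ : ℝ) : ℂ))) (𝓝 0)
      (𝓝 (proj p.1)) := by
    have h2 : Continuous fun δ : ℝ => c (proj p.1) + ((l * δ : ℝ) : ℂ) := by fun_prop
    have h3 := h2.tendsto 0
    simp only [mul_zero, Complex.ofReal_zero, add_zero] at h3
    exact (c.tendsto_symm hxc).comp h3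
  have h4 : ∀ᶠ δ : ℝ in 𝓝 0, c (proj p.1) + ((l * δ : ℝ) : ℂ) ∈ c.target := by
    have h2 : Continuous fun δ : ℝ => c (proj p.1) + ((l * δ : ℝ) : ℂ) := by fun_prop
    refine (h2.tendsto 0).eventually (c.open_target.mem_nhds ?_)
    simpa using c.map_source hxc
  -- A small step to the side of the lane leads to a point all of whose fibre is on that side. For
  -- lane `0` the step has length `0`, and there is no side condition.
  obtain ⟨δ, ⟨h5, h6⟩, h7⟩ := (((h1.eventually hV).and h4).filter_mono
    (nhdsWithin_le_nhds (s := Ioi 0))).and self_mem_nhdsWithin |>.exists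
  refine ⟨c.symm (c (proj p.1) + ((l * δ : ℝ) : ℂ)), fun q hq => hAO (hVA (a := q.1) ?_ ?_)⟩
  · rw [mem_preimage, hq]
    exact h5
  · change laneSide _ _ _ _
    rw [hq, c.right_inv h6, Complex.add_re, Complex.ofReal_re]
    by_cases h0 : lane p.1 = 0
    · exact Or.inl h0
    · refine Or.inr (Or.inl ?_)
      have h8 : l ≠ 0 := by
        rw [hl]
        rcases h9 : lane p.1 with _ | _ | _
        · exact absurd h9 h0
        · simp
        · simp
      rw [add_sub_cancel_left, ← hl, ← mul_assoc]
      exact mul_pos (mul_self_pos.2 h8) h7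

variable {ψ : Flow ℝ S.Fractured}

/-- `M` meets every fibre, and every neighbourhood of a point over `X` off the singularities
contains a fibre, so such points lie in the closure of `M`. The flow carries the lane points over
singularities to points of this kind. -/
theorem IsVerticalFlow.eq_univ [T2Space X] [CompactSpace X] [ConnectedSpace X]
    (hψ : IsVerticalFlow ψ) (hS : S.NoSaddleConnections) (hsing : S.sing.Nonempty)
    {M : Set S.Fractured} (hM : IsInvariant ψ M) (hMc : IsClosed M) (hMn : M.Nonempty) :
    M = univ := by
  have hN := hψ.image_eq_univ hS hsing hM hMc hMn
  have key : ∀ p : S.Fractured, proj p.1 ∉ S.sing → p ∈ M := by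
    intro p hp
    rw [← hMc.closure_eq, mem_closure_iff_nhds]
    intro O hO
    obtain ⟨x, hx⟩ := exists_fiber_subset hp hO
    obtain ⟨q, hq, hqx⟩ : x ∈ (fun p : S.Fractured => proj p.1) '' M := hN ▸ mem_univ x
    exact ⟨q, hx q hqx, hq⟩
  refine eq_univ_of_forall fun p => ?_
  by_cases hp : proj p.1 ∈ S.sing
  · obtain ⟨δ, h1, h2⟩ := (((hψ.eventually_notMem_sing hp).filter_mono
      (nhdsWithin_le_nhds (s := {0}ᶜ))).and self_mem_nhdsWithin).exists
    have := hM (-δ) (key _ (h1 h2))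
    rwa [← ψ.map_add, neg_add_cancel, ψ.map_zero_apply] at this
  · exact key p hp

end TranslationSurface

/-- By compactness the omega-limit set is nonempty, and it is closed and invariant; it lies in the
closure of the forward orbit. -/
theorem Flow.dense_forwardOrbit {K : Type*} [TopologicalSpace K] [CompactSpace K] (φ : Flow ℝ K)
    (h : ∀ M : Set K, IsInvariant φ M → IsClosed M → M.Nonempty → M = univ) (p : K) :
    Dense (φ.forwardOrbit p) := by
  have h1 : omegaLimit atTop φ {p} = univ :=
    h _ (φ.isInvariant_omegaLimit atTop {p} fun t => tendsto_atTop_add_const_left _ t tendsto_id)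
      (isClosed_omegaLimit _ _ _) (nonempty_omegaLimit _ _ _ (singleton_nonempty p))
  rw [dense_iff_closure_eq, ← univ_subset_iff, ← h1]
  refine (omegaLimit_subset_closure_image2 _ _ _ (Ici_mem_atTop 0)).trans (closure_mono ?_)
  rintro _ ⟨t, ht, _, rfl, rfl⟩
  rw [Flow.forwardOrbit_eq_range_nonneg]
  exact ⟨⟨t, ht⟩, rfl⟩

end

theorem mainTheorem7 {X : Type*} [TopologicalSpace X] [CompactSpace X] [T2Space X]
    [ConnectedSpace X] (S : TranslationSurface X) (hsing : S.sing.Nonempty)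
    (hS : S.NoSaddleConnections) :
    CompactSpace S.Fractured ∧ T2Space S.Fractured ∧
      ∃ ψ : Flow ℝ S.Fractured,
        (∀ (t : ℝ) (p : S.Fractured) (q : S.Divided), (ψ t p : S.Divided) = q ↔ S.VerticalFlow t p q) ∧
        (∀ p : S.Fractured, Dense (ψ.forwardOrbit p)) ∧
        (∀ p : S.Fractured, Dense (ψ.reverse.forwardOrbit p)) := by
  have hK : CompactSpace S.Fractured := TranslationSurface.compactSpace_fractured
  obtain ⟨ψ, hψ⟩ := TranslationSurface.exists_verticalFlow S
  have hψ' : TranslationSurface.IsVerticalFlow ψ := hψ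
  refine ⟨hK, TranslationSurface.t2Space_fractured, ψ, hψ,
    ψ.dense_forwardOrbit fun M hM hMc hMn => hψ'.eq_univ hS hsing hM hMc hMn,
    ψ.reverse.dense_forwardOrbit fun M hM hMc hMn => hψ'.eq_univ hS hsing (fun t p hp => ?_) hMc hMn⟩
  have := hM (-t) hp
  rwa [Flow.reverse_apply, neg_neg] at this
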